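/- For integers $1\le k\le n$ let $f(x)=1$ iff $x_1+\dots+x_n\ge k$ be the $k$-of-$n$ function on $\{0,1\}^n$, and let $x_1,\dots,x_n$ be independent with $\Pr[x_i=1]=p_i$, where the $p_i\in(0,1)$ are rational numbers given by numerators and denominators in binary. A non-adaptive policy is an ordering (permutation) of the variables; it tests the variables in this order, learning the value of each tested variable, until the values seen determine $f(x)$. In the unit-cost case its expected cost is the expected number of tests. There is a PTAS for computing an optimal non-adaptive policy in the unit-cost case. More precisely, there are a single random access machine program (with addition, truncated subtraction, multiplication, integer division, tests for zero and arrays over the natural numbers) and a constant $C$ such that, for every $\varepsilon>0$ and every instance $(n,k,p)$ as above, the program, given $n$, $k$, $p$ and $\lceil 1/\varepsilon\rceil$, halts with an ordering whose expected cost is at most $(1+\varepsilon)$ times the minimum expected cost over all orderings. With $L$ the encoding length of the instance, it performs at most $(n+1)^{2^{C\max(1,1/\varepsilon)}}$ steps, that is, $n^{2^{O(1/\varepsilon)}}$ for $n\ge2$ and $\varepsilon\le1$; and the total bit cost of these steps (logarithmic cost, with the product of the operand lengths charged for multiplication and division) is at most $(n+1)^{2^{C\max(1,1/\varepsilon)}}\,(L+1)^{C}$.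 In particular, for fixed $\varepsilon$ the bit cost is polynomial in $L$. -/

import Mathlib

namespace KOfN

/-! ### Stochastic evaluation of Boolean functions by non-adaptive policies -/

/-- The `k`-of-`n` function: it is `true` iff at least `k` of the `n` inputs are `true`. -/
def kOfN (n k : ℕ) (x : Fin n → Bool) : Bool :=
  decide (k ≤ (Finset.univ.filter (fun i => x i = true)).card)

/-- A state of knowledge: `none` is an unknown value, `some b` a variable known to be `b`. -/
abbrev KState (n : ℕ) : Type := Fin n → Option Bool

/-- The input `x` follows from the state `s`: it agrees with every known value. -/
def Follows {n : ℕ} (x : Fin n → Bool) (s : KState n) : Prop :=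
  ∀ i, s i = some (x i) ∨ s i = none

/-- `f` is determined by `s`: it is constant on the inputs that follow from `s`. -/
def Determined {n : ℕ} (f : (Fin n → Bool) → Bool) (s : KState n) : Prop :=
  ∀ x y, Follows x s → Follows y s → f x = f y

/-- A non-adaptive policy is an order of the variables: `σ t` is the variable tested in step `t`
(steps and variables are counted from `0`). This is the state of knowledge after the first `t`
steps on the input `x`. -/
def stateAfter {n : ℕ} (σ : Equiv.Perm (Fin n)) (x : Fin n → Bool) (t : ℕ) : KState n :=
  fun i => if (σ.symm i : ℕ) < t then some (x i) else none

/-- After all `n` tests every function is determined. -/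
theorem determined_stateAfter_all {n : ℕ} (f : (Fin n → Bool) → Bool) (σ : Equiv.Perm (Fin n))
    (x : Fin n → Bool) : Determined f (stateAfter σ x n) := by
  have key : ∀ y, Follows y (stateAfter σ x n) → y = x := by
    intro y hy
    funext i
    have h := hy i
    simp only [stateAfter, (σ.symm i).isLt, if_true] at h
    have h' : x i = y i := by simpa using h
    exact h'.symm
  intro y z hy hz
  rw [key y hy, key z hz]

open Classical in
/-- The number of steps after which `f` is determined for the first time. -/
noncomputable def stopTime {n : ℕ} (f : (Fin n → Bool) → Bool) (σ : Equiv.Perm (Fin n))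
    (x : Fin n → Bool) : ℕ :=
  Nat.find (p := fun t => Determined f (stateAfter σ x t)) ⟨n, determined_stateAfter_all f σ x⟩

/-- The variables that are tested before `f` is determined. -/
noncomputable def testedSet {n : ℕ} (f : (Fin n → Bool) → Bool) (σ : Equiv.Perm (Fin n))
    (x : Fin n → Bool) : Finset (Fin n) :=
  Finset.univ.filter (fun i => (σ.symm i : ℕ) < stopTime f σ x)

/-- The cost of the policy `σ` on the input `x` for the cost vector `c`. -/
noncomputable def cost {n : ℕ} (f : (Fin n → Bool) → Bool) (c : Fin n → ℝ)
    (σ : Equiv.Perm (Fin n)) (x : Fin n → Bool) : ℝ :=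
  ∑ i ∈ testedSet f σ x, c i

/-- The probability of the input `x` when the variables are independent and variable `i` is
`true` with probability `p i`. -/
noncomputable def inputProb {n : ℕ} (p : Fin n → ℝ) (x : Fin n → Bool) : ℝ :=
  ∏ i, if x i = true then p i else 1 - p i

/-- The expected cost of the policy `σ`. -/
noncomputable def expectedCost {n : ℕ} (f : (Fin n → Bool) → Bool) (p c : Fin n → ℝ)
    (σ : Equiv.Perm (Fin n)) : ℝ :=
  ∑ x, inputProb p x * cost f c σ x

/-! ### Random access machines -/

/-- The memory of the machine: registers and random access arrays, all holding natural numbers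
of arbitrary size. -/
structure Mem where
  reg : ℕ → ℕ
  arr : ℕ → ℕ → ℕ

/-- Elementary operations. The names of registers and arrays are part of the program, so that a
program uses finitely many of them; the cells of an array are addressed at run time. -/
inductive Op where
  /-- `reg d := c` -/
  | const (d c : ℕ)
  /-- `reg d := reg x` -/
  | copy (d x : ℕ)
  /-- `reg d := reg x + reg y` -/
  | add (d x y : ℕ)
  /-- `reg d := max (reg x - reg y) 0` -/
  | sub (d x y : ℕ)
  /-- `reg d := reg x * reg y` -/
  | mul (d x y : ℕ)
  /-- `reg d := ⌊reg x / reg y⌋` (and `0` if `reg y = 0`) -/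
  | div (d x y : ℕ)
  /-- `reg d := arr a [reg x]` -/
  | load (d a x : ℕ)
  /-- `arr a [reg x] := reg y` -/
  | store (a x y : ℕ)

/-- Assignment to a register. -/
def Mem.setReg (s : Mem) (d v : ℕ) : Mem :=
  { s with reg := Function.update s.reg d v }

/-- Assignment to a cell of an array. -/
def Mem.setArr (s : Mem) (a i v : ℕ) : Mem :=
  { s with arr := Function.update s.arr a (Function.update (s.arr a) i v) }

/-- The effect of an elementary operation. -/
def Op.apply : Op → Mem → Mem
  | .const d c, s => s.setReg d c
  | .copy d x, s => s.setReg d (s.reg x)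
  | .add d x y, s => s.setReg d (s.reg x + s.reg y)
  | .sub d x y, s => s.setReg d (s.reg x - s.reg y)
  | .mul d x y, s => s.setReg d (s.reg x * s.reg y)
  | .div d x y, s => s.setReg d (s.reg x / s.reg y)
  | .load d a x, s => s.setReg d (s.arr a (s.reg x))
  | .store a x y, s => s.setArr a (s.reg x) (s.reg y)

/-- The bit cost of an elementary operation: the total binary length of the values and run-time
addresses that take part, and the product of the lengths of the operands for multiplication and
division. -/
def Op.bits : Op → Mem → ℕ
  | .const _ c, _ => 1 + c.size
  | .copy _ x, s => 1 + (s.reg x).size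
  | .add _ x y, s => 1 + (s.reg x).size + (s.reg y).size
  | .sub _ x y, s => 1 + (s.reg x).size + (s.reg y).size
  | .mul _ x y, s => (1 + (s.reg x).size) * (1 + (s.reg y).size)
  | .div _ x y, s => (1 + (s.reg x).size) * (1 + (s.reg y).size)
  | .load _ a x, s => 1 + (s.reg x).size + (s.arr a (s.reg x)).size
  | .store _ x y, s => 1 + (s.reg x).size + (s.reg y).size

/-- Programs: operations, sequencing, branching on `reg x ≠ 0` and loops while `reg x ≠ 0`. -/
inductive Prog where
  | skip
  | op (o : Op)
  | seq (P Q : Prog)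
  | ite (x : ℕ) (P Q : Prog)
  | loop (x : ℕ) (P : Prog)

/-- `Exec P s s' t b`: started in the memory `s`, the program `P` halts in the memory `s'` after
`t` steps (elementary operations and tests) of total bit cost `b`. -/
inductive Exec : Prog → Mem → Mem → ℕ → ℕ → Prop where
  | skip (s : Mem) : Exec .skip s s 0 0
  | op (o : Op) (s : Mem) : Exec (.op o) s (o.apply s) 1 (o.bits s)
  | seq {P Q : Prog} {s s₁ s₂ : Mem} {t₁ t₂ b₁ b₂ : ℕ} :
      Exec P s s₁ t₁ b₁ → Exec Q s₁ s₂ t₂ b₂ → Exec (.seq P Q) s s₂ (t₁ + t₂) (b₁ + b₂)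
  | ite_true {x : ℕ} {P Q : Prog} {s s₁ : Mem} {t b : ℕ} :
      s.reg x ≠ 0 → Exec P s s₁ t b →
      Exec (.ite x P Q) s s₁ (1 + t) (1 + (s.reg x).size + b)
  | ite_false {x : ℕ} {P Q : Prog} {s s₁ : Mem} {t b : ℕ} :
      s.reg x = 0 → Exec Q s s₁ t b → Exec (.ite x P Q) s s₁ (1 + t) (1 + b)
  | loop_done {x : ℕ} {P : Prog} {s : Mem} :
      s.reg x = 0 → Exec (.loop x P) s s 1 1
  | loop_step {x : ℕ} {P : Prog} {s s₁ s₂ : Mem} {t₁ t₂ b₁ b₂ : ℕ} :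
      s.reg x ≠ 0 → Exec P s s₁ t₁ b₁ → Exec (.loop x P) s₁ s₂ t₂ b₂ →
      Exec (.loop x P) s s₂ (1 + t₁ + t₂) (1 + (s.reg x).size + b₁ + b₂)

/-- The memory at the start: register `0` holds `n`, register `1` holds `k`, register `2` holds
the accuracy parameter `m`, cell `i` of array `0` and of array `1` hold the numerator and the
denominator of `p i`, for `i < n`; everything else is `0`. -/
def inputMem {n : ℕ} (k : ℕ) (p : Fin n → ℚ) (m : ℕ) : Mem where
  reg r := if r = 0 then n else if r = 1 then k else if r = 2 then m else 0
  arr a i :=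
    if h : i < n then
      if a = 0 then (p ⟨i, h⟩).num.natAbs else if a = 1 then (p ⟨i, h⟩).den else 0
    else 0

/-- The memory holds the order `σ` as output: cell `i` of array `2` is `σ i`, for `i < n`. -/
def Outputs {n : ℕ} (s : Mem) (σ : Equiv.Perm (Fin n)) : Prop :=
  ∀ i : Fin n, s.arr 2 i = (σ i : ℕ)

/-- The encoding length of the unit-cost instance with threshold `k` and probabilities `p`. -/
def encLength {n : ℕ} (k : ℕ) (p : Fin n → ℚ) : ℕ :=
  n.size + k.size + ∑ i, ((p i).num.natAbs.size + (p i).den.size)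

end KOfN

/-! Let q(S) be the probability that the values in S leave the function undetermined. By the
tail-sum formula an order costs the sum of q over its proper prefixes (`expectedCost_eq_sum_undet`).
The function is determined once `k` ones or n-k+1 zeros have been seen. These events exclude each
other, so q is 1 minus two tails (`undet_eq`), and each tail grows when variables are exchanged for
more likely ones, respectively more likely zeros. Hence q(S') ≤ q(S) if, for the order of the
variables by probability, S' has at least as many elements as S above every rank and below every
rank (`undet_le_of_dominates`).

This allows rounding. Cut the variables by rank into blocks holding at most T elements of a set U
with at most W*T elements. Pushing S ⊆ U to the bottom of every block keeps all block counts, so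
counts from below do not decrease and counts from above lose at most T; adding the T topmost missing
variables repairs that. The result is a union of W+1 intervals, and a chain stays a chain
(`exists_interval_chain`).

Split an order into phases from T to W*T with W = 2^w and T = 2^(s+w*j). Inside a phase, follow the
rounded prefixes in steps of T elements. This costs what the order pays in the phase, plus T*q(T)
for the first step and 2T*q(T) for entering the phase, where q(T) belongs to the first T variables.
As the sum of 2^a * q(2^a) over all a is at most twice the cost of the order, some shift s < w makes
the total overhead at most 6/w of the cost (`exists_shift`, `exists_reach`). Conversely a path
through interval unions becomes an order that is no more expensive: list the new elements of each
node. With m the ceiling of 1/ε, the choice w = 6m gives the factor 1+1/m.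

There are at most N = (n+1)^(2Q) unions of Q = 2^(6m+1) intervals, so a shortest path is found by
dynamic programming over their codes. All probabilities are scaled by the product of the
denominators; the distribution of the number of ones in a node is then a product of linear factors
evaluated at a base exceeding every coefficient, and is read off digit by digit.

The resource bounds come from a program logic (`Runs`) that carries a bound `M` on loop lengths and
a bound `V` on all values: the number of steps is polynomial in `M` with degree fixed by the
program, and each step costs at most (1 + `V.size`)^2. -/

namespace KOfN

open Finset

/-! ### Probabilities -/

/-- The number of variables in `S` that are `true`. -/
def ones {n : ℕ} (S : Finset (Fin n)) (x : Fin n → Bool) : ℕ := #{i ∈ S | x i = true}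

/-- The number of variables in `S` that are `false`. -/
def zeros {n : ℕ} (S : Finset (Fin n)) (x : Fin n → Bool) : ℕ := #{i ∈ S | x i = false}

theorem ones_add_zeros {n : ℕ} (S : Finset (Fin n)) (x : Fin n → Bool) :
    ones S x + zeros S x = #S := by
  unfold ones zeros
  rw [← card_filter_add_card_filter_not (s := S) (fun i => x i = true)]
  simp

/-- The probability that at least `c` variables in `S` are `true`. -/
noncomputable def tail {n : ℕ} (p : Fin n → ℝ) (S : Finset (Fin n)) (c : ℕ) : ℝ :=
  ∑ x, inputProb p x * if c ≤ ones S x then 1 else 0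

/-- The probability that the `k`-of-`n` function is not determined by the variables in `S`. -/
noncomputable def undet {n : ℕ} (k : ℕ) (p : Fin n → ℝ) (S : Finset (Fin n)) : ℝ :=
  ∑ x, inputProb p x * if ones S x < k ∧ zeros S x + k ≤ n then 1 else 0

theorem sum_inputProb {n : ℕ} (p : Fin n → ℝ) : ∑ x, inputProb p x = 1 := by
  have h := Finset.prod_univ_sum (fun _ : Fin n => (univ : Finset Bool))
    (fun i b => if b = true then p i else 1 - p i)
  simp only [Fintype.piFinset_univ] at h
  unfold inputProb
  rw [← h]
  simp

theorem inputProb_nonneg {n : ℕ} {p : Fin n → ℝ} (hp : ∀ i, 0 ≤ p i ∧ p i ≤ 1)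
    (x : Fin n → Bool) : 0 ≤ inputProb p x := by
  refine prod_nonneg fun i _ => ?_
  split_ifs
  · exact (hp i).1
  · linarith [(hp i).2]

/-- Conditioning on the variable `a`. Both sums on the right still run over all inputs, because `h`
sees an input in which `a` has been overwritten. -/
theorem sum_inputProb_split {n : ℕ} (p : Fin n → ℝ) (a : Fin n) (h : (Fin n → Bool) → ℝ) :
    ∑ x, inputProb p x * h x =
      p a * ∑ x, inputProb p x * h (Function.update x a true) +
        (1 - p a) * ∑ x, inputProb p x * h (Function.update x a false) := by
  have key : ∀ g : (Fin n → Bool) → ℝ, ∑ x, g x =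
      ∑ y : {j // j ≠ a} → Bool, (g ((Equiv.funSplitAt a Bool).symm (true, y)) +
        g ((Equiv.funSplitAt a Bool).symm (false, y))) := by
    intro g
    rw [← Equiv.sum_comp (Equiv.funSplitAt a Bool).symm g, Fintype.sum_prod_type,
      Fintype.sum_bool, sum_add_distrib]
  have hupd : ∀ (b c : Bool) (y : {j // j ≠ a} → Bool),
      Function.update ((Equiv.funSplitAt a Bool).symm (b, y)) a c =
        (Equiv.funSplitAt a Bool).symm (c, y) := by
    intro b c y
    funext j
    by_cases hj : j = a
    · subst hj; simp [Equiv.funSplitAt]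
    · simp [Equiv.funSplitAt, hj]
  have hw : ∀ (b : Bool) (y : {j // j ≠ a} → Bool),
      inputProb p ((Equiv.funSplitAt a Bool).symm (b, y)) =
        (if b = true then p a else 1 - p a) *
          ∏ j ∈ univ.erase a, if (Equiv.funSplitAt a Bool).symm (true, y) j = true
            then p j else 1 - p j := by
    intro b y
    unfold inputProb
    rw [← mul_prod_erase univ _ (mem_univ a)]
    congr 1
    · simp [Equiv.funSplitAt]
    · refine prod_congr rfl fun j hj => ?_
      have hj' : j ≠ a := (mem_erase.1 hj).1
      simp [Equiv.funSplitAt, hj']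
  rw [key, key, key, mul_sum, mul_sum, ← sum_add_distrib]
  refine sum_congr rfl fun y _ => ?_
  rw [hupd, hupd, hupd, hupd, hw true, hw false]
  simp only [if_true, Bool.false_eq_true, if_false]
  ring

theorem ones_update_of_notMem {n : ℕ} {S : Finset (Fin n)} {a : Fin n} (ha : a ∉ S)
    (x : Fin n → Bool) (b : Bool) : ones S (Function.update x a b) = ones S x := by
  unfold ones
  congr 1
  refine filter_congr fun i hi => ?_
  rw [Function.update_of_ne (by rintro rfl; exact ha hi)]

theorem tail_insert {n : ℕ} (p : Fin n → ℝ) {S : Finset (Fin n)} {a : Fin n} (ha : a ∉ S)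
    (c : ℕ) :
    tail p (insert a S) (c + 1) = p a * tail p S c + (1 - p a) * tail p S (c + 1) := by
  have ht : ∀ x : Fin n → Bool,
      ones (insert a S) (Function.update x a true) = ones S x + 1 := by
    intro x
    unfold ones
    rw [filter_insert, if_pos (by simp), card_insert_of_notMem (by simp [ha])]
    exact congrArg (· + 1) (ones_update_of_notMem ha x true)
  have hf : ∀ x : Fin n → Bool,
      ones (insert a S) (Function.update x a false) = ones S x := by
    intro x
    unfold ones
    rw [filter_insert, if_neg (by simp)]
    exact ones_update_of_notMem ha x false
  unfold tail
  rw [sum_inputProb_split p a]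
  simp only [ht, hf, Nat.add_le_add_iff_right]

theorem tail_zero {n : ℕ} (p : Fin n → ℝ) (S : Finset (Fin n)) : tail p S 0 = 1 := by
  simp [tail, sum_inputProb]

/-! ### Monotonicity of tails and stochastic domination -/

theorem tail_succ_le {n : ℕ} {p : Fin n → ℝ} (hp : ∀ i, 0 ≤ p i ∧ p i ≤ 1)
    (S : Finset (Fin n)) (c : ℕ) : tail p S (c + 1) ≤ tail p S c := by
  refine sum_le_sum fun x _ => mul_le_mul_of_nonneg_left ?_ (inputProb_nonneg hp x)
  split_ifs <;> first | omega | norm_num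

theorem tail_mono_set {n : ℕ} {p : Fin n → ℝ} (hp : ∀ i, 0 ≤ p i ∧ p i ≤ 1)
    {S S' : Finset (Fin n)} (h : S ⊆ S') (c : ℕ) : tail p S c ≤ tail p S' c := by
  refine sum_le_sum fun x _ => mul_le_mul_of_nonneg_left ?_ (inputProb_nonneg hp x)
  have : ones S x ≤ ones S' x := card_le_card (filter_subset_filter _ h)
  split_ifs <;> first | omega | norm_num

/-- The elements are replaced one at a time. By `tail_insert` the tail is an average of the tails at
`c` and `c + 1` with weight `p a` on the first, which is the larger one, so raising `p a` to `p (f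
a)` raises the average. -/
theorem tail_le_image {n : ℕ} {p : Fin n → ℝ} (hp : ∀ i, 0 ≤ p i ∧ p i ≤ 1) (f : Fin n → Fin n)
    (S : Finset (Fin n)) (hf : Set.InjOn f S) (hle : ∀ i ∈ S, p i ≤ p (f i)) (c : ℕ) :
    tail p S c ≤ tail p (S.image f) c := by
  induction S using Finset.induction_on generalizing c with
  | empty => simp
  | insert a S ha ih =>
    have hS : Set.InjOn f S := hf.mono (by simp)
    have ih' := ih hS (fun i hi => hle i (mem_insert_of_mem hi))
    have hfa : f a ∉ S.image f := by
      intro h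
      obtain ⟨i, hi, hia⟩ := mem_image.1 h
      have : i = a := hf (by simp [hi]) (by simp) hia
      exact ha (this ▸ hi)
    cases c with
    | zero => simp [tail_zero]
    | succ c =>
      rw [image_insert, tail_insert p ha, tail_insert p hfa]
      have h1 := ih' c
      have h2 := ih' (c + 1)
      have h3 := tail_succ_le hp S c
      have h4 := hle a (mem_insert_self a S)
      have h5 := (hp (f a)).1
      have h6 := (hp (f a)).2
      nlinarith [mul_nonneg (sub_nonneg.2 h4) (sub_nonneg.2 h3),
        mul_nonneg h5 (sub_nonneg.2 h1), mul_nonneg (sub_nonneg.2 h6) (sub_nonneg.2 h2)]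

/-- If `S'` has at least as many elements as `S` above every element of `S`, then `S` can be
mapped upwards into `S'`. -/
theorem exists_injOn_of_card_le {n : ℕ} {α : Type*} [LinearOrder α] (rk : Fin n → α)
    (S S' : Finset (Fin n))
    (h : ∀ e ∈ S, #{i ∈ S | rk e ≤ rk i} ≤ #{i ∈ S' | rk e ≤ rk i}) :
    ∃ f : Fin n → Fin n, Set.InjOn f S ∧ ∀ e ∈ S, f e ∈ S' ∧ rk e ≤ rk (f e) := by
  classical
  -- Hall's condition: if `e` has the lowest rank in `X`, then `X` lies in the part of `S` from `e`
  -- upwards, and the candidates of `e` alone are already numerous enough.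
  have hall := (Finset.all_card_le_biUnion_card_iff_exists_injective
    (fun e : S => {i ∈ S' | rk e ≤ rk i})).1 (by
      intro X
      rcases X.eq_empty_or_nonempty with rfl | hX
      · simp
      obtain ⟨e, heX, he⟩ := X.exists_min_image (fun e => rk e) hX
      calc #X = #(X.map (Function.Embedding.subtype _)) := (card_map _).symm
        _ ≤ #{i ∈ S | rk e ≤ rk i} := by
          refine card_le_card fun i hi => ?_
          obtain ⟨j, hj, rfl⟩ := mem_map.1 hi
          exact mem_filter.2 ⟨j.2, he j hj⟩
        _ ≤ #{i ∈ S' | rk e ≤ rk i} := h e e.2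
        _ ≤ _ := card_le_card (subset_biUnion_of_mem
          (fun e : S => {i ∈ S' | rk e ≤ rk i}) heX))
  obtain ⟨f, hf, hfm⟩ := hall
  refine ⟨fun e => if he : e ∈ S then f ⟨e, he⟩ else e, ?_, ?_⟩
  · intro a ha b hb hab
    simp only [mem_coe] at ha hb
    simp only [ha, hb, dif_pos] at hab
    simpa using hf hab
  · intro e he
    simp only [he, dif_pos]
    exact mem_filter.1 (hfm ⟨e, he⟩)

theorem tail_le_of_dominates {n : ℕ} {α : Type*} [LinearOrder α] {p : Fin n → ℝ}
    (hp : ∀ i, 0 ≤ p i ∧ p i ≤ 1) (rk : Fin n → α) (hrk : ∀ i j, rk i ≤ rk j → p i ≤ p j)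
    {S S' : Finset (Fin n)}
    (h : ∀ e ∈ S, #{i ∈ S | rk e ≤ rk i} ≤ #{i ∈ S' | rk e ≤ rk i}) (c : ℕ) :
    tail p S c ≤ tail p S' c := by
  obtain ⟨f, hf, hfm⟩ := exists_injOn_of_card_le rk S S' h
  refine (tail_le_image hp f S hf (fun i hi => hrk _ _ (hfm i hi).2) c).trans
    (tail_mono_set hp ?_ c)
  intro i hi
  obtain ⟨j, hj, rfl⟩ := mem_image.1 hi
  exact (hfm j hj).1

/-- The probability that at least `c` variables in `S` are `false` is a tail for the
complementary probabilities. -/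
theorem tail_compl {n : ℕ} (p : Fin n → ℝ) (S : Finset (Fin n)) (c : ℕ) :
    tail (fun i => 1 - p i) S c = ∑ x, inputProb p x * if c ≤ zeros S x then 1 else 0 := by
  unfold tail
  rw [← Equiv.sum_comp (Equiv.piCongrRight fun _ : Fin n => Equiv.boolNot)]
  refine sum_congr rfl fun x _ => ?_
  congr 1
  · unfold inputProb
    refine prod_congr rfl fun i _ => ?_
    cases h : x i <;> simp [h]
  · have h : ones S (Equiv.piCongrRight (fun _ : Fin n => Equiv.boolNot) x) = zeros S x := by
      unfold ones zeros
      congr 1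
      ext i
      simp
    rw [h]

/-- Having `k` ones and having n-k+1 zeros in `S` are exclusive events, since together they need n+1
variables; the function is open exactly when neither occurs. -/
theorem undet_eq {n k : ℕ} (hk : k ≤ n) (p : Fin n → ℝ) (S : Finset (Fin n)) :
    undet k p S = 1 - tail p S k - tail (fun i => 1 - p i) S (n - k + 1) := by
  rw [tail_compl, eq_sub_iff_add_eq, eq_sub_iff_add_eq]
  refine Eq.trans ?_ (sum_inputProb p)
  unfold undet tail
  rw [← sum_add_distrib, ← sum_add_distrib]
  refine sum_congr rfl fun x _ => ?_
  have h1 := ones_add_zeros S x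
  have h2 : #S ≤ n := by simpa using card_le_univ S
  by_cases ha : k ≤ ones S x <;> by_cases hb : n - k + 1 ≤ zeros S x
  · omega
  · simp [ha, hb, show ¬ ones S x < k by omega]
  · simp [ha, hb, show ¬ zeros S x + k ≤ n by omega]
  · simp [ha, hb, show ones S x < k by omega, show zeros S x + k ≤ n by omega]

/-- `S'` dominates `S` in both directions of the order given by `rk`. -/
def Dominates {n : ℕ} (rk : Fin n → ℕ) (S' S : Finset (Fin n)) : Prop :=
  ∀ e, #{i ∈ S | rk e ≤ rk i} ≤ #{i ∈ S' | rk e ≤ rk i} ∧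
    #{i ∈ S | rk i ≤ rk e} ≤ #{i ∈ S' | rk i ≤ rk e}

theorem undet_le_of_dominates {n k : ℕ} (hk : k ≤ n) {p : Fin n → ℝ}
    (hp : ∀ i, 0 ≤ p i ∧ p i ≤ 1) {rk : Fin n → ℕ} (hrk : ∀ i j, rk i ≤ rk j → p i ≤ p j)
    {S S' : Finset (Fin n)} (h : Dominates rk S' S) : undet k p S' ≤ undet k p S := by
  rw [undet_eq hk, undet_eq hk]
  have h1 := tail_le_of_dominates hp rk hrk (fun e _ => (h e).1) k
  -- For zeros the probabilities are complementary and the rank order is reversed, so the counts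
  -- from below take the role of the counts from above.
  have h2 := tail_le_of_dominates (p := fun i => 1 - p i)
    (fun i => ⟨by linarith [(hp i).2], by linarith [(hp i).1]⟩)
    (fun i => OrderDual.toDual (rk i))
    (fun i j hij => by linarith [hrk j i (OrderDual.toDual_le_toDual.1 hij)])
    (S := S) (S' := S')
    (fun e _ => by simpa only [OrderDual.toDual_le_toDual] using (h e).2) (n - k + 1)
  linarith

theorem Dominates.of_subset {n : ℕ} (rk : Fin n → ℕ) {S S' : Finset (Fin n)} (h : S ⊆ S') :
    Dominates rk S' S :=
  fun _ => ⟨card_le_card (filter_subset_filter _ h), card_le_card (filter_subset_filter _ h)⟩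

theorem undet_univ {n k : ℕ} (p : Fin n → ℝ) : undet k p univ = 0 := by
  refine sum_eq_zero fun x _ => ?_
  have h1 := ones_add_zeros univ x
  rw [card_univ, Fintype.card_fin] at h1
  rw [if_neg (by omega), mul_zero]

/-! ### The expected cost as a sum over prefixes -/

/-- The variables tested in the first `t` steps. -/
def pre {n : ℕ} (σ : Equiv.Perm (Fin n)) (t : ℕ) : Finset (Fin n) := {i | (σ.symm i : ℕ) < t}

theorem pre_zero {n : ℕ} (σ : Equiv.Perm (Fin n)) : pre σ 0 = ∅ := by simp [pre]

theorem pre_mono {n : ℕ} (σ : Equiv.Perm (Fin n)) {s t : ℕ} (h : s ≤ t) : pre σ s ⊆ pre σ t := by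
  intro i
  simp only [pre, mem_filter, mem_univ, true_and]
  omega

theorem pre_eq_univ {n : ℕ} (σ : Equiv.Perm (Fin n)) {t : ℕ} (h : n ≤ t) : pre σ t = univ := by
  ext i
  have := (σ.symm i).isLt
  simp only [pre, mem_filter, mem_univ, true_and, iff_true]
  omega

theorem card_pre {n : ℕ} (σ : Equiv.Perm (Fin n)) (t : ℕ) : #(pre σ t) = min n t := by
  have h : #(pre σ t) = #{i : Fin n | (i : ℕ) < t} := by
    refine card_bij (fun i _ => σ.symm i) ?_ ?_ ?_
    · intro i hi; simpa [pre] using hi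
    · intro i _ j _ hij; exact σ.symm.injective hij
    · intro i hi; exact ⟨σ i, by simpa [pre] using hi, by simp⟩
  rw [h, Fin.card_filter_val_lt]

theorem determined_kOfN_iff {n k : ℕ} (σ : Equiv.Perm (Fin n)) (x : Fin n → Bool) (t : ℕ) :
    Determined (kOfN n k) (stateAfter σ x t) ↔
      ¬ (ones (pre σ t) x < k ∧ zeros (pre σ t) x + k ≤ n) := by
  have hfol : ∀ y, Follows y (stateAfter σ x t) ↔ ∀ i ∈ pre σ t, y i = x i := by
    intro y
    refine forall_congr' fun i => ?_
    by_cases h : (σ.symm i : ℕ) < t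
    · simp [stateAfter, pre, h, eq_comm]
    · simp [stateAfter, pre, h]
  have hones : ∀ y : Fin n → Bool, ones univ y + zeros univ y = n := by
    intro y; simpa using ones_add_zeros univ y
  have hkn : ∀ y : Fin n → Bool, kOfN n k y = decide (k ≤ ones univ y) := fun y => rfl
  have hle1 : ∀ y : Fin n → Bool, (∀ i ∈ pre σ t, y i = x i) → ones (pre σ t) x ≤ ones univ y := by
    intro y hy
    refine card_le_card fun i hi => ?_
    have h := mem_filter.1 hi
    simp [hy i h.1, h.2]
  have hle0 : ∀ y : Fin n → Bool, (∀ i ∈ pre σ t, y i = x i) →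
      zeros (pre σ t) x ≤ zeros univ y := by
    intro y hy
    refine card_le_card fun i hi => ?_
    have h := mem_filter.1 hi
    simp [hy i h.1, h.2]
  constructor
  · rintro hdet ⟨h1, h0⟩
    -- The two extreme completions, all ones and all zeros outside the prefix, get different values
    -- of the function.
    have := hdet (fun i => if i ∈ pre σ t then x i else true)
      (fun i => if i ∈ pre σ t then x i else false)
      ((hfol _).2 fun i hi => by simp [hi]) ((hfol _).2 fun i hi => by simp [hi])
    rw [hkn, hkn, decide_eq_decide] at this
    have e0 : zeros univ (fun i => if i ∈ pre σ t then x i else true) = zeros (pre σ t) x := by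
      unfold zeros
      congr 1
      ext i
      by_cases hi : i ∈ pre σ t <;> simp [hi]
    have e1 : ones univ (fun i => if i ∈ pre σ t then x i else false) = ones (pre σ t) x := by
      unfold ones
      congr 1
      ext i
      by_cases hi : i ∈ pre σ t <;> simp [hi]
    have := hones (fun i => if i ∈ pre σ t then x i else true)
    omega
  · intro h y z hy hz
    rw [hfol] at hy hz
    rw [hkn, hkn, decide_eq_decide]
    have := hle1 y hy; have := hle1 z hz; have := hle0 y hy; have := hle0 z hz
    have := hones y; have := hones z
    omega

/-- Both counts grow with the prefix, so once determined the function stays determined, and only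
time `t` itself has to be inspected. -/
theorem lt_stopTime_iff {n k : ℕ} (σ : Equiv.Perm (Fin n)) (x : Fin n → Bool) (t : ℕ) :
    t < stopTime (kOfN n k) σ x ↔ ones (pre σ t) x < k ∧ zeros (pre σ t) x + k ≤ n := by
  classical
  unfold stopTime
  rw [Nat.lt_find_iff]
  simp only [determined_kOfN_iff, not_not]
  refine ⟨fun h => h t le_rfl, fun h s hs => ?_⟩
  have h1 : ones (pre σ s) x ≤ ones (pre σ t) x :=
    card_le_card (filter_subset_filter _ (pre_mono σ hs))
  have h0 : zeros (pre σ s) x ≤ zeros (pre σ t) x :=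
    card_le_card (filter_subset_filter _ (pre_mono σ hs))
  omega

theorem expectedCost_eq_sum_undet {n k : ℕ} (p : Fin n → ℝ) (σ : Equiv.Perm (Fin n)) :
    expectedCost (kOfN n k) p (fun _ => 1) σ = ∑ t ∈ range n, undet k p (pre σ t) := by
  unfold expectedCost undet
  rw [sum_comm]
  refine sum_congr rfl fun x _ => ?_
  rw [← mul_sum]
  congr 1
  have h : testedSet (kOfN n k) σ x = pre σ (stopTime (kOfN n k) σ x) := rfl
  have hs : ∀ t ∈ range n, (if ones (pre σ t) x < k ∧ zeros (pre σ t) x + k ≤ n then (1 : ℝ)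
      else 0) = if t < stopTime (kOfN n k) σ x then 1 else 0 := by
    intro t _
    simp only [lt_stopTime_iff]
  unfold cost
  rw [sum_congr rfl hs, h, sum_const, card_pre, sum_boole, nsmul_eq_mul, mul_one]
  congr 1
  rw [← card_range (min n _)]
  congr 1
  ext t
  simp

end KOfN

namespace KOfN

open Finset

/-! ### Sets that are unions of few intervals -/

/-- `A` is a union of `Q` intervals in the order given by the ranks `rk`. -/
def IntervalUnion {n : ℕ} (rk : Fin n → ℕ) (Q : ℕ) (A : Finset (Fin n)) : Prop :=
  ∃ lo hi : ℕ → ℕ, (∀ j, lo j ≤ n ∧ hi j ≤ n) ∧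
    ∀ e, e ∈ A ↔ ∃ j < Q, lo j ≤ rk e ∧ rk e < hi j

theorem exists_interval_of_convex {n : ℕ} {rk : Fin n → ℕ} (hlt : ∀ e, rk e < n)
    (C : Fin n → Prop) (hC : ∀ a b c, C a → C c → rk a ≤ rk b → rk b ≤ rk c → C b) :
    ∃ lo hi : ℕ, lo ≤ n ∧ hi ≤ n ∧ ∀ e, C e ↔ lo ≤ rk e ∧ rk e < hi := by
  classical
  rcases (univ.filter C).eq_empty_or_nonempty with h | h
  · refine ⟨0, 0, by omega, by omega, fun e => ?_⟩
    have := filter_eq_empty_iff.1 h (mem_univ e)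
    simp [this]
  · obtain ⟨a, ha, hmin⟩ := exists_min_image _ rk h
    obtain ⟨c, hc, hmax⟩ := exists_max_image _ rk h
    simp only [mem_filter, mem_univ, true_and] at ha hc hmin hmax
    refine ⟨rk a, rk c + 1, (hlt a).le, hlt c, fun e => ⟨fun he => ?_, fun he => ?_⟩⟩
    · exact ⟨hmin e he, Nat.lt_succ_of_le (hmax e he)⟩
    · exact hC a e c ha hc he.1 (by omega)

theorem IntervalUnion.of_convex {n Q : ℕ} {rk : Fin n → ℕ} (hlt : ∀ e, rk e < n)
    (C : ℕ → Fin n → Prop)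
    (hC : ∀ j a b c, C j a → C j c → rk a ≤ rk b → rk b ≤ rk c → C j b)
    {A : Finset (Fin n)} (hA : ∀ e, e ∈ A ↔ ∃ j < Q, C j e) : IntervalUnion rk Q A := by
  choose lo hi hlo hhi h using fun j => exists_interval_of_convex hlt (C j) (hC j)
  exact ⟨lo, hi, fun j => ⟨hlo j, hhi j⟩, fun e => by simp only [hA, h]⟩

theorem IntervalUnion.mono {n Q Q' : ℕ} {rk : Fin n → ℕ} (hlt : ∀ e, rk e < n)
    {A : Finset (Fin n)} (h : IntervalUnion rk Q A) (hQ : Q ≤ Q') : IntervalUnion rk Q' A := by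
  obtain ⟨lo, hi, -, h⟩ := h
  refine .of_convex hlt (fun j e => j < Q ∧ lo j ≤ rk e ∧ rk e < hi j) ?_ ?_
  · intro j a b c; omega
  · intro e
    rw [h]
    exact ⟨fun ⟨j, hj, hh⟩ => ⟨j, by omega, hj, hh⟩, fun ⟨j, _, hj, hh⟩ => ⟨j, hj, hh⟩⟩

/-- Each element is an interval of its own. -/
theorem IntervalUnion.of_card_le {n Q : ℕ} {rk : Fin n → ℕ} (hinj : Function.Injective rk)
    (hlt : ∀ e, rk e < n) {A : Finset (Fin n)} (h : #A ≤ Q) : IntervalUnion rk Q A := by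
  let f := A.equivFin
  refine .of_convex hlt (fun j e => ∃ he : e ∈ A, (f ⟨e, he⟩ : ℕ) = j) ?_ ?_
  · rintro j a b c ⟨ha, hja⟩ ⟨hc, hjc⟩ hab hbc
    have hac : (⟨a, ha⟩ : A) = ⟨c, hc⟩ := f.injective (Fin.ext (hja.trans hjc.symm))
    have hac' : a = c := congrArg Subtype.val hac
    subst hac'
    have : a = b := hinj (by omega)
    subst this
    exact ⟨ha, hja⟩
  · intro e
    constructor
    · intro he
      exact ⟨f ⟨e, he⟩, by have := (f ⟨e, he⟩).isLt; omega, he, rfl⟩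
    · rintro ⟨j, _, he, _⟩
      exact he

/-! ### Rounding a chain of sets to interval unions -/

/-- The `c` lowest elements of `C`. -/
def lowest {n : ℕ} {α : Type*} [LinearOrder α] (rk : Fin n → α) (C : Finset (Fin n)) (c : ℕ) :
    Finset (Fin n) := {e ∈ C | #{f ∈ C | rk f < rk e} < c}

theorem card_below_lt {n : ℕ} {α : Type*} [LinearOrder α] {rk : Fin n → α} {C : Finset (Fin n)}
    {a b : Fin n} (ha : a ∈ C) (hab : rk a < rk b) :
    #{f ∈ C | rk f < rk a} < #{f ∈ C | rk f < rk b} := by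
  refine card_lt_card ⟨fun i hi => ?_, fun h => ?_⟩
  · simp only [mem_filter] at hi ⊢
    exact ⟨hi.1, hi.2.trans hab⟩
  · have := h (mem_filter.2 ⟨ha, hab⟩)
    simp at this

theorem injOn_card_below {n : ℕ} {α : Type*} [LinearOrder α] {rk : Fin n → α}
    (hinj : Function.Injective rk) (C : Finset (Fin n)) :
    Set.InjOn (fun e => #{f ∈ C | rk f < rk e}) (C : Set (Fin n)) := by
  intro a ha b hb hab
  rcases lt_trichotomy (rk a) (rk b) with h | h | h
  · exact absurd hab (card_below_lt ha h).ne
  · exact hinj h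
  · exact absurd hab (card_below_lt hb h).ne'

theorem image_card_below {n : ℕ} {α : Type*} [LinearOrder α] {rk : Fin n → α}
    (hinj : Function.Injective rk) (C : Finset (Fin n)) :
    C.image (fun e => #{f ∈ C | rk f < rk e}) = range #C := by
  refine eq_of_subset_of_card_le ?_ ?_
  · intro x hx
    obtain ⟨e, he, rfl⟩ := mem_image.1 hx
    refine mem_range.2 (card_lt_card ⟨filter_subset _ _, fun h => ?_⟩)
    have := h he
    simp at this
  · rw [card_range, card_image_of_injOn (injOn_card_below hinj C)]

theorem card_lowest {n : ℕ} {α : Type*} [LinearOrder α] {rk : Fin n → α}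
    (hinj : Function.Injective rk) (C : Finset (Fin n)) (c : ℕ) :
    #(lowest rk C c) = min c #C := by
  have h : (lowest rk C c).image (fun e => #{f ∈ C | rk f < rk e}) = range (min c #C) := by
    ext x
    have hx : x ∈ C.image (fun e => #{f ∈ C | rk f < rk e}) ↔ x < #C := by
      rw [image_card_below hinj, mem_range]
    rw [mem_range, lt_min_iff, ← hx]
    simp only [lowest, mem_image, mem_filter]
    constructor
    · rintro ⟨e, ⟨he, hc⟩, rfl⟩
      exact ⟨hc, e, he, rfl⟩
    · rintro ⟨hc, e, he, rfl⟩
      exact ⟨e, ⟨he, hc⟩, rfl⟩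
  rw [← card_range (min c #C), ← h, card_image_of_injOn]
  exact (injOn_card_below hinj C).mono (coe_subset.2 (filter_subset _ _))

/-- Either all of the lowest elements are at most `e`, and there are `#X` of them, or one of them
lies above `e`, and then they include everything in `C` up to `e`. -/
theorem card_filter_le_card_filter_lowest {n : ℕ} {rk : Fin n → ℕ}
    (hinj : Function.Injective rk) {C X : Finset (Fin n)} (hX : X ⊆ C) (e : Fin n) :
    #{i ∈ X | rk i ≤ rk e} ≤ #{i ∈ lowest rk C #X | rk i ≤ rk e} := by
  by_cases h : ∀ i ∈ lowest rk C #X, rk i ≤ rk e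
  · rw [filter_true_of_mem h, card_lowest hinj, min_eq_left (card_le_card hX)]
    exact card_filter_le _ _
  · push Not at h
    obtain ⟨a, ha, hea⟩ := h
    refine card_le_card fun i hi => ?_
    simp only [lowest, mem_filter] at ha hi ⊢
    refine ⟨⟨hX hi.1, lt_of_le_of_lt (card_le_card ?_) ha.2⟩, hi.2⟩
    intro j hj
    simp only [mem_filter] at hj ⊢
    exact ⟨hj.1, by omega⟩

theorem card_le_of_fiber_le {n : ℕ} (g : Fin n → ℕ) {X Y : Finset (Fin n)}
    (h : ∀ b, #{e ∈ X | g e = b} ≤ #{e ∈ Y | g e = b}) : #X ≤ #Y := by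
  have hmap : ∀ Z : Finset (Fin n), Set.MapsTo g Z (univ.image g : Finset ℕ) := by
    intro Z e _
    simp
  rw [card_eq_sum_card_fiberwise (hmap X), card_eq_sum_card_fiberwise (hmap Y)]
  exact sum_le_sum fun b _ => h b

/-- A chain of sets is dominated by a chain of unions of few intervals, at the price of `T`
additional elements. -/
theorem exists_interval_chain {n : ℕ} {rk : Fin n → ℕ} (hinj : Function.Injective rk)
    (hlt : ∀ e, rk e < n) {T W : ℕ} (hT : 0 < T) {U : Finset (Fin n)} (hU : #U ≤ W * T)
    {S : ℕ → Finset (Fin n)} (hS : Monotone S) (hSU : ∀ i, S i ⊆ U) :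
    ∃ B : ℕ → Finset (Fin n), (∀ i, IntervalUnion rk (W + 1) (B i)) ∧ Monotone B ∧
      (∀ i, Dominates rk (B i) (S i)) ∧ (∀ i, #(B i) ≤ #(S i) + T) ∧
      ∀ i, B i = univ ∨ #(B i) = #(S i) + T := by
  classical
  -- The block number of a variable. Blocks are convex in rank and cover all variables, but are
  -- measured by `U`: each holds at most `T` elements of `U`, and those of `U` use only the numbers
  -- below `W`.
  set g : Fin n → ℕ := fun e => #{f ∈ U | rk f < rk e} / T with hg
  have hgmono : ∀ a b, rk a ≤ rk b → g a ≤ g b := by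
    intro a b hab
    refine Nat.div_le_div_right (card_le_card fun i hi => ?_)
    simp only [mem_filter] at hi ⊢
    exact ⟨hi.1, by omega⟩
  have hgU : ∀ e ∈ U, g e < W := by
    intro e he
    rw [hg, Nat.div_lt_iff_lt_mul hT]
    refine lt_of_lt_of_le (card_lt_card ⟨filter_subset _ _, fun h => ?_⟩) hU
    have := h he
    simp at this
  have hfib : ∀ b, #{e ∈ U | g e = b} ≤ T := by
    intro b
    have : #{e ∈ U | g e = b} ≤ #(Ico (b * T) (b * T + T)) := by
      refine card_le_card_of_injOn (fun e => #{f ∈ U | rk f < rk e}) ?_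
        ((injOn_card_below hinj U).mono (coe_subset.2 (filter_subset _ _)))
      intro e he
      simp only [coe_filter, Set.mem_ofPred_eq, hg] at he
      simp only [coe_Ico, Set.mem_Ico]
      have h := (Nat.div_eq_iff hT).1 he.2
      constructor
      · omega
      · omega
    simpa using this
  set K : ℕ → Finset (Fin n) := fun b => {e | g e = b} with hK
  have hX : ∀ i b, S i ∩ K b = {e ∈ S i | g e = b} := by
    intro i b; ext e; simp [hK]
  -- `S i` pushed to the bottom within every block; its trace on a block is an initial segment of
  -- the block, hence an interval.
  set S' : ℕ → Finset (Fin n) := fun i =>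
    {e | e ∈ lowest rk (K (g e)) #(S i ∩ K (g e))} with hS'
  have hS'fib : ∀ i b, ({e ∈ S' i | g e = b} : Finset (Fin n)) =
      lowest rk (K b) #(S i ∩ K b) := by
    intro i b
    ext e
    simp only [hS', mem_filter, mem_univ, true_and]
    constructor
    · rintro ⟨h, rfl⟩
      exact h
    · intro h
      have : g e = b := by
        have := (mem_filter.1 h).1
        simpa [hK] using this
      rw [this]
      exact ⟨h, rfl⟩
  have hfibcard : ∀ i b, #{e ∈ S' i | g e = b} = #{e ∈ S i | g e = b} := by
    intro i b
    rw [hS'fib, card_lowest hinj, min_eq_left (card_le_card inter_subset_right), hX]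
  have hcard : ∀ i, #(S' i) = #(S i) := fun i =>
    le_antisymm (card_le_of_fiber_le g fun b => (hfibcard i b).le)
      (card_le_of_fiber_le g fun b => (hfibcard i b).ge)
  have hS'mono : Monotone S' := by
    intro i j hij e he
    simp only [hS', lowest, mem_filter, mem_univ, true_and] at he ⊢
    exact ⟨he.1, he.2.trans_le (card_le_card (inter_subset_inter_right (hS hij)))⟩
  have hlow : ∀ i e, #{x ∈ S i | rk x ≤ rk e} ≤ #{x ∈ S' i | rk x ≤ rk e} := by
    intro i e
    refine card_le_of_fiber_le g fun b => ?_
    have hc : ∀ Z : Finset (Fin n), filter (fun x => g x = b) {x ∈ Z | rk x ≤ rk e} =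
        filter (fun x => rk x ≤ rk e) {x ∈ Z | g x = b} := fun Z => by
      rw [filter_filter, filter_filter]
      simp only [and_comm]
    rw [hc, hc, hS'fib, ← hX]
    exact card_filter_le_card_filter_lowest hinj inter_subset_right e
  -- Blocks above that of `e` keep their counts; only elements in the block of `e` can drop below
  -- `e`, and there are at most `T` of them.
  have hhigh : ∀ i e, #{x ∈ S i | rk e ≤ rk x} ≤ #{x ∈ S' i | rk e ≤ rk x} + T := by
    intro i e
    have h1 : #{x ∈ S i | rk e ≤ rk x} ≤ #{x ∈ S i | g e < g x} + #{x ∈ S i | g x = g e} := by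
      refine (card_le_card fun x hx => ?_).trans (card_union_le _ _)
      simp only [mem_filter, mem_union] at hx ⊢
      have := hgmono e x hx.2
      rcases this.lt_or_eq with h | h
      · exact Or.inl ⟨hx.1, h⟩
      · exact Or.inr ⟨hx.1, h.symm⟩
    have h2 : #{x ∈ S i | g x = g e} ≤ T :=
      (card_le_card (filter_subset_filter _ (hSU i))).trans (hfib _)
    have h3 : #{x ∈ S i | g e < g x} ≤ #{x ∈ S' i | g e < g x} := by
      refine card_le_of_fiber_le g fun b => ?_
      rw [filter_filter, filter_filter]
      by_cases hb : g e < b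
      · have hc : ∀ x, (g e < g x ∧ g x = b) ↔ g x = b := by intro x; omega
        simp only [hc]
        exact (hfibcard i b).ge
      · have hc : ∀ x, ¬ (g e < g x ∧ g x = b) := by intro x; omega
        simp [hc]
    have h4 : #{x ∈ S' i | g e < g x} ≤ #{x ∈ S' i | rk e ≤ rk x} := by
      refine card_le_card fun x hx => ?_
      simp only [mem_filter] at hx ⊢
      refine ⟨hx.1, ?_⟩
      by_contra hlt'
      have := hgmono x e (by omega)
      omega
    omega
  -- The `T` topmost variables outside `S' i`, which make up for the loss in `hhigh`.
  set E : ℕ → Finset (Fin n) := fun i =>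
    lowest (fun e => OrderDual.toDual (rk e)) (univ \ S' i) T with hE
  have hdinj : Function.Injective (fun e => OrderDual.toDual (rk e)) :=
    OrderDual.toDual.injective.comp hinj
  have hEmem : ∀ i e, e ∈ E i ↔ e ∉ S' i ∧ #{f | f ∉ S' i ∧ rk e < rk f} < T := by
    intro i e
    have h : filter (fun f => OrderDual.toDual (rk f) < OrderDual.toDual (rk e)) (univ \ S' i) =
        filter (fun f => f ∉ S' i ∧ rk e < rk f) univ := by
      ext f
      simp
    simp only [hE, lowest]
    rw [mem_filter, h]
    simp
  have hEcard : ∀ i, #(E i) = min T #(univ \ S' i) := fun i => card_lowest hdinj _ _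
  have hdisj : ∀ i, Disjoint (S' i) (E i) := by
    intro i
    rw [disjoint_left]
    intro e he he'
    exact ((hEmem i e).1 he').1 he
  -- `E i` need not be an interval, but without the condition `e ∉ S' i` its definition describes a
  -- set closed upwards in rank. This set is the one interval beyond the `W` blocks, and it grows
  -- with `S' i`.
  have hBmem : ∀ i e, e ∈ S' i ∪ E i ↔ e ∈ S' i ∨ #{f | f ∉ S' i ∧ rk e < rk f} < T := by
    intro i e
    rw [mem_union, hEmem]
    tauto
  refine ⟨fun i => S' i ∪ E i, fun i => ?_, ?_, fun i e => ⟨?_, ?_⟩, fun i => ?_, fun i => ?_⟩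
  · refine .of_convex hlt (fun j e => if j < W then e ∈ S' i ∧ g e = j else
      #{f | f ∉ S' i ∧ rk e < rk f} < T) ?_ ?_
    · intro j a b c
      by_cases hj : j < W
      · simp only [hj, if_true]
        rintro ⟨ha, hga⟩ ⟨hc, hgc⟩ hab hbc
        have hgb : g b = j := by
          have := hgmono a b hab
          have := hgmono b c hbc
          omega
        refine ⟨?_, hgb⟩
        simp only [hS', lowest, mem_filter, mem_univ, true_and, hgc, hgb] at hc ⊢
        refine ⟨by simp [hK, hgb], lt_of_le_of_lt (card_le_card fun x hx => ?_) hc.2⟩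
        simp only [mem_filter] at hx ⊢
        exact ⟨hx.1, by omega⟩
      · simp only [hj, if_false]
        intro ha _ hab _
        refine lt_of_le_of_lt (card_le_card fun x hx => ?_) ha
        simp only [mem_filter] at hx ⊢
        exact ⟨hx.1, hx.2.1, by omega⟩
    · intro e
      rw [hBmem]
      constructor
      · rintro (h | h)
        · have hgW : g e < W := by
            have h' := h
            simp only [hS', lowest, mem_filter, mem_univ, true_and] at h'
            obtain ⟨x, hx⟩ := card_pos.1 (lt_of_le_of_lt (Nat.zero_le _) h'.2)
            rw [hX, mem_filter] at hx
            rw [← hx.2]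
            exact hgU x (hSU i hx.1)
          exact ⟨g e, by omega, by simp [hgW, h]⟩
        · exact ⟨W, by omega, by simpa using h⟩
      · rintro ⟨j, _, h⟩
        split_ifs at h
        · exact Or.inl h.1
        · exact Or.inr h
  · intro i j hij e he
    rw [hBmem] at he ⊢
    rcases he with he | he
    · exact Or.inl (hS'mono hij he)
    · refine Or.inr (lt_of_le_of_lt (card_le_card fun x hx => ?_) he)
      simp only [mem_filter, mem_univ, true_and] at hx ⊢
      exact ⟨fun h => hx.1 (hS'mono hij h), hx.2⟩
  · by_cases h : ∀ x, rk e ≤ rk x → x ∈ S' i ∪ E i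
    · refine card_le_card fun x hx => ?_
      simp only [mem_filter] at hx ⊢
      exact ⟨h x hx.2, hx.2⟩
    · push Not at h
      obtain ⟨a, hea, ha⟩ := h
      rw [hBmem] at ha
      push Not at ha
      -- A missing variable `a` above `e` shows that `E i` was filled up to `T` elements before
      -- reaching `a`, so all of them lie above `e` and pay for the loss.
      have hEfull : ∀ x ∈ E i, rk e ≤ rk x := by
        intro x hx
        by_contra hlt'
        have h1 := ((hEmem i x).1 hx).2
        have h2 : #{f | f ∉ S' i ∧ rk a < rk f} ≤ #{f | f ∉ S' i ∧ rk x < rk f} := by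
          refine card_le_card fun y hy => ?_
          simp only [mem_filter, mem_univ, true_and] at hy ⊢
          exact ⟨hy.1, by omega⟩
        omega
      have hET : #(E i) = T := by
        rw [hEcard, min_eq_left]
        refine ha.2.trans (card_le_card fun y hy => ?_)
        simp only [mem_filter, mem_univ, true_and, mem_sdiff] at hy ⊢
        exact hy.1
      rw [filter_union, card_union_of_disjoint
        ((hdisj i).mono (filter_subset _ _) (filter_subset _ _)), filter_true_of_mem hEfull, hET]
      exact hhigh i e
  · exact (hlow i e).trans (card_le_card (filter_subset_filter _ subset_union_left))
  · rw [card_union_of_disjoint (hdisj i), hcard, hEcard]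
    omega
  · rw [card_union_of_disjoint (hdisj i), hcard, hEcard]
    rcases le_total T #(univ \ S' i) with h | h
    · right
      rw [min_eq_left h]
    · left
      have : E i = univ \ S' i := by
        refine eq_of_subset_of_card_le (filter_subset _ _) ?_
        rw [hEcard, min_eq_right h]
      simp [this]

end KOfN

namespace KOfN

open Finset

/-! ### Short paths through interval unions -/

/-- `Reach q Ok r A v`: there is a path of `r` steps through sets satisfying `Ok` that starts in
`A` and has length `v`, where a step from `A` to `B` has length `#(B \ A) * q A` and the end `B`
of the path contributes `n * q B`. -/
inductive Reach {n : ℕ} (q : Finset (Fin n) → ℕ) (Ok : Finset (Fin n) → Prop) :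
    ℕ → Finset (Fin n) → ℕ → Prop
  | zero {A : Finset (Fin n)} : Ok A → Reach q Ok 0 A (n * q A)
  | succ {r v : ℕ} {A B : Finset (Fin n)} : Ok A → Reach q Ok r B v →
      Reach q Ok (r + 1) A (#(B \ A) * q A + v)

theorem Reach.chain {n : ℕ} {q : Finset (Fin n) → ℕ} {Ok : Finset (Fin n) → Prop} {r v l : ℕ}
    {B : ℕ → Finset (Fin n)} (hB : ∀ i < l, Ok (B i)) (h : Reach q Ok r (B l) v) :
    Reach q Ok (r + l) (B 0) (∑ i ∈ range l, #(B (i + 1) \ B i) * q (B i) + v) := by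
  induction l generalizing B with
  | zero => simpa using h
  | succ l ih =>
    have h' := ih (B := fun i => B (i + 1)) (fun i hi => hB (i + 1) (by omega)) h
    have := Reach.succ (hB 0 (by omega)) h'
    rw [sum_range_succ', add_comm _ (#(B (0 + 1) \ B 0) * q (B 0)), add_assoc]
    exact this

/-! ### Sums of antitone sequences -/

section

variable {f : ℕ → ℕ}

theorem mul_le_sum_Ico (hf : Antitone f) {a b c : ℕ} (hb : b = a + c) :
    c * f b ≤ ∑ t ∈ Ico a b, f t := by
  subst hb
  have h := card_nsmul_le_sum (Ico a (a + c)) f (f (a + c)) (fun t ht => hf (mem_Ico.1 ht).2.le)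
  simpa using h

/-- Each term except the first is charged to the interval of length `T` that ends at its argument;
the first term has no such interval and remains as overhead. -/
theorem sum_steps_le (hf : Antitone f) (T K : ℕ) :
    ∑ i ∈ range (K + 1), T * f ((i + 1) * T) ≤ T * f T + ∑ t ∈ Ico T ((K + 1) * T), f t := by
  induction K with
  | zero => simp
  | succ K ih =>
    rw [sum_range_succ]
    have h1 := mul_le_sum_Ico hf (a := (K + 1) * T) (b := (K + 1 + 1) * T) (c := T) (by ring)
    have h2 := sum_Ico_consecutive f (m := T) (n := (K + 1) * T) (k := (K + 1 + 1) * T)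
      (by nlinarith) (by nlinarith)
    omega

/-- Cauchy condensation: 2^(a+1) * f(2^(a+1)) is at most twice the sum of `f` from 2^a up to
2^(a+1). -/
theorem sum_pow_two_mul_le (hf : Antitone f) (M : ℕ) :
    ∑ a ∈ range (M + 1), 2 ^ a * f (2 ^ a) ≤ 2 * ∑ t ∈ range (2 ^ M), f t := by
  induction M with
  | zero =>
    have := hf (Nat.zero_le 1)
    simp
    omega
  | succ M ih =>
    rw [sum_range_succ]
    have h1 := mul_le_sum_Ico hf (a := 2 ^ M) (b := 2 ^ (M + 1)) (c := 2 ^ M) (by ring)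
    have h2 := sum_range_add_sum_Ico f (m := 2 ^ M) (n := 2 ^ (M + 1))
      (Nat.pow_le_pow_right (by norm_num) (by omega))
    have h3 : 2 ^ (M + 1) * f (2 ^ (M + 1)) = 2 * (2 ^ M * f (2 ^ (M + 1))) := by ring
    omega

theorem sum_range_le_of_eq_zero {n : ℕ} (h0 : ∀ t, n ≤ t → f t = 0) (M : ℕ) :
    ∑ t ∈ range M, f t ≤ ∑ t ∈ range n, f t := by
  rcases le_total M n with h | h
  · exact sum_le_sum_of_subset (range_mono h)
  · refine (sum_subset (range_mono h) fun t _ ht => h0 t ?_).ge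
    simpa using ht

/-- Among the `w` shifts there is one for which the values at the phase boundaries are small. -/
theorem exists_shift (hf : Antitone f) {n w : ℕ} (h0 : ∀ t, n ≤ t → f t = 0) (hw : 0 < w) :
    ∃ s < w, w * ∑ j ∈ range n, 2 ^ (s + w * j) * f (2 ^ (s + w * j)) ≤
      2 * ∑ t ∈ range n, f t := by
  obtain ⟨s, hs, hmin⟩ := exists_min_image (range w)
    (fun s => ∑ j ∈ range n, 2 ^ (s + w * j) * f (2 ^ (s + w * j))) ⟨0, by simpa⟩
  refine ⟨s, by simpa using hs, ?_⟩
  have h1 := card_nsmul_le_sum (range w) _ _ hmin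
  rw [card_range, smul_eq_mul] at h1
  refine h1.trans ?_
  -- The exponents s + w*j with s < w run through every number below w*M exactly once, so the best
  -- shift is at most the average.
  have hG : ∀ M, ∑ s ∈ range w, ∑ j ∈ range M, 2 ^ (s + w * j) * f (2 ^ (s + w * j)) =
      ∑ a ∈ range (w * M), 2 ^ a * f (2 ^ a) := by
    intro M
    induction M with
    | zero => simp
    | succ M ih =>
      simp only [sum_range_succ, sum_add_distrib]
      rw [ih, mul_add_one, sum_range_add]
      simp only [add_comm]
  rw [hG]
  calc _ ≤ ∑ a ∈ range (w * n + 1), 2 ^ a * f (2 ^ a) :=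
        sum_le_sum_of_subset (range_mono (by omega))
    _ ≤ 2 * ∑ t ∈ range (2 ^ (w * n)), f t := sum_pow_two_mul_le hf _
    _ ≤ _ := by
      have := sum_range_le_of_eq_zero h0 (2 ^ (w * n))
      omega

end

/-! ### Phases and the path that follows a given order -/

section

variable {n : ℕ} {rk : Fin n → ℕ} {q : Finset (Fin n) → ℕ}

/-- One phase, from `T` to `W * T` tests: the prefixes of lengths T, 2T, …, W*T are rounded. The `T`
extra elements appear in every rounded set, so they are paid only on entering the phase and do not
lengthen the steps inside it. -/
theorem exists_phase (hinj : Function.Injective rk) (hlt : ∀ e, rk e < n)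
    (hdom : ∀ S S', Dominates rk S' S → q S' ≤ q S) (hfull : q univ = 0)
    (τ : Equiv.Perm (Fin n)) {T W : ℕ} (hT : 0 < T) (hW : 2 ≤ W) :
    ∃ B : ℕ → Finset (Fin n), (∀ i, IntervalUnion rk (W + 1) (B i)) ∧ #(B 0) ≤ 2 * T ∧
      q (B (W - 1)) ≤ q (pre τ (W * T)) ∧
      ∑ i ∈ range (W - 1), #(B (i + 1) \ B i) * q (B i) ≤
        T * q (pre τ T) + ∑ t ∈ Ico T (W * T), q (pre τ t) := by
  have hanti : Antitone fun t => q (pre τ t) :=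
    fun a b hab => hdom _ _ (.of_subset rk (pre_mono τ hab))
  obtain ⟨B, hB, hmono, hBdom, hcard, hcard'⟩ := exists_interval_chain hinj hlt (T := T) (W := W)
    hT (U := pre τ (W * T)) (by rw [card_pre]; exact min_le_right _ _)
    (S := fun i => pre τ (min (i + 1) W * T))
    (fun i j hij => pre_mono τ (Nat.mul_le_mul_right _ (by omega)))
    (fun i => pre_mono τ (Nat.mul_le_mul_right _ (by omega)))
  have hq : ∀ i, i + 1 ≤ W → q (B i) ≤ q (pre τ ((i + 1) * T)) := by
    intro i hi
    have := hdom _ _ (hBdom i)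
    rwa [min_eq_left hi] at this
  refine ⟨B, hB, ?_, ?_, ?_⟩
  · have := hcard 0
    have e : min (0 + 1) W = 1 := by omega
    rw [card_pre, e, one_mul] at this
    omega
  · have := hq (W - 1) (by omega)
    rwa [Nat.sub_add_cancel (by omega)] at this
  · have h1 : ∀ i ∈ range (W - 1), #(B (i + 1) \ B i) * q (B i) ≤
        T * q (pre τ ((i + 1) * T)) := by
      intro i hi
      have hi' := mem_range.1 hi
      -- Either `B i` contains all variables and its weight is zero, or its excess over the prefix
      -- is exactly `T`. The excess of `B (i + 1)` is at most `T`, so the step adds at most `T`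
      -- elements.
      rcases hcard' i with h | h
      · rw [h, hfull]; simp
      · refine Nat.mul_le_mul ?_ (hq i (by omega))
        have h2 := hcard (i + 1)
        have e1 : min (i + 1) W = i + 1 := by omega
        have e2 : min (i + 1 + 1) W = i + 1 + 1 := by omega
        rw [card_pre, e1] at h
        rw [card_pre, e2] at h2
        have h3 : (i + 1 + 1) * T = (i + 1) * T + T := by ring
        have h4 := card_sdiff_add_card_eq_card (hmono (Nat.le_succ i))
        rw [Nat.succ_eq_add_one] at h4
        omega
    refine (sum_le_sum h1).trans ?_
    obtain ⟨K, rfl⟩ : ∃ K, W = K + 2 := ⟨W - 2, by omega⟩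
    refine (sum_steps_le hanti T K).trans (Nat.add_le_add_left (sum_le_sum_of_subset ?_) _)
    exact Ico_subset_Ico_right (by nlinarith)

/-- Induction on the number `i` of phases left. A phase takes one step into its first set and 2^w -
1 steps inside. Nothing is required of `S` except that its weight is at most that of the prefix at
the boundary, so consecutive phases need not be nested. -/
theorem exists_reach_phases (hinj : Function.Injective rk) (hlt : ∀ e, rk e < n)
    (hdom : ∀ S S', Dominates rk S' S → q S' ≤ q S) (hfull : q univ = 0)
    (τ : Equiv.Perm (Fin n)) {w Q : ℕ} (hw : 0 < w) (hQ : 2 ^ w + 1 ≤ Q) (s i j : ℕ)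
    (hij : n ≤ 2 ^ (s + w * (j + i))) {S : Finset (Fin n)} (hS : IntervalUnion rk Q S)
    (hqS : q S ≤ q (pre τ (2 ^ (s + w * j)))) :
    ∃ v, Reach q (IntervalUnion rk Q) (i * 2 ^ w) S v ∧
      v ≤ ∑ t ∈ Ico (2 ^ (s + w * j)) (2 ^ (s + w * (j + i))), q (pre τ t) +
        3 * ∑ l ∈ range i, 2 ^ (s + w * (j + l)) * q (pre τ (2 ^ (s + w * (j + l)))) := by
  induction i generalizing j S with
  | zero =>
    refine ⟨_, by simpa using Reach.zero hS, ?_⟩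
    -- The last boundary lies beyond `n`, so the weight of `S` is zero and the final step is free.
    rw [add_zero] at hij
    rw [pre_eq_univ τ hij, hfull, Nat.le_zero] at hqS
    simp [hqS]
  | succ i ih =>
    have hW : 2 ≤ 2 ^ w := Nat.le_self_pow hw.ne' 2
    obtain ⟨B, hB, hB0, hBl, hsum⟩ := exists_phase hinj hlt hdom hfull τ
      (T := 2 ^ (s + w * j)) (W := 2 ^ w) (by positivity) hW
    have hT : 2 ^ w * 2 ^ (s + w * j) = 2 ^ (s + w * (j + 1)) := by
      rw [← pow_add]; congr 1; ring
    rw [hT] at hBl hsum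
    have hB' : ∀ i, IntervalUnion rk Q (B i) := fun i => (hB i).mono hlt hQ
    obtain ⟨v, hv, hvle⟩ := ih (j + 1) (by rwa [add_assoc, add_comm 1]) (hB' (2 ^ w - 1)) hBl
    have h1 := Reach.succ hS (Reach.chain (l := 2 ^ w - 1) (fun i _ => hB' i) hv)
    have e : i * 2 ^ w + (2 ^ w - 1) + 1 = (i + 1) * 2 ^ w := by
      rw [add_assoc, Nat.sub_add_cancel (by omega)]
      ring
    rw [e] at h1
    refine ⟨_, h1, ?_⟩
    -- Entering the phase contributes 2 to the factor 3 of the overhead; the first step inside the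
    -- phase contributes the remaining 1.
    · have h2 : #(B 0 \ S) * q S ≤ 2 * 2 ^ (s + w * j) * q (pre τ (2 ^ (s + w * j))) :=
        Nat.mul_le_mul ((card_le_card sdiff_subset).trans hB0) hqS
      have h3 := sum_Ico_consecutive (fun t => q (pre τ t)) (m := 2 ^ (s + w * j))
        (n := 2 ^ (s + w * (j + 1))) (k := 2 ^ (s + w * (j + (i + 1))))
        (Nat.pow_le_pow_right (by norm_num) (by nlinarith))
        (Nat.pow_le_pow_right (by norm_num) (by nlinarith))
      have h4 : ∑ l ∈ range (i + 1), 2 ^ (s + w * (j + l)) * q (pre τ (2 ^ (s + w * (j + l)))) =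
          ∑ l ∈ range i, 2 ^ (s + w * (j + 1 + l)) * q (pre τ (2 ^ (s + w * (j + 1 + l)))) +
            2 ^ (s + w * j) * q (pre τ (2 ^ (s + w * j))) := by
        rw [sum_range_succ']
        simp only [add_zero, add_comm, add_left_comm]
      have h5 : j + 1 + i = j + (i + 1) := by ring
      rw [h5] at hvle
      rw [mul_assoc] at h2
      rw [h4]
      omega

/-- The expected cost of every order is, up to the factor `1 + 6 / w`, the length of a path. -/
theorem exists_reach (hinj : Function.Injective rk) (hlt : ∀ e, rk e < n)
    (hdom : ∀ S S', Dominates rk S' S → q S' ≤ q S) (hfull : q univ = 0)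
    (τ : Equiv.Perm (Fin n)) {w Q : ℕ} (hw : 0 < w) (hQ : 2 ^ w + 1 ≤ Q) :
    ∃ r v, r ≤ 2 ^ w * (n + 1) ∧ Reach q (IntervalUnion rk Q) r ∅ v ∧
      w * v ≤ (w + 6) * ∑ t ∈ range n, q (pre τ t) := by
  have hanti : Antitone fun t => q (pre τ t) :=
    fun a b hab => hdom _ _ (.of_subset rk (pre_mono τ hab))
  have h0 : ∀ t, n ≤ t → q (pre τ t) = 0 := fun t ht => by rw [pre_eq_univ τ ht, hfull]
  obtain ⟨s, hs, hshift⟩ := exists_shift hanti h0 hw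
  have hsw : 2 ^ s ≤ 2 ^ w := Nat.pow_le_pow_right (by norm_num) hs.le
  -- Prefixes before the first boundary have at most 2^w elements and need no rounding, so the path
  -- follows the order exactly there.
  have hOk : ∀ i ≤ 2 ^ s, IntervalUnion rk Q (pre τ i) := by
    intro i hi
    refine .of_card_le hinj hlt ?_
    rw [card_pre]
    omega
  have hn : n ≤ 2 ^ (s + w * (0 + n)) := by
    have h1 : n < 2 ^ n := Nat.lt_two_pow_self
    have h2 : 2 ^ n ≤ 2 ^ (s + w * (0 + n)) := Nat.pow_le_pow_right (by norm_num) (by nlinarith)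
    omega
  obtain ⟨v, hv, hvle⟩ := exists_reach_phases hinj hlt hdom hfull τ hw hQ s n 0 hn
    (hOk (2 ^ s) le_rfl) (by simp)
  have h1 := Reach.chain (l := 2 ^ s) (B := pre τ) (fun i hi => hOk i hi.le) hv
  rw [pre_zero] at h1
  refine ⟨_, _, ?_, h1, ?_⟩
  · have : 2 ^ w * (n + 1) = n * 2 ^ w + 2 ^ w := by ring
    omega
  · have h2 : ∑ i ∈ range (2 ^ s), #(pre τ (i + 1) \ pre τ i) * q (pre τ i) ≤
        ∑ i ∈ range (2 ^ s), q (pre τ i) := by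
      refine sum_le_sum fun i _ => ?_
      have h := card_sdiff_add_card_eq_card (pre_mono τ (Nat.le_succ i))
      rw [card_pre, card_pre] at h
      have : #(pre τ (i + 1) \ pre τ i) ≤ 1 := by
        rw [Nat.succ_eq_add_one] at h
        omega
      calc _ ≤ 1 * q (pre τ i) := Nat.mul_le_mul_right _ this
        _ = _ := one_mul _
    simp only [mul_zero, add_zero, zero_add] at hvle
    have h3 := sum_range_add_sum_Ico (fun t => q (pre τ t)) (m := 2 ^ s) (n := 2 ^ (s + w * n))
      (Nat.pow_le_pow_right (by norm_num) (by omega))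
    have h4 := sum_range_le_of_eq_zero h0 (2 ^ (s + w * n))
    have h5 : ∑ i ∈ range (2 ^ s), #(pre τ (i + 1) \ pre τ i) * q (pre τ i) + v ≤
        ∑ t ∈ range n, q (pre τ t) +
          3 * ∑ j ∈ range n, 2 ^ (s + w * j) * q (pre τ (2 ^ (s + w * j))) := by omega
    nlinarith [Nat.mul_le_mul_left w h5]

end

end KOfN

namespace KOfN

open Finset

/-! ### Orders from paths -/

/-- The sum of `q` over all proper prefixes of a list. -/
def listCost {n : ℕ} (q : Finset (Fin n) → ℕ) (L : List (Fin n)) : ℕ :=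
  ∑ t ∈ range L.length, q (L.take t).toFinset

theorem listCost_append_singleton {n : ℕ} (q : Finset (Fin n) → ℕ) (L : List (Fin n))
    (e : Fin n) : listCost q (L ++ [e]) = listCost q L + q L.toFinset := by
  unfold listCost
  rw [List.length_append, List.length_singleton, sum_range_succ, List.take_left]
  congr 1
  refine sum_congr rfl fun t ht => ?_
  rw [List.take_append_of_le_length (mem_range.1 ht).le]

theorem exists_perm_of_list {n : ℕ} {L : List (Fin n)} (hL : L.Nodup) (hlen : L.length = n) :
    ∃ σ : Equiv.Perm (Fin n), (∀ i : Fin n, σ i = L[(i : ℕ)]'(by omega)) ∧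
      ∀ q, ∑ t ∈ range n, q (pre σ t) = listCost q L := by
  have hinj : Function.Injective fun i : Fin n => L[(i : ℕ)]'(by omega) := by
    intro i j hij
    exact Fin.ext ((hL.getElem_inj_iff (hi := by omega) (hj := by omega)).1 hij)
  refine ⟨Equiv.ofBijective _ hinj.bijective_of_finite, fun i => rfl, fun q => ?_⟩
  have hl : listCost q L = ∑ t ∈ range n, q (L.take t).toFinset := by
    unfold listCost
    rw [hlen]
  rw [hl]
  refine sum_congr rfl fun t _ => congrArg q ?_
  ext e
  simp only [pre, mem_filter, mem_univ, true_and, List.mem_toFinset, List.mem_take_iff_getElem]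
  set σ := Equiv.ofBijective _ hinj.bijective_of_finite with hσ
  have hval : ∀ i : Fin n, σ i = L[(i : ℕ)]'(by omega) := fun i => rfl
  constructor
  · intro h
    refine ⟨σ.symm e, by omega, ?_⟩
    rw [← hval, Equiv.apply_symm_apply]
  · rintro ⟨i, hi, rfl⟩
    have : σ ⟨i, by omega⟩ = L[i] := hval ⟨i, by omega⟩
    rw [← this, Equiv.symm_apply_apply]
    exact (lt_min_iff.1 hi).1

/-! ### Probabilities with common denominator -/

section

variable {n : ℕ} (a d : Fin n → ℕ)

/-- The probability of an input, multiplied by the product of all denominators. -/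
def weight (x : Fin n → Bool) : ℕ := ∏ i, if x i = true then a i else d i - a i

/-- The scaled probability that exactly `c` variables in `S` are `true`. -/
def coef (S : Finset (Fin n)) (c : ℕ) : ℕ := ∑ x with ones S x = c, weight a d x

/-- The scaled probability that the variables in `S` do not determine the `k`-of-`n`
function. -/
def scaledUndet (k : ℕ) (S : Finset (Fin n)) : ℕ :=
  ∑ c ∈ range k, if #S + k ≤ c + n then coef a d S c else 0

variable {a d}

theorem ones_le {S : Finset (Fin n)} (x : Fin n → Bool) : ones S x ≤ n := by
  have h := ones_add_zeros S x
  have h' : #S ≤ n := by simpa using card_le_univ S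
  omega

/-- The generating function of the number of ones in `S`: a variable outside `S` contributes its
total weight, since (d-a) + a = d. -/
theorem prod_eq_sum_coef (had : ∀ i, a i ≤ d i) (S : Finset (Fin n)) (X : ℕ) :
    ∏ i, (if i ∈ S then (d i - a i) + a i * X else d i) =
      ∑ c ∈ range (n + 1), coef a d S c * X ^ c := by
  have h := Finset.prod_univ_sum (fun _ : Fin n => (univ : Finset Bool))
    (fun i b => (if b = true then a i else d i - a i) *
      (if i ∈ S ∧ b = true then X else 1))
  simp only [Fintype.piFinset_univ] at h
  have h1 : ∀ i, (if i ∈ S then (d i - a i) + a i * X else d i) =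
      ∑ b : Bool, (if b = true then a i else d i - a i) *
        (if i ∈ S ∧ b = true then X else 1) := by
    intro i
    have := had i
    rw [Fintype.sum_bool]
    by_cases hi : i ∈ S
    · simp [hi, add_comm]
    · simp [hi, this]
  rw [prod_congr rfl fun i _ => h1 i, h]
  have h2 : ∀ x : Fin n → Bool, ∏ i, (if x i = true then a i else d i - a i) *
      (if i ∈ S ∧ x i = true then X else 1) = weight a d x * X ^ ones S x := by
    intro x
    rw [prod_mul_distrib]
    congr 1
    rw [prod_ite, prod_const, prod_const_one, mul_one]
    congr 1
    unfold ones
    congr 1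
    ext i
    simp
  rw [sum_congr rfl fun x _ => h2 x]
  rw [← sum_fiberwise_of_maps_to (s := univ) (t := range (n + 1)) (g := fun x => ones S x)
    (fun x _ => mem_range.2 (Nat.lt_succ_of_le (ones_le x)))]
  refine sum_congr rfl fun c _ => ?_
  unfold coef
  rw [sum_mul]
  refine sum_congr rfl fun x hx => ?_
  rw [(mem_filter.1 hx).2]

/-- At `X = 1` the generating function is the product of the denominators, so one more than this
product is a base in which the coefficients are digits. -/
theorem coef_le (had : ∀ i, a i ≤ d i) (S : Finset (Fin n)) (c : ℕ) :
    coef a d S c ≤ ∏ i, d i := by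
  rcases le_or_gt c n with hc | hc
  · have h := prod_eq_sum_coef had S 1
    have h1 : ∀ i, (if i ∈ S then (d i - a i) + a i * 1 else d i) = d i := by
      intro i
      have := had i
      split_ifs <;> omega
    rw [prod_congr rfl fun i _ => h1 i] at h
    rw [h]
    simp only [one_pow, mul_one]
    exact single_le_sum (f := fun c => coef a d S c) (fun _ _ => Nat.zero_le _)
      (mem_range.2 (Nat.lt_succ_of_le hc))
  · have : coef a d S c = 0 := by
      unfold coef
      rw [filter_false_of_mem, sum_empty]
      intro x _
      have := ones_le (S := S) x
      omega
    omega

theorem coef_eq_zero {S : Finset (Fin n)} {c : ℕ} (hc : n < c) : coef a d S c = 0 := by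
  unfold coef
  rw [filter_false_of_mem, sum_empty]
  intro x _
  have := ones_le (S := S) x
  omega

/-- The number whose digits in base `X` are the coefficients from `j` on. -/
def digitSum (a d : Fin n → ℕ) (S : Finset (Fin n)) (X j : ℕ) : ℕ :=
  ∑ c ∈ range (n + 1), coef a d S (c + j) * X ^ c

theorem digitSum_eq (S : Finset (Fin n)) (X j : ℕ) :
    digitSum a d S X j = digitSum a d S X (j + 1) * X + coef a d S j := by
  unfold digitSum
  have h := sum_range_succ (fun c => coef a d S (c + j) * X ^ c) (n + 1)
  rw [coef_eq_zero (a := a) (d := d) (S := S) (c := n + 1 + j) (by omega), zero_mul, add_zero] at h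
  rw [← h, sum_range_succ', sum_mul]
  congr 1
  · refine sum_congr rfl fun c _ => ?_
    rw [show c + 1 + j = c + (j + 1) by ring]
    ring
  · simp

theorem cast_weight {p : Fin n → ℝ} (had : ∀ i, a i ≤ d i) (hd : ∀ i, 0 < d i)
    (hp : ∀ i, p i = a i / d i) (x : Fin n → Bool) :
    (weight a d x : ℝ) = (∏ i, (d i : ℝ)) * inputProb p x := by
  unfold weight inputProb
  rw [← prod_mul_distrib]
  push_cast
  refine prod_congr rfl fun i _ => ?_
  have h : (d i : ℝ) ≠ 0 := by exact_mod_cast (hd i).ne'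
  rw [hp i]
  split_ifs
  · field_simp
  · rw [Nat.cast_sub (had i)]
    field_simp

/-- Inputs are grouped by their number `c` of ones in `S`; there are then #S - c zeros, so both
conditions for being undetermined depend on `c` only. -/
theorem cast_scaledUndet {p : Fin n → ℝ} (had : ∀ i, a i ≤ d i) (hd : ∀ i, 0 < d i)
    (hp : ∀ i, p i = a i / d i) (k : ℕ) (S : Finset (Fin n)) :
    (scaledUndet a d k S : ℝ) = (∏ i, (d i : ℝ)) * undet k p S := by
  have h1 : scaledUndet a d k S =
      ∑ x, weight a d x * if ones S x < k ∧ zeros S x + k ≤ n then 1 else 0 := by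
    unfold scaledUndet coef
    rw [← sum_filter, ← sum_biUnion]
    · rw [← sum_filter_add_sum_filter_not univ
        (fun x : Fin n → Bool => ones S x < k ∧ zeros S x + k ≤ n)]
      rw [sum_congr (s₂ := filter (fun x : Fin n → Bool => ones S x < k ∧ zeros S x + k ≤ n) univ)
        (g := fun x => weight a d x * if ones S x < k ∧ zeros S x + k ≤ n then 1 else 0) ?_ ?_]
      · refine (Nat.add_eq_left.2 (sum_eq_zero fun x hx => ?_)).symm
        rw [if_neg (mem_filter.1 hx).2, mul_zero]
      · ext x
        have := ones_add_zeros S x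
        simp only [mem_biUnion, mem_filter, mem_range, mem_univ, true_and, exists_eq_right']
        omega
      · intro x hx
        rw [if_pos (mem_filter.1 hx).2, mul_one]
    · intro c _ c' _ hcc
      refine disjoint_left.2 fun x hx hx' => hcc ?_
      simp only [mem_filter, mem_univ, true_and] at hx hx'
      omega
  rw [h1]
  unfold undet
  push_cast
  rw [mul_sum]
  refine sum_congr rfl fun x _ => ?_
  rw [cast_weight had hd hp, mul_assoc]

theorem scaledUndet_le (had : ∀ i, a i ≤ d i) (hd : ∀ i, 0 < d i) (k : ℕ)
    (S : Finset (Fin n)) : scaledUndet a d k S ≤ ∏ i, d i := by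
  have h := cast_scaledUndet (p := fun i => (a i : ℝ) / d i) had hd (fun _ => rfl) k S
  have hp : ∀ i, 0 ≤ (a i : ℝ) / d i ∧ (a i : ℝ) / d i ≤ 1 := by
    intro i
    refine ⟨by positivity, ?_⟩
    rw [div_le_one (by exact_mod_cast hd i)]
    exact_mod_cast had i
  have h1 : undet k (fun i => (a i : ℝ) / d i) S ≤ 1 := by
    rw [← sum_inputProb (fun i => (a i : ℝ) / d i)]
    refine sum_le_sum fun x _ => ?_
    have := inputProb_nonneg hp x
    split_ifs <;> linarith
  have h2 : (scaledUndet a d k S : ℝ) ≤ ((∏ i, d i : ℕ) : ℝ) := by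
    rw [h]
    push_cast
    exact mul_le_of_le_one_right (prod_nonneg fun i _ => by positivity) h1
  exact_mod_cast h2

end

end KOfN

namespace KOfN

/-! ### Reasoning about programs -/

@[simp] theorem Mem.reg_setReg (s : Mem) (d v r : ℕ) :
    (s.setReg d v).reg r = if r = d then v else s.reg r := by
  simp [Mem.setReg, Function.update_apply]

@[simp] theorem Mem.arr_setReg (s : Mem) (d v : ℕ) : (s.setReg d v).arr = s.arr := rfl

@[simp] theorem Mem.reg_setArr (s : Mem) (a i v : ℕ) : (s.setArr a i v).reg = s.reg := rfl

@[simp] theorem Mem.arr_setArr (s : Mem) (a i v a' : ℕ) :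
    (s.setArr a i v).arr a' = if a' = a then Function.update (s.arr a) i v else s.arr a' := by
  by_cases h : a' = a
  · subst h; simp [Mem.setArr]
  · simp [Mem.setArr, h]

/-- All values in the memory are at most `V`. -/
def Bounded (V : ℕ) (s : Mem) : Prop := (∀ r, s.reg r ≤ V) ∧ ∀ a i, s.arr a i ≤ V

/-- An upper bound for the number of steps if no loop is iterated more than `M` times. -/
def Prog.time (M : ℕ) : Prog → ℕ
  | .skip => 0
  | .op _ => 1
  | .seq P Q => P.time M + Q.time M
  | .ite _ P Q => 1 + (P.time M + Q.time M)
  | .loop _ P => 1 + M * (1 + P.time M)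

/-- Whether an operation assigns to the register `r`. -/
def Op.setsReg : Op → ℕ → Bool
  | .const d _, r => r == d
  | .copy d _, r => r == d
  | .add d _ _, r => r == d
  | .sub d _ _, r => r == d
  | .mul d _ _, r => r == d
  | .div d _ _, r => r == d
  | .load d _ _, r => r == d
  | .store _ _ _, _ => false

/-- Whether an operation assigns to the array `a`. -/
def Op.setsArr : Op → ℕ → Bool
  | .store a' _ _, a => a == a'
  | _, _ => false

/-- Whether a program contains an assignment to the register `r`. -/
def Prog.setsReg : Prog → ℕ → Bool
  | .skip, _ => false
  | .op o, r => o.setsReg r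
  | .seq P Q, r => P.setsReg r || Q.setsReg r
  | .ite _ P Q, r => P.setsReg r || Q.setsReg r
  | .loop _ P, r => P.setsReg r

/-- Whether a program contains an assignment to the array `a`. -/
def Prog.setsArr : Prog → ℕ → Bool
  | .skip, _ => false
  | .op o, a => o.setsArr a
  | .seq P Q, a => P.setsArr a || Q.setsArr a
  | .ite _ P Q, a => P.setsArr a || Q.setsArr a
  | .loop _ P, a => P.setsArr a

/-- The memories `s` and `s'` agree where `P` makes no assignment. -/
structure Frame (P : Prog) (s s' : Mem) : Prop where
  reg : ∀ r, P.setsReg r = false → s'.reg r = s.reg r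
  arr : ∀ a, P.setsArr a = false → s'.arr a = s.arr a

theorem Op.frame (o : Op) (s : Mem) : Frame (.op o) s (o.apply s) := by
  constructor
  · intro r hr
    cases o <;> simp_all [Prog.setsReg, Op.setsReg, Op.apply]
  · intro a ha
    cases o <;> simp_all [Prog.setsArr, Op.setsArr, Op.apply]

theorem Exec.frame {P : Prog} {s s' : Mem} {t b : ℕ} (h : Exec P s s' t b) : Frame P s s' := by
  induction h with
  | skip s => exact ⟨fun _ _ => rfl, fun _ _ => rfl⟩
  | op o s => exact o.frame s
  | seq _ _ ih₁ ih₂ =>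
    constructor
    · intro r hr
      simp only [Prog.setsReg, Bool.or_eq_false_iff] at hr
      rw [ih₂.reg r hr.2, ih₁.reg r hr.1]
    · intro a ha
      simp only [Prog.setsArr, Bool.or_eq_false_iff] at ha
      rw [ih₂.arr a ha.2, ih₁.arr a ha.1]
  | ite_true _ _ ih =>
    constructor
    · intro r hr
      simp only [Prog.setsReg, Bool.or_eq_false_iff] at hr
      exact ih.reg r hr.1
    · intro a ha
      simp only [Prog.setsArr, Bool.or_eq_false_iff] at ha
      exact ih.arr a ha.1
  | ite_false _ _ ih =>
    constructor
    · intro r hr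
      simp only [Prog.setsReg, Bool.or_eq_false_iff] at hr
      exact ih.reg r hr.2
    · intro a ha
      simp only [Prog.setsArr, Bool.or_eq_false_iff] at ha
      exact ih.arr a ha.2
  | loop_done _ => exact ⟨fun _ _ => rfl, fun _ _ => rfl⟩
  | loop_step _ _ _ ih₁ ih₂ =>
    constructor
    · intro r hr
      rw [ih₂.reg r hr, ih₁.reg r hr]
    · intro a ha
      rw [ih₂.arr a ha, ih₁.arr a ha]

/-- Started in `s`, where all values are at most `V`, the program `P` halts in a memory
satisfying `Q`; no loop is iterated more than `M` times, and no value exceeds `V`. -/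
def Runs (V M : ℕ) (P : Prog) (s : Mem) (Q : Mem → Prop) : Prop :=
  Bounded V s → ∃ s' t b, Exec P s s' t b ∧ t ≤ P.time M ∧ b ≤ t * (1 + V.size) ^ 2 ∧
    Bounded V s' ∧ Q s'

/-- The result of an operation is at most `V` if all values are. -/
def Op.Ok (V : ℕ) : Op → Mem → Prop
  | .const _ c, _ => c ≤ V
  | .add _ x y, s => s.reg x + s.reg y ≤ V
  | .mul _ x y, s => s.reg x * s.reg y ≤ V
  | _, _ => True

theorem Bounded.setReg {V : ℕ} {s : Mem} (h : Bounded V s) {d v : ℕ} (hv : v ≤ V) :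
    Bounded V (s.setReg d v) := by
  refine ⟨fun r => ?_, h.2⟩
  rw [Mem.reg_setReg]
  split_ifs
  · exact hv
  · exact h.1 r

theorem Bounded.setArr {V : ℕ} {s : Mem} (h : Bounded V s) {a i v : ℕ} (hv : v ≤ V) :
    Bounded V (s.setArr a i v) := by
  refine ⟨h.1, fun a' j => ?_⟩
  rw [Mem.arr_setArr]
  split_ifs
  · rw [Function.update_apply]
    split_ifs
    · exact hv
    · exact h.2 _ _
  · exact h.2 _ _

theorem Bounded.apply {V : ℕ} {s : Mem} (h : Bounded V s) {o : Op} (ho : o.Ok V s) :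
    Bounded V (o.apply s) := by
  cases o with
  | const d c => exact h.setReg ho
  | copy d x => exact h.setReg (h.1 x)
  | add d x y => exact h.setReg ho
  | sub d x y => exact h.setReg ((Nat.sub_le _ _).trans (h.1 x))
  | mul d x y => exact h.setReg ho
  | div d x y => exact h.setReg ((Nat.div_le_self _ _).trans (h.1 x))
  | load d a x => exact h.setReg (h.2 _ _)
  | store a x y => exact h.setArr (h.1 y)

theorem Bounded.bits_le {V : ℕ} {s : Mem} (h : Bounded V s) {o : Op} (ho : o.Ok V s) :
    o.bits s ≤ (1 + V.size) ^ 2 := by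
  have hr : ∀ r, (s.reg r).size ≤ V.size := fun r => Nat.size_le_size (h.1 r)
  have ha : ∀ a i, (s.arr a i).size ≤ V.size := fun a i => Nat.size_le_size (h.2 a i)
  have hmul : ∀ x y, (1 + (s.reg x).size) * (1 + (s.reg y).size) ≤ (1 + V.size) ^ 2 := by
    intro x y
    rw [pow_two]
    exact Nat.mul_le_mul (by have := hr x; omega) (by have := hr y; omega)
  have hadd : ∀ u v, u ≤ V.size → v ≤ V.size → 1 + u + v ≤ (1 + V.size) ^ 2 := by
    intro u v hu hv
    nlinarith
  have hone : ∀ u, u ≤ V.size → 1 + u ≤ (1 + V.size) ^ 2 := by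
    intro u hu
    nlinarith
  cases o with
  | const d c => exact hone _ (Nat.size_le_size ho)
  | copy d x => exact hone _ (hr x)
  | add d x y => exact hadd _ _ (hr x) (hr y)
  | sub d x y => exact hadd _ _ (hr x) (hr y)
  | mul d x y => exact hmul x y
  | div d x y => exact hmul x y
  | load d a x => exact hadd _ _ (hr x) (ha _ _)
  | store a x y => exact hadd _ _ (hr x) (hr y)

section

variable {V M : ℕ} {P P' : Prog} {s : Mem} {Q R : Mem → Prop}

theorem Runs.of_bounded (h : Bounded V s → Runs V M P s Q) : Runs V M P s Q :=
  fun hs => h hs hs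

theorem Runs.skip (h : Q s) : Runs V M .skip s Q :=
  fun hs => ⟨s, 0, 0, .skip s, le_rfl, by simp, hs, h⟩

theorem Runs.op {o : Op} (ho : o.Ok V s) (h : Q (o.apply s)) : Runs V M (.op o) s Q :=
  fun hs => ⟨_, 1, _, .op o s, le_rfl, by simpa using hs.bits_le ho, hs.apply ho, h⟩

/-- The frame of the first part is handed to the second, so the intermediate assertion `R` need only
mention what has changed. -/
theorem Runs.seq (h₁ : Runs V M P s R)
    (h₂ : ∀ s', R s' → Frame P s s' → Bounded V s' → Runs V M P' s' Q) :
    Runs V M (.seq P P') s Q := by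
  intro hs
  obtain ⟨s₁, t₁, b₁, he₁, ht₁, hb₁, hs₁, hR⟩ := h₁ hs
  obtain ⟨s₂, t₂, b₂, he₂, ht₂, hb₂, hs₂, hQ⟩ := h₂ s₁ hR he₁.frame hs₁ hs₁
  refine ⟨s₂, _, _, .seq he₁ he₂, Nat.add_le_add ht₁ ht₂, ?_, hs₂, hQ⟩
  rw [Nat.add_mul]
  exact Nat.add_le_add hb₁ hb₂

theorem test_le (hs : Bounded V s) (x : ℕ) : 1 + (s.reg x).size ≤ (1 + V.size) ^ 2 := by
  have := Nat.size_le_size (hs.1 x)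
  nlinarith

theorem Runs.ite {x : ℕ} (h₁ : s.reg x ≠ 0 → Runs V M P s Q)
    (h₂ : s.reg x = 0 → Runs V M P' s Q) : Runs V M (.ite x P P') s Q := by
  intro hs
  have htest := test_le hs x
  by_cases hx : s.reg x = 0
  · obtain ⟨s', t, b, he, ht, hb, hs', hQ⟩ := h₂ hx hs
    refine ⟨s', _, _, .ite_false hx he, ?_, ?_, hs', hQ⟩
    · simp only [Prog.time]; omega
    · rw [Nat.add_mul, one_mul]
      omega
  · obtain ⟨s', t, b, he, ht, hb, hs', hQ⟩ := h₁ hx hs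
    refine ⟨s', _, _, .ite_true hx he, ?_, ?_, hs', hQ⟩
    · simp only [Prog.time]; omega
    · rw [Nat.add_mul, one_mul]
      omega

/-- The invariant forces the loop register to be `N - j` before round `j`, which makes the loop stop
after exactly `N` rounds. The frame is relative to the memory before the whole loop. -/
theorem Runs.loop {x N : ℕ} (hN : N ≤ M) (I : ℕ → Mem → Prop) (hI : I 0 s)
    (hx : ∀ j s', j ≤ N → I j s' → Frame (.loop x P) s s' → s'.reg x = N - j)
    (hstep : ∀ j s', j < N → I j s' → Frame (.loop x P) s s' → Bounded V s' →
      Runs V M P s' (I (j + 1)))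
    (hQ : ∀ s', I N s' → Frame (.loop x P) s s' → Q s') : Runs V M (.loop x P) s Q := by
  have key : ∀ l j s₁, j + l = N → I j s₁ → Frame (.loop x P) s s₁ → Bounded V s₁ →
      ∃ s' t b, Exec (.loop x P) s₁ s' t b ∧ t ≤ 1 + l * (1 + P.time M) ∧
        b ≤ t * (1 + V.size) ^ 2 ∧ Bounded V s' ∧ Q s' := by
    intro l
    induction l with
    | zero =>
      intro j s₁ hj hIj hF hs₁
      have hj' : j = N := by omega
      subst hj'
      have h0 : s₁.reg x = 0 := by rw [hx j s₁ le_rfl hIj hF]; omega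
      refine ⟨s₁, 1, 1, .loop_done h0, by omega, ?_, hs₁, hQ s₁ hIj hF⟩
      have := test_le hs₁ x
      omega
    | succ l ih =>
      intro j s₁ hj hIj hF hs₁
      have h0 : s₁.reg x ≠ 0 := by rw [hx j s₁ (by omega) hIj hF]; omega
      obtain ⟨s₂, t₁, b₁, he₁, ht₁, hb₁, hs₂, hI₂⟩ := hstep j s₁ (by omega) hIj hF hs₁ hs₁
      have hF₂ : Frame (.loop x P) s s₂ := by
        have hF₁ := he₁.frame
        exact ⟨fun r hr => (hF₁.reg r hr).trans (hF.reg r hr),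
          fun a ha => (hF₁.arr a ha).trans (hF.arr a ha)⟩
      obtain ⟨s₃, t₂, b₂, he₂, ht₂, hb₂, hs₃, hQ₃⟩ := ih (j + 1) s₂ (by omega) hI₂ hF₂ hs₂
      refine ⟨s₃, _, _, .loop_step h0 he₁ he₂, ?_, ?_, hs₃, hQ₃⟩
      · have : (l + 1) * (1 + P.time M) = l * (1 + P.time M) + (1 + P.time M) := by ring
        omega
      · have := test_le hs₁ x
        rw [Nat.add_mul, Nat.add_mul, one_mul]
        omega
  intro hs
  obtain ⟨s', t, b, he, ht, hb, hs', hQ'⟩ := key N 0 s (by omega) hI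
    ⟨fun _ _ => rfl, fun _ _ => rfl⟩ hs
  refine ⟨s', t, b, he, ht.trans ?_, hb, hs', hQ'⟩
  simp only [Prog.time]
  exact Nat.add_le_add_left (Nat.mul_le_mul_right _ hN) _

end

/-! ### Straight-line code and counting loops -/

/-- A sequence of programs. -/
def Prog.seqs : List Prog → Prog
  | [] => .skip
  | P :: L => .seq P (Prog.seqs L)

/-- A sequence of operations. -/
def Prog.ops : List Op → Prog
  | [] => .skip
  | o :: L => .seq (.op o) (Prog.ops L)

/-- The effect of a sequence of operations. -/
def runOps : List Op → Mem → Mem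
  | [], s => s
  | o :: L, s => runOps L (o.apply s)

/-- The operations in a list produce no value above `V`. -/
def OpsOk (V : ℕ) : List Op → Mem → Prop
  | [], _ => True
  | o :: L, s => o.Ok V s ∧ OpsOk V L (o.apply s)

/-- `for i := 0, …, reg x - 1 do P`; the register `c` counts down, and register `3` is expected
to hold `1`. -/
def Prog.forUp (i c x : ℕ) (P : Prog) : Prog :=
  .seq (.ops [.copy c x, .const i 0]) (.loop c (.seq P (.ops [.add i i 3, .sub c c 3])))

section

variable {V M : ℕ} {P : Prog} {s : Mem} {Q : Mem → Prop}

theorem Runs.ops {L : List Op} (hL : OpsOk V L s) (h : Q (runOps L s)) :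
    Runs V M (.ops L) s Q := by
  induction L generalizing s with
  | nil => exact .skip h
  | cons o L ih =>
    refine .seq (R := fun s' => s' = o.apply s) (.op hL.1 rfl) ?_
    rintro _ rfl _ _
    exact ih hL.2 h

theorem Runs.seqs_nil (h : Q s) : Runs V M (.seqs []) s Q := .skip h

theorem Runs.seqs_cons {L : List Prog} {R : Mem → Prop} (h₁ : Runs V M P s R)
    (h₂ : ∀ s', R s' → Frame P s s' → Bounded V s' → Runs V M (.seqs L) s' Q) :
    Runs V M (.seqs (P :: L)) s Q := .seq h₁ h₂

/-- The body has to establish the invariant for the memory in which the two counters are already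
updated. That the body leaves the counters and register `3` alone is decided by computation. -/
theorem Runs.forUp {i c x N : ℕ} (hx : s.reg x = N) (hone : s.reg 3 = 1) (hN : N ≤ M)
    (hic : i ≠ c) (hi : i ≠ 3) (hc : c ≠ 3)
    (hPi : P.setsReg i = false) (hPc : P.setsReg c = false) (hP3 : P.setsReg 3 = false)
    (I : ℕ → Mem → Prop) (hI : I 0 ((s.setReg c N).setReg i 0))
    (hstep : ∀ j s', j < N → I j s' → Frame (.forUp i c x P) s s' → s'.reg i = j → Bounded V s' →
      Runs V M P s' (fun s' => I (j + 1) ((s'.setReg i (j + 1)).setReg c (N - (j + 1)))))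
    (hQ : ∀ s', I N s' → Frame (.forUp i c x P) s s' → Q s') :
    Runs V M (.forUp i c x P) s Q := by
  refine .of_bounded fun hs => ?_
  have hframe : ∀ s', Frame (.loop c (.seq P (.ops [.add i i 3, .sub c c 3])))
      ((s.setReg c N).setReg i 0) s' → Frame (.forUp i c x P) s s' := by
    intro s' hF
    constructor
    · intro r hr
      have h2 : (Prog.loop c (.seq P (.ops [.add i i 3, .sub c c 3]))).setsReg r = false := by
        simp only [Prog.forUp, Prog.setsReg, Bool.or_eq_false_iff] at hr ⊢
        exact hr.2
      rw [hF.reg r h2]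
      simp [Prog.forUp, Prog.ops, Prog.setsReg, Op.setsReg] at hr
      simp [hr]
    · intro a ha
      simp only [Prog.forUp, Prog.ops, Prog.setsArr, Op.setsArr, Bool.or_false, Bool.false_or]
        at ha
      rw [hF.arr a (by simp [Prog.ops, Prog.setsArr, Op.setsArr, ha])]
      rfl
  refine .seq (R := fun s' => s' = (s.setReg c N).setReg i 0)
    (.ops (by simp [OpsOk, Op.Ok]) (by simp [runOps, Op.apply, hx])) ?_
  rintro _ rfl _ _
  refine .loop hN (fun j s' => I j s' ∧ s'.reg i = j ∧ s'.reg c = N - j ∧ s'.reg 3 = 1)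
    ⟨hI, by simp, by simp [hic.symm], by simp [hone, hi.symm, hc.symm]⟩
    (fun j s' _ h _ => h.2.2.1) ?_ (fun s' h hF => hQ s' h.1 (hframe s' hF))
  rintro j s₁ hj ⟨hIj, hji, hjc, hj3⟩ hF hs₁
  refine .seq (hstep j s₁ hj hIj (hframe s₁ hF) hji hs₁) ?_
  intro s₂ hI₂ hF₂ _
  have h1 := (hF₂.reg i hPi).trans hji
  have h2 := (hF₂.reg c hPc).trans hjc
  have h3 := (hF₂.reg 3 hP3).trans hj3
  have hV : N ≤ V := hx ▸ hs.1 x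
  refine .ops ?_ ?_
  · simp only [OpsOk, Op.Ok, h1, h3, and_true]
    omega
  · have e : runOps [.add i i 3, .sub c c 3] s₂ =
        (s₂.setReg i (j + 1)).setReg c (N - (j + 1)) := by
      simp [runOps, Op.apply, h1, h2, h3, hic.symm, hi.symm, Nat.sub_sub]
    rw [e]
    exact ⟨hI₂, by simp [hic], by simp, by simp [h3, hi.symm, hc.symm]⟩

end

/-- For a fixed program the step bound is a polynomial in `M`. The base `M + 2 ≥ 2` lets extra
factors absorb additive constants. -/
theorem Prog.time_le (P : Prog) : ∃ c, ∀ M, P.time M ≤ (M + 2) ^ c := by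
  induction P with
  | skip => exact ⟨0, fun M => by simp [Prog.time]⟩
  | op o => exact ⟨0, fun M => by simp [Prog.time]⟩
  | seq P Q ihP ihQ =>
    obtain ⟨c, hc⟩ := ihP
    obtain ⟨d, hd⟩ := ihQ
    refine ⟨c + d + 1, fun M => ?_⟩
    have h1 : (M + 2) ^ c ≤ (M + 2) ^ (c + d) := Nat.pow_le_pow_right (by omega) (by omega)
    have h2 : (M + 2) ^ d ≤ (M + 2) ^ (c + d) := Nat.pow_le_pow_right (by omega) (by omega)
    have := hc M
    have := hd M
    simp only [Prog.time]
    rw [pow_succ]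
    nlinarith
  | ite x P Q ihP ihQ =>
    obtain ⟨c, hc⟩ := ihP
    obtain ⟨d, hd⟩ := ihQ
    refine ⟨c + d + 2, fun M => ?_⟩
    have h1 : (M + 2) ^ c ≤ (M + 2) ^ (c + d) := Nat.pow_le_pow_right (by omega) (by omega)
    have h2 : (M + 2) ^ d ≤ (M + 2) ^ (c + d) := Nat.pow_le_pow_right (by omega) (by omega)
    have h3 : 1 ≤ (M + 2) ^ (c + d) := Nat.one_le_pow _ _ (by omega)
    have := hc M
    have := hd M
    simp only [Prog.time]
    have h4 : (M + 2) ^ (c + d + 2) = (M + 2) ^ (c + d) * ((M + 2) * (M + 2)) := by ring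
    rw [h4]
    nlinarith [Nat.mul_le_mul_left ((M + 2) ^ (c + d))
      (show 4 ≤ (M + 2) * (M + 2) by nlinarith)]
  | loop x P ih =>
    obtain ⟨c, hc⟩ := ih
    refine ⟨c + 2, fun M => ?_⟩
    have h3 : 1 ≤ (M + 2) ^ c := Nat.one_le_pow _ _ (by omega)
    have := hc M
    simp only [Prog.time]
    have h4 : (M + 2) ^ (c + 2) = (M + 2) ^ c * ((M + 2) * (M + 2)) := by ring
    rw [h4]
    have h5 : M * (1 + P.time M) ≤ M * (2 * (M + 2) ^ c) := Nat.mul_le_mul_left _ (by omega)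
    nlinarith [Nat.mul_le_mul_left ((M + 2) ^ c)
      (show 1 + 2 * M ≤ (M + 2) * (M + 2) by nlinarith)]

end KOfN

namespace KOfN

open Finset

/-! ### The program -/

/-- Register `3` becomes `1`, register `4` becomes `b = n + 1`, register `5` becomes
`Q = 2 ^ (6 * m + 1)`, register `6` becomes `N = (b * b) ^ Q`. -/
def progSetup : Prog := .seqs [
  .ops [.const 3 1, .add 4 0 3, .const 5 2, .const 8 6, .mul 8 8 2],
  .forUp 9 10 8 (.ops [.add 5 5 5]),
  .ops [.const 6 1, .mul 11 4 4],
  .forUp 9 10 5 (.ops [.mul 6 6 11])]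

theorem runs_setup {V M n m : ℕ} {s : Mem} (h0 : s.reg 0 = n) (h2 : s.reg 2 = m)
    (hn : 1 ≤ n)
    (hM : ((n + 1) * (n + 1)) ^ 2 ^ (6 * m + 1) ≤ M) (hMV : M ≤ V) :
    Runs V M progSetup s (fun s' => s'.reg 3 = 1 ∧ s'.reg 4 = n + 1 ∧
      s'.reg 5 = 2 ^ (6 * m + 1) ∧ s'.reg 6 = ((n + 1) * (n + 1)) ^ 2 ^ (6 * m + 1)) := by
  have hb : 4 ≤ (n + 1) * (n + 1) := by nlinarith
  -- The number of codes exceeds `Q`, since Q < 4^Q and the base (n+1)^2 is at least 4; this makes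
  -- `M` large enough for the loops that compute it.
  have hQM : 2 ^ (6 * m + 1) ≤ M := by
    have h1 : 2 ^ (6 * m + 1) < 4 ^ 2 ^ (6 * m + 1) := Nat.lt_pow_self (by norm_num)
    have h2 : 4 ^ 2 ^ (6 * m + 1) ≤ ((n + 1) * (n + 1)) ^ 2 ^ (6 * m + 1) :=
      Nat.pow_le_pow_left hb _
    omega
  have hmM : 6 * m + 1 < M := lt_of_lt_of_le Nat.lt_two_pow_self hQM
  have hbM : (n + 1) * (n + 1) ≤ M := (Nat.le_self_pow (by positivity) _).trans hM
  have h16 : 16 ≤ M := by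
    have h1 : 4 ^ 2 ≤ ((n + 1) * (n + 1)) ^ 2 := Nat.pow_le_pow_left hb 2
    have h2 : ((n + 1) * (n + 1)) ^ 2 ≤ ((n + 1) * (n + 1)) ^ 2 ^ (6 * m + 1) :=
      Nat.pow_le_pow_right (by omega) (Nat.le_self_pow (by omega) 2)
    omega
  refine .seqs_cons (R := fun s' => s'.reg 3 = 1 ∧ s'.reg 4 = n + 1 ∧ s'.reg 5 = 2 ∧
    s'.reg 8 = 6 * m) (.ops ?_ ?_) ?_
  · simp [OpsOk, Op.Ok, Op.apply, h0, h2]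
    refine ⟨by omega, by nlinarith, by omega, by omega, by omega⟩
  · simp [runOps, Op.apply, h0, h2]
  rintro s₁ ⟨h3, h4, h5, h8⟩ - -
  refine .seqs_cons (R := fun s' => s'.reg 5 = 2 ^ (6 * m + 1))
    (.forUp h8 h3 (by omega) (by decide) (by decide) (by decide) rfl rfl rfl
      (fun j s' => s'.reg 5 = 2 ^ (j + 1)) (by simp [h5]) ?_ (fun s' h _ => h)) ?_
  · intro j s' hj hI _ _ _
    have h1 : 2 ^ (j + 1 + 1) = 2 ^ (j + 1) + 2 ^ (j + 1) := by ring
    have h2 : 2 ^ (j + 1 + 1) ≤ 2 ^ (6 * m + 1) := Nat.pow_le_pow_right (by omega) (by omega)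
    refine .ops ?_ ?_
    · simp only [OpsOk, Op.Ok, hI, and_true]
      omega
    · simp only [runOps, Op.apply, Mem.reg_setReg, hI, h1]
      simp
  intro s₂ h5' hF₂ hs₂
  have h4₂ : s₂.reg 4 = n + 1 := (hF₂.reg 4 rfl).trans h4
  have h3₂ : s₂.reg 3 = 1 := (hF₂.reg 3 rfl).trans h3
  refine .seqs_cons (R := fun s' => s'.reg 3 = 1 ∧ s'.reg 4 = n + 1 ∧
    s'.reg 5 = 2 ^ (6 * m + 1) ∧ s'.reg 6 = 1 ∧ s'.reg 11 = (n + 1) * (n + 1)) (.ops ?_ ?_) ?_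
  · simp [OpsOk, Op.Ok, Op.apply, h4₂]
    omega
  · simp [runOps, Op.apply, h4₂, h3₂, h5']
  rintro s₃ ⟨h3, h4, h5, h6, h11⟩ - -
  refine .seqs_cons (R := fun s' => s'.reg 3 = 1 ∧ s'.reg 4 = n + 1 ∧
      s'.reg 5 = 2 ^ (6 * m + 1) ∧ s'.reg 6 = ((n + 1) * (n + 1)) ^ 2 ^ (6 * m + 1))
    (.forUp h5 h3 (by omega) (by decide) (by decide) (by decide) rfl rfl rfl
      (fun j s' => s'.reg 6 = ((n + 1) * (n + 1)) ^ j) (by simp [h6]) ?_ (fun s' h hF => ?_)) ?_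
  · intro j s' hj hI hF _ _
    have h11' : s'.reg 11 = (n + 1) * (n + 1) := (hF.reg 11 rfl).trans h11
    refine .ops ?_ ?_
    · simp only [OpsOk, Op.Ok, hI, h11', and_true]
      rw [← pow_succ]
      exact (Nat.pow_le_pow_right (by omega) hj).trans (hM.trans hMV)
    · simp [runOps, Op.apply, hI, h11', pow_succ]
  · exact ⟨(hF.reg 3 rfl).trans h3, (hF.reg 4 rfl).trans h4, (hF.reg 5 rfl).trans h5, h⟩
  · intro s₄ h _ _
    exact .seqs_nil h

/-! #### Ranks -/

/-- The variable `f` comes before the variable `e`: the fraction `num f / den f` is smaller, or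
equal and `f < e`. -/
def Before (num den : ℕ → ℕ) (n f e : ℕ) : Prop :=
  num f * den e * n + f < num e * den f * n + e

instance (num den : ℕ → ℕ) (n f e : ℕ) : Decidable (Before num den n f e) :=
  inferInstanceAs (Decidable (_ < _))

/-- The number of variables that come before the variable `e`. -/
def rankOf (num den : ℕ → ℕ) (n e : ℕ) : ℕ := #{f ∈ range n | Before num den n f e}

/-- The loop that computes the rank of the variable in register `9`. -/
def progRank : Prog := .forUp 15 16 0 (.seqs [
  .ops [.load 17 0 15, .load 18 1 15, .mul 17 17 14, .mul 17 17 0, .add 17 17 15,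
    .mul 18 13 18, .mul 18 18 0, .add 18 18 9, .sub 18 18 17],
  .ite 18 (.ops [.add 12 12 3]) .skip])

/-- Array `3` receives the ranks, register `7` the product of all denominators plus `1`. -/
def progRanks : Prog := .seqs [
  .ops [.const 7 1],
  .forUp 9 10 0 (.seqs [
    .ops [.const 12 0, .load 13 0 9, .load 14 1 9],
    progRank,
    .ops [.store 3 9 12, .mul 7 7 14]]),
  .ops [.add 7 7 3]]

theorem runs_rank {V M n e : ℕ} {num den : ℕ → ℕ} {s : Mem} (h0 : s.reg 0 = n)
    (h3 : s.reg 3 = 1) (h9 : s.reg 9 = e) (h12 : s.reg 12 = 0) (h13 : s.reg 13 = num e)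
    (h14 : s.reg 14 = den e) (ha0 : s.arr 0 = num) (ha1 : s.arr 1 = den)
    (he : e < n) (hnM : n ≤ M) (hV : ∀ e < n, ∀ f < n, num f * den e * n + n ≤ V) :
    Runs V M progRank s (fun s' => s'.reg 12 = rankOf num den n e) := by
  refine .forUp h0 h3 hnM (by decide) (by decide) (by decide) rfl rfl rfl
    (fun j s' => s'.reg 12 = #{f ∈ range j | Before num den n f e}) (by simp [h12]) ?_
    (fun s' h _ => h)
  intro j s' hj hI hF hi _
  have h0' : s'.reg 0 = n := (hF.reg 0 rfl).trans h0
  have h3' : s'.reg 3 = 1 := (hF.reg 3 rfl).trans h3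
  have h9' : s'.reg 9 = e := (hF.reg 9 rfl).trans h9
  have h13' : s'.reg 13 = num e := (hF.reg 13 rfl).trans h13
  have h14' : s'.reg 14 = den e := (hF.reg 14 rfl).trans h14
  have ha0' : s'.arr 0 = num := (hF.arr 0 rfl).trans ha0
  have ha1' : s'.arr 1 = den := (hF.arr 1 rfl).trans ha1
  have hV1 := hV e he j hj
  have hV2 := hV j hj e he
  have hm1 : num j * den e ≤ num j * den e * n := Nat.le_mul_of_pos_right _ (by omega)
  have hm2 : num e * den j ≤ num e * den j * n := Nat.le_mul_of_pos_right _ (by omega)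
  refine .seqs_cons (R := fun s₁ => s₁.reg 3 = 1 ∧ s₁.reg 12 = s'.reg 12 ∧
    (s₁.reg 18 ≠ 0 ↔ Before num den n j e)) (.ops ?_ ?_) ?_
  · simp [OpsOk, Op.Ok, Op.apply, h0', h9', h13', h14', ha0', ha1', hi]
    refine ⟨?_, ?_, ?_, ?_, ?_, ?_⟩ <;> omega
  · simp [runOps, Op.apply, h0', h3', h9', h13', h14', ha0', ha1', hi]
    unfold Before
    omega
  rintro s₁ ⟨h3, h12, h18⟩ - -
  refine .seqs_cons (R := fun s₂ => s₂.reg 12 = #{f ∈ range (j + 1) | Before num den n f e})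
    ?_ (fun s₂ h _ _ => .seqs_nil (by simpa using h))
  rw [range_add_one, filter_insert]
  refine .ite (fun h => ?_) (fun h => ?_)
  · have hcard : #{f ∈ range j | Before num den n f e} ≤ j := by
      simpa using card_filter_le (range j) (fun f => Before num den n f e)
    rw [if_pos (h18.1 h), card_insert_of_notMem (by simp)]
    refine .ops ?_ ?_
    · simp only [OpsOk, Op.Ok, h3, h12, hI, and_true]
      omega
    · simp [runOps, Op.apply, h3, h12, hI]
  · rw [if_neg (fun h' => h18.2 h' h)]
    exact .skip (by rw [h12, hI])

theorem runs_ranks {V M n : ℕ} {num den : ℕ → ℕ} {s : Mem} (h0 : s.reg 0 = n)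
    (h3 : s.reg 3 = 1) (ha0 : s.arr 0 = num) (ha1 : s.arr 1 = den) (hden : ∀ e < n, 0 < den e)
    (hnM : n ≤ M) (hV : ∀ e < n, ∀ f < n, num f * den e * n + n ≤ V)
    (hD : ∏ e ∈ range n, den e + 1 ≤ V) :
    Runs V M progRanks s (fun s' => (∀ e < n, s'.arr 3 e = rankOf num den n e) ∧
      s'.reg 7 = ∏ e ∈ range n, den e + 1) := by
  refine .seqs_cons (R := fun s' => s'.reg 7 = 1) (.ops ?_ ?_) ?_
  · simp [OpsOk, Op.Ok]
    omega
  · simp [runOps, Op.apply]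
  intro s₁ h7 hF₁ _
  refine .seqs_cons (R := fun s' => (∀ e < n, s'.arr 3 e = rankOf num den n e) ∧
      s'.reg 7 = ∏ e ∈ range n, den e)
    (.forUp ((hF₁.reg 0 rfl).trans h0) ((hF₁.reg 3 rfl).trans h3) hnM (by decide) (by decide)
      (by decide) rfl rfl rfl (fun j s' => (∀ e < j, s'.arr 3 e = rankOf num den n e) ∧
      s'.reg 7 = ∏ e ∈ range j, den e) (by simp [h7]) ?_ (fun s' h _ => h)) ?_
  · rintro e s₂ he ⟨hI1, hI2⟩ hF₂ hi -
    have h0₂ : s₂.reg 0 = n := (hF₂.reg 0 rfl).trans ((hF₁.reg 0 rfl).trans h0)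
    have h3₂ : s₂.reg 3 = 1 := (hF₂.reg 3 rfl).trans ((hF₁.reg 3 rfl).trans h3)
    have ha0₂ : s₂.arr 0 = num := (hF₂.arr 0 rfl).trans ((hF₁.arr 0 rfl).trans ha0)
    have ha1₂ : s₂.arr 1 = den := (hF₂.arr 1 rfl).trans ((hF₁.arr 1 rfl).trans ha1)
    refine .seqs_cons (R := fun s' => s'.reg 0 = n ∧ s'.reg 3 = 1 ∧ s'.reg 9 = e ∧
      s'.reg 12 = 0 ∧ s'.reg 13 = num e ∧ s'.reg 14 = den e ∧ s'.arr = s₂.arr ∧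
      s'.reg 7 = s₂.reg 7) (.ops ?_ ?_) ?_
    · simp [OpsOk, Op.Ok]
    · simp [runOps, Op.apply, h0₂, h3₂, hi, ha0₂, ha1₂]
    rintro s₃ ⟨h0₃, h3₃, h9₃, h12₃, h13₃, h14₃, harr, h7₃⟩ - -
    refine .seqs_cons (runs_rank h0₃ h3₃ h9₃ h12₃ h13₃ h14₃ (by rw [harr, ha0₂])
      (by rw [harr, ha1₂]) he hnM hV) ?_
    intro s₄ h12₄ hF₄ _
    have h9₄ : s₄.reg 9 = e := (hF₄.reg 9 rfl).trans h9₃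
    have h14₄ : s₄.reg 14 = den e := (hF₄.reg 14 rfl).trans h14₃
    have h7₄ : s₄.reg 7 = ∏ e ∈ range e, den e := by rw [hF₄.reg 7 rfl, h7₃, hI2]
    have ha3₄ : s₄.arr 3 = s₂.arr 3 := by rw [hF₄.arr 3 rfl, harr]
    have hle : (∏ i ∈ range e, den i) * den e ≤ ∏ i ∈ range n, den i := by
      rw [← prod_range_succ]
      refine prod_le_prod_of_subset_of_one_le' (range_mono he) ?_
      intro i hi _
      exact hden i (mem_range.1 hi)
    refine .seqs_cons (R := fun s' => (∀ i < e + 1, s'.arr 3 i = rankOf num den n i) ∧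
      s'.reg 7 = ∏ i ∈ range (e + 1), den i) (.ops ?_ ?_)
      (fun s₅ h _ _ => .seqs_nil (by simpa using h))
    · simp only [OpsOk, Op.Ok, Op.apply, Mem.reg_setArr, h7₄, h14₄, and_true, true_and]
      omega
    · simp only [runOps, Op.apply, Mem.arr_setReg, Mem.arr_setArr, h9₄, h12₄, ha3₄]
      refine ⟨fun i hi => ?_, ?_⟩
      · simp only [if_true, Function.update_apply]
        split_ifs with hie
        · rw [hie]
        · exact hI1 i (by omega)
      · simp [h7₄, h14₄, prod_range_succ]
  · rintro s₂ ⟨hr, h7₂⟩ hF₂ -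
    have h3₂ : s₂.reg 3 = 1 := (hF₂.reg 3 rfl).trans ((hF₁.reg 3 rfl).trans h3)
    refine .seqs_cons (.ops ?_ ?_) (fun s₃ h _ _ => .seqs_nil h)
    · simpa [OpsOk, Op.Ok, h3₂, h7₂] using hD
    · simpa [runOps, Op.apply, h3₂, h7₂] using hr

end KOfN

namespace KOfN

open Finset

/-! #### Codes of interval unions -/

/-- The digits of `A` in base `b` are the ends of `Q` intervals; `r` lies in one of them. -/
def InNode (b Q A r : ℕ) : Prop :=
  ∃ j < Q, A / (b * b) ^ j % b ≤ r ∧ r < A / (b * b) ^ j / b % b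

instance (b Q A r : ℕ) : Decidable (InNode b Q A r) :=
  inferInstanceAs (Decidable (∃ j < Q, _))

theorem InNode_succ {b Q A r : ℕ} : InNode b (Q + 1) A r ↔
    InNode b Q A r ∨ (A / (b * b) ^ Q % b ≤ r ∧ r < A / (b * b) ^ Q / b % b) := by
  unfold InNode
  constructor
  · rintro ⟨j, hj, h⟩
    rcases Nat.lt_succ_iff_lt_or_eq.1 hj with h' | rfl
    · exact Or.inl ⟨j, h', h⟩
    · exact Or.inr h
  · rintro (⟨j, hj, h⟩ | h)
    · exact ⟨j, by omega, h⟩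
    · exact ⟨Q, by omega, h⟩

/-- The set of variables with code `A`. -/
def node {n : ℕ} (b Q : ℕ) (rk : Fin n → ℕ) (A : ℕ) : Finset (Fin n) := {e | InNode b Q A (rk e)}

@[simp] theorem mem_node {n b Q A : ℕ} {rk : Fin n → ℕ} {e : Fin n} :
    e ∈ node b Q rk A ↔ InNode b Q A (rk e) := by simp [node]

/-- Digit pairs are put together from the least significant one, `lo 0 + b * hi 0`, the remaining
pairs forming the quotient by b*b. -/
theorem exists_code_digits {b : ℕ} (hb : 0 < b) (Q : ℕ) (lo hi : ℕ → ℕ)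
    (h : ∀ j, lo j < b ∧ hi j < b) :
    ∃ A < (b * b) ^ Q, ∀ j < Q, A / (b * b) ^ j % b = lo j ∧ A / (b * b) ^ j / b % b = hi j := by
  induction Q generalizing lo hi with
  | zero => exact ⟨0, by simp, by simp⟩
  | succ Q ih =>
    obtain ⟨A, hA, hAd⟩ := ih (fun j => lo (j + 1)) (fun j => hi (j + 1)) (fun j => h (j + 1))
    have h0 := h 0
    have hlow : lo 0 + b * hi 0 < b * b := by nlinarith
    refine ⟨lo 0 + b * hi 0 + b * b * A, ?_, ?_⟩
    · have : b * b * (A + 1) ≤ b * b * (b * b) ^ Q := Nat.mul_le_mul_left _ hA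
      rw [pow_succ']
      nlinarith
    · intro j hj
      cases j with
      | zero =>
        have e : lo 0 + b * hi 0 + b * b * A = lo 0 + b * (hi 0 + b * A) := by ring
        rw [pow_zero, Nat.div_one, e]
        refine ⟨?_, ?_⟩
        · rw [Nat.add_mul_mod_self_left, Nat.mod_eq_of_lt h0.1]
        · rw [Nat.add_mul_div_left _ _ hb, Nat.div_eq_of_lt h0.1, zero_add,
            Nat.add_mul_mod_self_left, Nat.mod_eq_of_lt h0.2]
      | succ j =>
        rw [pow_succ', ← Nat.div_div_eq_div_mul, Nat.add_mul_div_left _ _ (by positivity),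
          Nat.div_eq_of_lt hlow, zero_add]
        exact hAd j (by omega)

theorem exists_code {n Q : ℕ} {rk : Fin n → ℕ} {S : Finset (Fin n)}
    (h : IntervalUnion rk Q S) :
    ∃ A < ((n + 1) * (n + 1)) ^ Q, node (n + 1) Q rk A = S := by
  obtain ⟨lo, hi, hle, hS⟩ := h
  obtain ⟨A, hA, hAd⟩ := exists_code_digits (b := n + 1) (by omega) Q lo hi
    (fun j => ⟨by have := (hle j).1; omega, by have := (hle j).2; omega⟩)
  refine ⟨A, hA, ?_⟩
  ext e
  rw [hS]
  rw [mem_node, InNode]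
  refine exists_congr fun j => and_congr_right fun hj => ?_
  rw [(hAd j hj).1, (hAd j hj).2]

theorem node_zero {n b Q : ℕ} (rk : Fin n → ℕ) : node b Q rk 0 = ∅ := by
  simp [node, InNode]

/-- The lowest digit pair of this code is 0 and `n`, the interval of all ranks. -/
theorem node_full {n Q : ℕ} {rk : Fin n → ℕ} (hlt : ∀ e, rk e < n) (hQ : 0 < Q) :
    node (n + 1) Q rk (n * (n + 1)) = univ := by
  ext e
  rw [mem_node, InNode]
  simp only [mem_univ, iff_true]
  refine ⟨0, hQ, ?_⟩
  rw [pow_zero, Nat.div_one, Nat.mul_mod_left, Nat.mul_div_cancel _ (by omega),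
    Nat.mod_eq_of_lt (by omega)]
  exact ⟨by omega, hlt e⟩

/-! #### The dynamic program -/

/-- The minimum of `D A` and `w B + D B` over `B < j`, and where it is attained. -/
def bestStep (w D : ℕ → ℕ) (A : ℕ) : ℕ → ℕ × ℕ
  | 0 => (D A, A)
  | j + 1 => if w j + D j < (bestStep w D A j).1 then (w j + D j, j) else bestStep w D A j

theorem bestStep_le {w D : ℕ → ℕ} {A j B : ℕ} (hB : B < j) :
    (bestStep w D A j).1 ≤ w B + D B := by
  induction j with
  | zero => omega
  | succ j ih =>
    unfold bestStep
    rcases Nat.lt_succ_iff_lt_or_eq.1 hB with h | rfl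
    · have := ih h
      split_ifs <;> (try dsimp only) <;> omega
    · split_ifs <;> (try dsimp only) <;> omega

theorem bestStep_le_self {w D : ℕ → ℕ} {A j : ℕ} : (bestStep w D A j).1 ≤ D A := by
  induction j with
  | zero => exact le_rfl
  | succ j ih =>
    unfold bestStep
    split_ifs <;> (try dsimp only) <;> omega

theorem bestStep_snd_lt {w D : ℕ → ℕ} {A j N : ℕ} (hA : A < N) (hj : j ≤ N) :
    (bestStep w D A j).2 < N := by
  induction j with
  | zero => exact hA
  | succ j ih =>
    unfold bestStep
    have := ih (by omega)
    split_ifs <;> (try dsimp only) <;> omega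

/-- The initial candidate `D A` is the step from `A` to itself, which is free. -/
theorem bestStep_eq {w D : ℕ → ℕ} {A j : ℕ} (hw : w A = 0) :
    (bestStep w D A j).1 = w (bestStep w D A j).2 + D (bestStep w D A j).2 := by
  induction j with
  | zero => simp [bestStep, hw]
  | succ j ih =>
    unfold bestStep
    split_ifs
    · rfl
    · exact ih

/-- The length of a shortest path with `r` steps from the node `A`. -/
def dist (w : ℕ → ℕ → ℕ) (D : ℕ → ℕ) (N : ℕ) : ℕ → ℕ → ℕ
  | 0, A => D A
  | r + 1, A => (bestStep (w A) (dist w D N r) A N).1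

/-- The second node on a shortest path with `r` steps from the node `A`; after `0` steps the
path continues to the node `full`. -/
def next (w : ℕ → ℕ → ℕ) (D : ℕ → ℕ) (N full : ℕ) : ℕ → ℕ → ℕ
  | 0, _ => full
  | r + 1, A => (bestStep (w A) (dist w D N r) A N).2

theorem dist_succ_le {w : ℕ → ℕ → ℕ} {D : ℕ → ℕ} {N : ℕ} (r A : ℕ) :
    dist w D N (r + 1) A ≤ dist w D N r A := bestStep_le_self

/-- A path may stay where it is, so a fixed large number of rounds covers all shorter paths. -/
theorem dist_anti {w : ℕ → ℕ → ℕ} {D : ℕ → ℕ} {N r r' : ℕ} (h : r ≤ r') (A : ℕ) :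
    dist w D N r' A ≤ dist w D N r A :=
  antitone_nat_of_succ_le (f := fun r => dist w D N r A) (fun r => dist_succ_le r A) h

theorem dist_le_of_reach {n Q : ℕ} {rk : Fin n → ℕ} {q : Finset (Fin n) → ℕ} {r v : ℕ}
    {S : Finset (Fin n)} (h : Reach q (IntervalUnion rk Q) r S v) {A : ℕ}
    (hA : node (n + 1) Q rk A = S) :
    dist (fun A B => #(node (n + 1) Q rk B \ node (n + 1) Q rk A) * q (node (n + 1) Q rk A))
      (fun A => n * q (node (n + 1) Q rk A)) (((n + 1) * (n + 1)) ^ Q) r A ≤ v := by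
  induction h generalizing A with
  | zero _ =>
    subst hA
    exact le_rfl
  | @succ r v S B _ hB ih =>
    have hBok : IntervalUnion rk Q B := by cases hB <;> assumption
    obtain ⟨C, hC, rfl⟩ := exists_code hBok
    subst hA
    exact (bestStep_le hC).trans (Nat.add_le_add_left (ih rfl) _)

end KOfN

namespace KOfN

open Finset

/-! #### The table of all nodes -/

/-- The constants and tables that the main part of the program only reads. -/
structure Env (n k Q N X : ℕ) (num den rk : ℕ → ℕ) (s : Mem) : Prop where
  r0 : s.reg 0 = n
  r1 : s.reg 1 = k
  r3 : s.reg 3 = 1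
  r4 : s.reg 4 = n + 1
  r5 : s.reg 5 = Q
  r6 : s.reg 6 = N
  r7 : s.reg 7 = X
  a0 : s.arr 0 = num
  a1 : s.arr 1 = den
  a3 : ∀ e < n, s.arr 3 e = rk e

/-- The program makes no assignment to what `Env` describes. -/
def Prog.Keeps (P : Prog) : Prop :=
  (∀ r ∈ [0, 1, 3, 4, 5, 6, 7], P.setsReg r = false) ∧ ∀ a ∈ [0, 1, 3], P.setsArr a = false

instance (P : Prog) : Decidable P.Keeps := inferInstanceAs (Decidable (_ ∧ _))

/-- Carries the constants and input tables past any part of the program; `Prog.Keeps` is a finite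
check settled by `decide`. -/
theorem Env.frame {n k Q N X : ℕ} {num den rk : ℕ → ℕ} {s s' : Mem} {P : Prog}
    (h : Env n k Q N X num den rk s) (hF : Frame P s s') (hP : P.Keeps) :
    Env n k Q N X num den rk s' where
  r0 := (hF.reg 0 (hP.1 0 (by simp))).trans h.r0
  r1 := (hF.reg 1 (hP.1 1 (by simp))).trans h.r1
  r3 := (hF.reg 3 (hP.1 3 (by simp))).trans h.r3
  r4 := (hF.reg 4 (hP.1 4 (by simp))).trans h.r4
  r5 := (hF.reg 5 (hP.1 5 (by simp))).trans h.r5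
  r6 := (hF.reg 6 (hP.1 6 (by simp))).trans h.r6
  r7 := (hF.reg 7 (hP.1 7 (by simp))).trans h.r7
  a0 := (hF.arr 0 (hP.2 0 (by simp))).trans h.a0
  a1 := (hF.arr 1 (hP.2 1 (by simp))).trans h.a1
  a3 := fun e he => by rw [hF.arr 3 (hP.2 3 (by simp)), h.a3 e he]

/-- The bound `V` is large enough for all values that occur, and `M` for all loops. -/
structure Sizes (n k Q N X V M : ℕ) (num den rk : ℕ → ℕ) : Prop where
  k_le : k ≤ n
  full_lt : n * (n + 1) < N
  Q_le : Q ≤ N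
  lt_M : N < M
  index_le : (N + 2) * (N + 2) ≤ V
  X_eq : X = ∏ e ∈ range n, den e + 1
  XX_le : X * X ≤ V
  prod_le : (∏ e ∈ range n, den e) * X ^ n ≤ V
  cost_le : 2 * n * (∏ e ∈ range n, den e) ≤ V
  num_le : ∀ e < n, num e ≤ den e
  den_pos : ∀ e < n, 0 < den e
  rk_lt : ∀ e < n, rk e < n

section

variable {n k Q N X V M : ℕ} {num den rk : ℕ → ℕ} {s : Mem}

theorem Sizes.n_le (hZ : Sizes n k Q N X V M num den rk) : n ≤ N := by
  have := hZ.full_lt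
  nlinarith

theorem Sizes.cell_le (hZ : Sizes n k Q N X V M num den rk) {A e : ℕ} (hA : A ≤ N + 1)
    (he : e ≤ N) : A * n + e ≤ V := by
  have h1 := hZ.index_le
  have h2 : A * n ≤ (N + 1) * N := Nat.mul_le_mul hA hZ.n_le
  nlinarith

theorem Sizes.row_le (hZ : Sizes n k Q N X V M num den rk) {r A : ℕ} (hr : r ≤ N + 1)
    (hA : A ≤ N) : r * N + A ≤ V := by
  have h1 := hZ.index_le
  have h2 : r * N ≤ (N + 1) * N := Nat.mul_le_mul_right _ hr
  nlinarith

theorem Sizes.small_le (hZ : Sizes n k Q N X V M num den rk) : 4 * n + 4 ≤ V := by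
  have h1 := hZ.index_le
  have h2 := hZ.n_le
  have h3 := hZ.full_lt
  nlinarith

theorem Sizes.den_le (hZ : Sizes n k Q N X V M num den rk) {e : ℕ} (he : e < n) :
    den e ≤ ∏ i ∈ range n, den i :=
  single_le_prod' (f := den) (fun i hi => hZ.den_pos i (mem_range.1 hi)) (mem_range.2 he)

/-- Register `17` becomes `1` if the rank in register `18` belongs to the node with the code in
register `16`. -/
def progDigits : Prog := .forUp 19 20 5 (.seqs [
  .ops [.div 21 16 4, .mul 22 21 4, .sub 22 16 22, .div 16 21 4, .mul 23 16 4, .sub 23 21 23,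
    .sub 22 22 18, .add 24 18 3, .sub 24 24 23, .add 22 22 24],
  .ite 22 .skip (.ops [.const 17 1])])

theorem runs_digits (hZ : Sizes n k Q N X V M num den rk) (hE : Env n k Q N X num den rk s)
    {A r : ℕ} (h16 : s.reg 16 = A) (h17 : s.reg 17 = 0) (h18 : s.reg 18 = r) (hr : r < n) :
    Runs V M progDigits s (fun s' => s'.reg 17 = if InNode (n + 1) Q A r then 1 else 0) := by
  have hsmall := hZ.small_le
  refine .forUp hE.r5 hE.r3 (by have := hZ.Q_le; have := hZ.lt_M; omega) (by decide) (by decide)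
    (by decide) rfl rfl rfl (fun j s' => s'.reg 16 = A / ((n + 1) * (n + 1)) ^ j ∧
      s'.reg 17 = if InNode (n + 1) j A r then 1 else 0) (by simp [h16, h17, InNode]) ?_
    (fun s' h _ => h.2)
  rintro j s₁ hj ⟨hI1, hI2⟩ hF hi hB
  have hE₁ := hE.frame hF (by decide)
  have h18₁ : s₁.reg 18 = r := (hF.reg 18 rfl).trans h18
  have hx := hB.1 16
  set x := s₁.reg 16 with hxdef
  have hmod : ∀ y, y - y / (n + 1) * (n + 1) = y % (n + 1) := fun y => by
    have := Nat.div_add_mod' y (n + 1)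
    omega
  have hlo : x % (n + 1) < n + 1 := Nat.mod_lt _ (by omega)
  have hm1 : x / (n + 1) * (n + 1) ≤ x := Nat.div_mul_le_self _ _
  have hm2 : x / (n + 1) / (n + 1) * (n + 1) ≤ x / (n + 1) := Nat.div_mul_le_self _ _
  have hm3 : x / (n + 1) ≤ x := Nat.div_le_self _ _
  -- Register `22` becomes (lo - r) + (r + 1 - hi) in truncated subtraction, which vanishes exactly
  -- if lo ≤ r < hi.
  refine .seqs_cons (R := fun s₂ => s₂.reg 16 = A / ((n + 1) * (n + 1)) ^ (j + 1) ∧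
    s₂.reg 17 = s₁.reg 17 ∧
    (s₂.reg 22 = 0 ↔ x % (n + 1) ≤ r ∧ r < x / (n + 1) % (n + 1))) (.ops ?_ ?_) ?_
  · simp [OpsOk, Op.Ok, Op.apply, hE₁.r4, hE₁.r3, h18₁, ← hxdef, hmod]
    refine ⟨by omega, by omega, by omega, by omega⟩
  · simp [runOps, Op.apply, hE₁.r4, hE₁.r3, h18₁, ← hxdef, hmod]
    refine ⟨?_, by omega⟩
    rw [hI1, Nat.div_div_eq_div_mul, Nat.div_div_eq_div_mul, pow_succ]
  rintro s₂ ⟨h16₂, h17₂, h22₂⟩ - -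
  refine .seqs_cons (R := fun s₃ => s₃.reg 16 = A / ((n + 1) * (n + 1)) ^ (j + 1) ∧
    s₃.reg 17 = if InNode (n + 1) (j + 1) A r then 1 else 0) ?_
    (fun s₃ h _ _ => .seqs_nil (by simpa using h))
  rw [hI1] at h22₂
  simp only [InNode_succ, ← h22₂]
  refine .ite (fun h => .skip ⟨h16₂, ?_⟩) (fun h => .ops ?_ ?_)
  · rw [h17₂, hI2]
    simp [h]
  · simp [OpsOk, Op.Ok]
    omega
  · simp [runOps, Op.apply, h16₂, h]

/-- The contribution of the variable `e` to the number that encodes the distribution for the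
node `A`. -/
def factor (n Q X : ℕ) (num den rk : ℕ → ℕ) (A e : ℕ) : ℕ :=
  if InNode (n + 1) Q A (rk e) then den e - num e + num e * X else den e

/-- Enters the elements of the node in register `9` into array `4`; register `11` becomes the
product of all factors, and register `12` the size of the node. -/
def progProduct : Prog := .forUp 14 15 0 (.seqs [
  .ops [.copy 16 9, .const 17 0, .load 18 3 14],
  progDigits,
  .ops [.add 21 13 14, .store 4 21 17, .load 22 0 14, .load 23 1 14],
  .ite 17 (.ops [.sub 23 23 22, .mul 22 22 7, .add 23 23 22, .mul 11 11 23, .add 12 12 3])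
    (.ops [.mul 11 11 23])])

theorem Sizes.factor_le (hZ : Sizes n k Q N X V M num den rk) (A : ℕ) {e : ℕ} (he : e < n) :
    factor n Q X num den rk A e ≤ den e * X := by
  have h1 := hZ.num_le e he
  have h2 : 1 ≤ X := by rw [hZ.X_eq]; omega
  unfold factor
  split_ifs
  · obtain ⟨c, hc⟩ := Nat.exists_eq_add_of_le h1
    rw [hc, Nat.add_sub_cancel_left]
    nlinarith
  · nlinarith

theorem Sizes.prod_factor_le (hZ : Sizes n k Q N X V M num den rk) (A : ℕ) {e : ℕ}
    (he : e ≤ n) : ∏ i ∈ range e, factor n Q X num den rk A i ≤ V := by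
  refine le_trans ?_ hZ.prod_le
  have h2 : 1 ≤ X := by rw [hZ.X_eq]; omega
  calc _ ≤ ∏ i ∈ range e, den i * X :=
        prod_le_prod' fun i hi => hZ.factor_le A (by have := mem_range.1 hi; omega)
    _ ≤ ∏ i ∈ range n, den i * X := by
        refine prod_le_prod_of_subset_of_one_le' (range_mono he) fun i hi _ => ?_
        have := hZ.den_pos i (mem_range.1 hi)
        exact Nat.mul_pos this h2
    _ = _ := by rw [prod_mul_distrib, prod_const, card_range]

theorem runs_product (hZ : Sizes n k Q N X V M num den rk) (hE : Env n k Q N X num den rk s)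
    {A : ℕ} (hA : A < N) (h9 : s.reg 9 = A) (h11 : s.reg 11 = 1) (h12 : s.reg 12 = 0)
    (h13 : s.reg 13 = A * n) :
    Runs V M progProduct s (fun s' =>
      s'.reg 11 = ∏ e ∈ range n, factor n Q X num den rk A e ∧
      s'.reg 12 = #{e ∈ range n | InNode (n + 1) Q A (rk e)} ∧
      (∀ e < n, s'.arr 4 (A * n + e) = if InNode (n + 1) Q A (rk e) then 1 else 0) ∧
      ∀ i < A * n, s'.arr 4 i = s.arr 4 i) := by
  have hsmall := hZ.small_le
  refine .forUp hE.r0 hE.r3 (by have := hZ.n_le; have := hZ.lt_M; omega) (by decide) (by decide)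
    (by decide) rfl rfl rfl (fun j s' =>
      s'.reg 11 = ∏ e ∈ range j, factor n Q X num den rk A e ∧
      s'.reg 12 = #{e ∈ range j | InNode (n + 1) Q A (rk e)} ∧
      (∀ e < j, s'.arr 4 (A * n + e) = if InNode (n + 1) Q A (rk e) then 1 else 0) ∧
      ∀ i < A * n, s'.arr 4 i = s.arr 4 i) (by simp [h11, h12]) ?_ (fun s' h _ => h)
  rintro e s₁ he ⟨hI1, hI2, hI3, hI4⟩ hF hi hB
  have hE₁ := hE.frame hF (by decide)
  have h9₁ : s₁.reg 9 = A := (hF.reg 9 rfl).trans h9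
  have h13₁ : s₁.reg 13 = A * n := (hF.reg 13 rfl).trans h13
  refine .seqs_cons (R := fun s₂ => s₂.reg 16 = A ∧ s₂.reg 17 = 0 ∧ s₂.reg 18 = rk e ∧
    s₂.reg 11 = s₁.reg 11 ∧ s₂.reg 12 = s₁.reg 12 ∧ s₂.reg 13 = A * n ∧ s₂.reg 14 = e ∧
    s₂.arr = s₁.arr) (.ops ?_ ?_) ?_
  · simp [OpsOk, Op.Ok]
  · simp [runOps, Op.apply, h9₁, h13₁, hi, hE₁.a3 e he]
  rintro s₂ ⟨h16₂, h17₂, h18₂, h11₂, h12₂, h13₂, h14₂, harr₂⟩ hF₂ -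
  have hE₂ := hE₁.frame hF₂ (by decide)
  refine .seqs_cons (runs_digits hZ hE₂ h16₂ h17₂ h18₂ (hZ.rk_lt e he)) ?_
  rintro s₃ h17₃ hF₃ -
  have hE₃ := hE₂.frame hF₃ (by decide)
  have h11₃ : s₃.reg 11 = s₁.reg 11 := (hF₃.reg 11 rfl).trans h11₂
  have h12₃ : s₃.reg 12 = s₁.reg 12 := (hF₃.reg 12 rfl).trans h12₂
  have h13₃ : s₃.reg 13 = A * n := (hF₃.reg 13 rfl).trans h13₂
  have h14₃ : s₃.reg 14 = e := (hF₃.reg 14 rfl).trans h14₂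
  have harr₃ : s₃.arr 4 = s₁.arr 4 := by rw [hF₃.arr 4 rfl, harr₂]
  refine .seqs_cons (R := fun s₄ => s₄.reg 17 = s₃.reg 17 ∧ s₄.reg 22 = num e ∧
    s₄.reg 23 = den e ∧ s₄.reg 11 = s₁.reg 11 ∧ s₄.reg 12 = s₁.reg 12 ∧
    (∀ e' < e + 1, s₄.arr 4 (A * n + e') = if InNode (n + 1) Q A (rk e') then 1 else 0) ∧
      ∀ i < A * n, s₄.arr 4 i = s.arr 4 i) (.ops ?_ ?_) ?_
  · simp [OpsOk, Op.Ok, h13₃, h14₃]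
    exact hZ.cell_le (by omega) (by have := hZ.n_le; omega)
  · simp [runOps, Op.apply, h11₃, h12₃, h13₃, h14₃, harr₃, hE₃.a0, hE₃.a1, h17₃,
      Function.update_apply]
    refine ⟨fun e' he' => ?_, fun i hi => ?_⟩
    · by_cases h1 : e' = e
      · subst h1; simp
      · rw [if_neg h1, hI3 e' (by omega)]
    · rw [if_neg (by omega), hI4 i hi]
  rintro s₄ ⟨h17₄, h22₄, h23₄, h11₄, h12₄, h4₄⟩ hF₄ -
  have hE₄ := hE₃.frame hF₄ (by decide)
  refine .seqs_cons (R := fun s₅ =>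
      s₅.reg 11 = ∏ e ∈ range (e + 1), factor n Q X num den rk A e ∧
      s₅.reg 12 = #{e ∈ range (e + 1) | InNode (n + 1) Q A (rk e)} ∧
      (∀ e' < e + 1, s₅.arr 4 (A * n + e') = if InNode (n + 1) Q A (rk e') then 1 else 0) ∧
      ∀ i < A * n, s₅.arr 4 i = s.arr 4 i) ?_
    (fun s₅ h _ _ => .seqs_nil (by simpa using h))
  have hP := hZ.prod_factor_le A (e := e + 1) (by omega)
  rw [prod_range_succ] at hP ⊢
  rw [range_add_one, filter_insert]
  have hcard : #{f ∈ range e | InNode (n + 1) Q A (rk f)} ≤ e := by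
    simpa using card_filter_le (range e) (fun f => InNode (n + 1) Q A (rk f))
  have hnd := hZ.num_le e he
  have hdle := hZ.den_le he
  have hX := hZ.X_eq
  have hXX := hZ.XX_le
  by_cases hin : InNode (n + 1) Q A (rk e)
  · rw [if_pos hin, card_insert_of_notMem (by simp)]
    have hfac : factor n Q X num den rk A e = den e - num e + num e * X := if_pos hin
    rw [hfac] at hP ⊢
    have hm : den e - num e + num e * X ≤ X * X := by
      refine (hfac ▸ hZ.factor_le A he).trans (Nat.mul_le_mul_right _ (by omega))
    refine .ite (fun _ => .ops ?_ ?_) (fun h => ?_)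
    · simp [OpsOk, Op.Ok, Op.apply, h22₄, h23₄, h11₄, h12₄, hE₄.r7, hE₄.r3, hI1, hI2]
      exact ⟨by omega, by omega, hP, by omega⟩
    · simp [runOps, Op.apply, h22₄, h23₄, h11₄, h12₄, hE₄.r7, hE₄.r3, hI1, hI2]
      simpa using h4₄
    · simp [h17₄, h17₃, hin] at h
  · rw [if_neg hin]
    have hfac : factor n Q X num den rk A e = den e := if_neg hin
    rw [hfac] at hP ⊢
    refine .ite (fun h => ?_) (fun _ => .ops ?_ ?_)
    · simp [h17₄, h17₃, hin] at h
    · simp [OpsOk, Op.Ok, h23₄, h11₄, hI1]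
      exact hP
    · simp [runOps, Op.apply, h23₄, h11₄, h12₄, hI1, hI2]
      simpa using h4₄

/-- Sums the digits of register `11` that belong to undetermined states. -/
def progSum : Prog := .forUp 14 15 1 (.seqs [
  .ops [.div 16 11 7, .mul 17 16 7, .sub 17 11 17, .copy 11 16, .add 18 14 0, .sub 18 12 18],
  .ite 18 .skip (.ops [.add 13 13 17])])

/-- Each round divides register `11` by `X`: the remainder is the coefficient at `c`, the quotient
holds the later ones. Running `c` only below `k` is the first condition for being undetermined; the
test of register `18` is the second. -/
theorem runs_sum (hZ : Sizes n k Q N X V M num den rk) (hE : Env n k Q N X num den rk s)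
    {S : Finset (Fin n)}
    (h11 : s.reg 11 = digitSum (fun e : Fin n => num e) (fun e : Fin n => den e) S X 0)
    (h12 : s.reg 12 = #S + k) (h13 : s.reg 13 = 0) :
    Runs V M progSum s (fun s' =>
      s'.reg 13 = scaledUndet (fun e : Fin n => num e) (fun e : Fin n => den e) k S) := by
  have hsmall := hZ.small_le
  have hk := hZ.k_le
  set a : Fin n → ℕ := fun e => num e with ha
  set d : Fin n → ℕ := fun e => den e with hd
  have had : ∀ i, a i ≤ d i := fun i => hZ.num_le i i.2
  have hprod : ∏ i, d i = ∏ e ∈ range n, den e := by rw [prod_range]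
  have hcost : scaledUndet a d k S ≤ V := by
    refine (scaledUndet_le had (fun i => hZ.den_pos i i.2) k S).trans ?_
    rw [hprod]
    have := hZ.XX_le
    have := hZ.X_eq
    nlinarith
  refine .forUp hE.r1 hE.r3 (by have := hZ.n_le; have := hZ.lt_M; omega) (by decide) (by decide)
    (by decide) rfl rfl rfl (fun j s' => s'.reg 11 = digitSum a d S X j ∧
      s'.reg 13 = ∑ c ∈ range j, if #S + k ≤ c + n then coef a d S c else 0)
    (by simp [h11, h13]) ?_ (fun s' h _ => h.2)
  rintro c s₁ hc ⟨hI1, hI2⟩ hF hi hB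
  have hE₁ := hE.frame hF (by decide)
  have h12₁ : s₁.reg 12 = #S + k := (hF.reg 12 rfl).trans h12
  -- Because of the 1 added to the product of the denominators, coefficients are proper digits and
  -- no carry occurs.
  have hcoef : coef a d S c < X := by
    have := coef_le had S c
    rw [hprod] at this
    rw [hZ.X_eq]
    omega
  have hdiv : digitSum a d S X c / X = digitSum a d S X (c + 1) := by
    rw [digitSum_eq S X c, mul_comm, Nat.mul_add_div (by omega), Nat.div_eq_of_lt hcoef, add_zero]
  have hdig := digitSum_eq (a := a) (d := d) S X c
  have h11₁ := hB.1 11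
  rw [hI1] at h11₁
  refine .seqs_cons (R := fun s₂ => s₂.reg 11 = digitSum a d S X (c + 1) ∧
    s₂.reg 17 = coef a d S c ∧ s₂.reg 13 = s₁.reg 13 ∧
    (s₂.reg 18 = 0 ↔ #S + k ≤ c + n)) (.ops ?_ ?_) ?_
  · simp [OpsOk, Op.Ok, Op.apply, hE₁.r0, hE₁.r7, hI1, hi, hdiv]
    omega
  · simp [runOps, Op.apply, hE₁.r0, hE₁.r7, h12₁, hI1, hi, hdiv]
    omega
  rintro s₂ ⟨h11₂, h17₂, h13₂, h18₂⟩ - -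
  refine .seqs_cons (R := fun s₃ => s₃.reg 11 = digitSum a d S X (c + 1) ∧
      s₃.reg 13 = ∑ c ∈ range (c + 1), if #S + k ≤ c + n then coef a d S c else 0) ?_
    (fun s₃ h _ _ => .seqs_nil (by simpa using h))
  have hle : ∑ c ∈ range (c + 1), (if #S + k ≤ c + n then coef a d S c else 0) ≤
      scaledUndet a d k S := sum_le_sum_of_subset (range_mono hc)
  rw [sum_range_succ] at hle ⊢
  refine .ite (fun h => .skip ⟨h11₂, ?_⟩) (fun h => ?_)
  · rw [if_neg (fun h' => h (h18₂.2 h')), h13₂, hI2, add_zero]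
  · rw [if_pos (h18₂.1 h)] at hle ⊢
    refine .ops ?_ ?_
    · simp [OpsOk, Op.Ok, h13₂, hI2, h17₂]
      omega
    · simp [runOps, Op.apply, h11₂, h13₂, hI2, h17₂]

/-- Enters the elements of all nodes into array `4`, their scaled probabilities into array `5`,
and the first rows of the dynamic program into arrays `6` and `7`. -/
def progTables : Prog := .forUp 9 10 6 (.seqs [
  .ops [.const 11 1, .const 12 0, .mul 13 9 0],
  progProduct,
  .ops [.const 13 0, .add 12 12 1],
  progSum,
  .ops [.store 5 9 13, .mul 13 0 13, .store 6 9 13, .mul 14 0 4, .store 7 9 14]])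

/-- The scaled probability that the variables in the node `A` do not determine the function. -/
def nodeUndet (n k Q : ℕ) (num den rk : ℕ → ℕ) (A : ℕ) : ℕ :=
  scaledUndet (fun e : Fin n => num e) (fun e : Fin n => den e) k
    (node (n + 1) Q (fun e : Fin n => rk e) A)

theorem card_node (A : ℕ) : #(node (n + 1) Q (fun e : Fin n => rk e) A) =
    #{e ∈ range n | InNode (n + 1) Q A (rk e)} := by
  unfold node
  rw [card_filter, card_filter, sum_range]

theorem Sizes.nodeUndet_le (hZ : Sizes n k Q N X V M num den rk) (A : ℕ) :
    nodeUndet n k Q num den rk A ≤ ∏ e ∈ range n, den e := by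
  rw [prod_range]
  exact scaledUndet_le (fun i => hZ.num_le i i.2) (fun i => hZ.den_pos i i.2) k _

theorem runs_tables (hZ : Sizes n k Q N X V M num den rk) (hE : Env n k Q N X num den rk s) :
    Runs V M progTables s (fun s' => ∀ A < N,
      (∀ e < n, s'.arr 4 (A * n + e) = if InNode (n + 1) Q A (rk e) then 1 else 0) ∧
      s'.arr 5 A = nodeUndet n k Q num den rk A ∧
      s'.arr 6 A = n * nodeUndet n k Q num den rk A ∧ s'.arr 7 A = n * (n + 1)) := by
  have hsmall := hZ.small_le
  have hk := hZ.k_le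
  refine .forUp hE.r6 hE.r3 hZ.lt_M.le (by decide) (by decide)
    (by decide) rfl rfl rfl (fun j s' => ∀ A < j,
      (∀ e < n, s'.arr 4 (A * n + e) = if InNode (n + 1) Q A (rk e) then 1 else 0) ∧
      s'.arr 5 A = nodeUndet n k Q num den rk A ∧
      s'.arr 6 A = n * nodeUndet n k Q num den rk A ∧ s'.arr 7 A = n * (n + 1))
    (by simp) ?_ (fun s' h _ => h)
  intro A s₁ hA hI hF hi hB
  have hE₁ := hE.frame hF (by decide)
  refine .seqs_cons (R := fun s₂ => s₂.reg 9 = A ∧ s₂.reg 11 = 1 ∧ s₂.reg 12 = 0 ∧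
    s₂.reg 13 = A * n ∧ s₂.arr = s₁.arr) (.ops ?_ ?_) ?_
  · simp [OpsOk, Op.Ok, Op.apply, hi, hE₁.r0]
    exact ⟨by omega, hZ.cell_le (e := 0) (by omega) (by omega)⟩
  · simp [runOps, Op.apply, hi, hE₁.r0]
  rintro s₂ ⟨h9₂, h11₂, h12₂, h13₂, harr₂⟩ hF₂ -
  have hE₂ := hE₁.frame hF₂ (by decide)
  refine .seqs_cons (runs_product hZ hE₂ hA h9₂ h11₂ h12₂ h13₂) ?_
  rintro s₃ ⟨h11₃, h12₃, h4₃, h4₃'⟩ hF₃ -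
  have hE₃ := hE₂.frame hF₃ (by decide)
  have h9₃ : s₃.reg 9 = A := (hF₃.reg 9 rfl).trans h9₂
  rw [harr₂] at h4₃'
  rw [← card_node] at h12₃
  have hcard : #(node (n + 1) Q (fun e : Fin n => rk e) A) ≤ n := by
    simpa using card_le_univ (node (n + 1) Q (fun e : Fin n => rk e) A)
  refine .seqs_cons (R := fun s₄ => s₄.reg 9 = A ∧ s₄.reg 11 = s₃.reg 11 ∧
    s₄.reg 12 = #(node (n + 1) Q (fun e : Fin n => rk e) A) + k ∧ s₄.reg 13 = 0 ∧
    s₄.arr = s₃.arr) (.ops ?_ ?_) ?_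
  · simp [OpsOk, Op.Ok, Op.apply, h12₃, hE₃.r1]
    omega
  · simp [runOps, Op.apply, h9₃, h12₃, hE₃.r1]
  rintro s₄ ⟨h9₄, h11₄, h12₄, h13₄, harr₄⟩ hF₄ -
  have hE₄ := hE₃.frame hF₄ (by decide)
  -- The product of the factors is the generating function at `X`, that is, the number whose digits
  -- are the coefficients.
  have hdig : ∏ e ∈ range n, factor n Q X num den rk A e =
      digitSum (fun e : Fin n => num e) (fun e : Fin n => den e)
        (node (n + 1) Q (fun e : Fin n => rk e) A) X 0 := by
    have h := prod_eq_sum_coef (a := fun e : Fin n => num e) (d := fun e : Fin n => den e)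
      (fun i => hZ.num_le i i.2) (node (n + 1) Q (fun e : Fin n => rk e) A) X
    unfold digitSum
    simp only [add_zero]
    rw [← h, prod_range]
    simp only [factor, mem_node]
  refine .seqs_cons (runs_sum hZ hE₄ (by rw [h11₄, h11₃, hdig]) h12₄ h13₄) ?_
  rintro s₅ h13₅ hF₅ -
  have hE₅ := hE₄.frame hF₅ (by decide)
  have h9₅ : s₅.reg 9 = A := (hF₅.reg 9 rfl).trans h9₄
  have h4 : s₅.arr 4 = s₃.arr 4 := by rw [hF₅.arr 4 rfl, harr₄]
  have h5 : s₅.arr 5 = s₁.arr 5 := by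
    rw [hF₅.arr 5 rfl, harr₄, hF₃.arr 5 rfl, harr₂]
  have h6 : s₅.arr 6 = s₁.arr 6 := by
    rw [hF₅.arr 6 rfl, harr₄, hF₃.arr 6 rfl, harr₂]
  have h7 : s₅.arr 7 = s₁.arr 7 := by
    rw [hF₅.arr 7 rfl, harr₄, hF₃.arr 7 rfl, harr₂]
  change s₅.reg 13 = nodeUndet n k Q num den rk A at h13₅
  refine .seqs_cons (R := fun s' => ∀ A' < A + 1,
      (∀ e < n, s'.arr 4 (A' * n + e) = if InNode (n + 1) Q A' (rk e) then 1 else 0) ∧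
      s'.arr 5 A' = nodeUndet n k Q num den rk A' ∧
      s'.arr 6 A' = n * nodeUndet n k Q num den rk A' ∧ s'.arr 7 A' = n * (n + 1)) (.ops ?_ ?_)
    (fun s₆ h _ _ => .seqs_nil (by simpa using h))
  · simp [OpsOk, Op.Ok, Op.apply, h13₅, hE₅.r0, hE₅.r4]
    have h1 := Nat.mul_le_mul_left n (hZ.nodeUndet_le A)
    have h2 := hZ.cost_le
    have h3 := hZ.full_lt
    have h4 := hZ.row_le (r := 0) (A := N) (by omega) le_rfl
    exact ⟨by nlinarith, by omega⟩
  · intro A' hA'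
    rcases Nat.lt_succ_iff_lt_or_eq.1 hA' with h | rfl
    · have hne : A' ≠ A := by omega
      have hI' := hI A' h
      simp [runOps, Op.apply, h9₅, h4, h5, h6, h7, hne, hI']
      intro e he
      rw [h4₃' _ (by nlinarith), hI'.1 e he]
    · simp [runOps, Op.apply, h9₅, h4, h13₅, hE₅.r0, hE₅.r4]
      exact h4₃

end

end KOfN

/-! ### Running the dynamic program on the machine -/

namespace KOfN

open Finset

/-- Arrays `4` and `5` hold the elements and the scaled probabilities of all nodes. -/
structure Tables (n k Q N : ℕ) (num den rk : ℕ → ℕ) (s : Mem) : Prop where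
  a4 : ∀ A < N, ∀ e < n, s.arr 4 (A * n + e) = if InNode (n + 1) Q A (rk e) then 1 else 0
  a5 : ∀ A < N, s.arr 5 A = nodeUndet n k Q num den rk A

theorem Tables.frame {n k Q N : ℕ} {num den rk : ℕ → ℕ} {s s' : Mem} {P : Prog}
    (h : Tables n k Q N num den rk s) (hF : Frame P s s') (h4 : P.setsArr 4 = false)
    (h5 : P.setsArr 5 = false) : Tables n k Q N num den rk s' :=
  ⟨by rw [hF.arr 4 h4]; exact h.a4, by rw [hF.arr 5 h5]; exact h.a5⟩

/-- The length of the step from the node `A` to the node `B`. -/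
def stepCost (n k Q : ℕ) (num den rk : ℕ → ℕ) (A B : ℕ) : ℕ :=
  #(node (n + 1) Q (fun e : Fin n => rk e) B \ node (n + 1) Q (fun e : Fin n => rk e) A) *
    nodeUndet n k Q num den rk A

section

variable {n k Q N X V M : ℕ} {num den rk : ℕ → ℕ} {s : Mem}

theorem Sizes.stepCost_le (hZ : Sizes n k Q N X V M num den rk) (A B : ℕ) :
    stepCost n k Q num den rk A B ≤ n * ∏ e ∈ range n, den e := by
  refine Nat.mul_le_mul ?_ (hZ.nodeUndet_le A)
  simpa using card_le_univ
    (node (n + 1) Q (fun e : Fin n => rk e) B \ node (n + 1) Q (fun e : Fin n => rk e) A)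

theorem stepCost_self (A : ℕ) : stepCost n k Q num den rk A A = 0 := by
  simp [stepCost]

/-- Register `22` becomes the number of elements of the second node that are not in the first
one; registers `19` and `23` hold the offsets of the two nodes in array `4`. -/
def progCount : Prog := .forUp 24 25 0
  (.ops [.add 26 23 24, .load 26 4 26, .add 27 19 24, .load 27 4 27, .sub 26 26 27,
    .add 22 22 26])

theorem runs_count (hZ : Sizes n k Q N X V M num den rk) (hE : Env n k Q N X num den rk s)
    (hT : Tables n k Q N num den rk s) {A B : ℕ} (hA : A < N) (hB : B < N)
    (h19 : s.reg 19 = A * n) (h23 : s.reg 23 = B * n) (h22 : s.reg 22 = 0) :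
    Runs V M progCount s (fun s' => s'.reg 22 =
      #(node (n + 1) Q (fun e : Fin n => rk e) B \ node (n + 1) Q (fun e : Fin n => rk e) A)) := by
  have hsmall := hZ.small_le
  have hnN := hZ.n_le
  have hcard : #(node (n + 1) Q (fun e : Fin n => rk e) B \
      node (n + 1) Q (fun e : Fin n => rk e) A) =
      #{e ∈ range n | InNode (n + 1) Q B (rk e) ∧ ¬ InNode (n + 1) Q A (rk e)} := by
    have h : node (n + 1) Q (fun e : Fin n => rk e) B \ node (n + 1) Q (fun e : Fin n => rk e) A =
        ({e : Fin n | InNode (n + 1) Q B (rk e) ∧ ¬ InNode (n + 1) Q A (rk e)} :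
          Finset (Fin n)) := by
      ext e; simp
    rw [h, card_filter, card_filter, sum_range]
  rw [hcard]
  refine .forUp hE.r0 hE.r3 (by have := hZ.lt_M; omega) (by decide) (by decide)
    (by decide) rfl rfl rfl (fun j s' => s'.reg 22 =
      #{e ∈ range j | InNode (n + 1) Q B (rk e) ∧ ¬ InNode (n + 1) Q A (rk e)})
    (by simp [h22]) ?_ (fun s' h _ => h)
  intro e s₁ he hI hF hi _
  have hT₁ := hT.frame hF rfl rfl
  have h19₁ : s₁.reg 19 = A * n := (hF.reg 19 rfl).trans h19
  have h23₁ : s₁.reg 23 = B * n := (hF.reg 23 rfl).trans h23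
  have hle : #{e ∈ range e | InNode (n + 1) Q B (rk e) ∧ ¬ InNode (n + 1) Q A (rk e)} ≤ e := by
    simpa using card_filter_le (range e)
      (fun e => InNode (n + 1) Q B (rk e) ∧ ¬ InNode (n + 1) Q A (rk e))
  -- Truncated subtraction of membership bits is the membership bit of the set difference.
  have hval : ((if InNode (n + 1) Q B (rk e) then 1 else 0) -
      if InNode (n + 1) Q A (rk e) then 1 else 0) =
      if InNode (n + 1) Q B (rk e) ∧ ¬ InNode (n + 1) Q A (rk e) then 1 else 0 := by
    by_cases h1 : InNode (n + 1) Q B (rk e) <;> by_cases h2 : InNode (n + 1) Q A (rk e) <;>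
      simp [h1, h2]
  refine .ops ?_ ?_
  · simp [OpsOk, Op.Ok, Op.apply, h19₁, h23₁, hi, hT₁.a4 A hA e he, hT₁.a4 B hB e he, hI]
    refine ⟨hZ.cell_le (by omega) (by omega), hZ.cell_le (by omega) (by omega), ?_⟩
    rw [hval]
    split_ifs <;> omega
  · simp [runOps, Op.apply, h19₁, h23₁, hi, hT₁.a4 A hA e he, hT₁.a4 B hB e he, hI]
    rw [hval, range_add_one, filter_insert]
    split_ifs
    · rw [card_insert_of_notMem (by simp)]
    · rfl

/-- Registers `16` and `17` become the length of a best continuation and its first node. -/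
def progBest : Prog := .forUp 20 21 6 (.seqs [
  .ops [.const 22 0, .mul 23 20 0],
  progCount,
  .ops [.mul 22 22 18, .add 26 11 20, .load 26 6 26, .add 22 22 26, .sub 23 16 22],
  .ite 23 (.ops [.copy 16 22, .copy 17 20]) .skip])

theorem runs_best (hZ : Sizes n k Q N X V M num den rk) (hE : Env n k Q N X num den rk s)
    (hT : Tables n k Q N num den rk s) {A r : ℕ} {D : ℕ → ℕ} (hA : A < N) (hr : r < N)
    (h11 : s.reg 11 = r * N) (h16 : s.reg 16 = D A) (h17 : s.reg 17 = A)
    (h18 : s.reg 18 = nodeUndet n k Q num den rk A) (h19 : s.reg 19 = A * n)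
    (ha6 : ∀ B < N, s.arr 6 (r * N + B) = D B)
    (hD : ∀ B < N, D B ≤ n * ∏ e ∈ range n, den e) :
    Runs V M progBest s (fun s' =>
      s'.reg 16 = (bestStep (stepCost n k Q num den rk A) D A N).1 ∧
      s'.reg 17 = (bestStep (stepCost n k Q num den rk A) D A N).2) := by
  have hsmall := hZ.small_le
  have hnN := hZ.n_le
  refine .forUp hE.r6 hE.r3 hZ.lt_M.le (by decide) (by decide)
    (by decide) rfl rfl rfl (fun j s' =>
      s'.reg 16 = (bestStep (stepCost n k Q num den rk A) D A j).1 ∧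
      s'.reg 17 = (bestStep (stepCost n k Q num den rk A) D A j).2)
    (by simp [h16, h17, bestStep]) ?_ (fun s' h _ => h)
  rintro B s₁ hB ⟨hI1, hI2⟩ hF hi _
  have hE₁ := hE.frame hF (by decide)
  have hT₁ := hT.frame hF rfl rfl
  refine .seqs_cons (R := fun s₂ => s₂.reg 22 = 0 ∧ s₂.reg 23 = B * n) (.ops ?_ ?_) ?_
  · simp [OpsOk, Op.Ok, Op.apply, hi, hE₁.r0]
    exact hZ.cell_le (e := 0) (by omega) (by omega)
  · simp [runOps, Op.apply, hi, hE₁.r0]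
  rintro s₂ ⟨h22₂, h23₂⟩ hF₂ -
  have hE₂ := hE₁.frame hF₂ (by decide)
  have hT₂ := hT₁.frame hF₂ rfl rfl
  have h19₂ : s₂.reg 19 = A * n := ((hF₂.reg 19 rfl).trans (hF.reg 19 rfl)).trans h19
  refine .seqs_cons (runs_count hZ hE₂ hT₂ hA hB h19₂ h23₂ h22₂) ?_
  intro s₃ h22₃ hF₃ _
  have h11₃ : s₃.reg 11 = r * N := by
    rw [hF₃.reg 11 rfl, hF₂.reg 11 rfl, hF.reg 11 rfl, h11]
  have h18₃ : s₃.reg 18 = nodeUndet n k Q num den rk A := by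
    rw [hF₃.reg 18 rfl, hF₂.reg 18 rfl, hF.reg 18 rfl, h18]
  have h16₃ := (hF₃.reg 16 rfl).trans ((hF₂.reg 16 rfl).trans hI1)
  have h17₃ := (hF₃.reg 17 rfl).trans ((hF₂.reg 17 rfl).trans hI2)
  have h20₃ : s₃.reg 20 = B := (hF₃.reg 20 rfl).trans ((hF₂.reg 20 rfl).trans hi)
  have ha6₃ : s₃.arr 6 = s.arr 6 := by
    rw [hF₃.arr 6 rfl, hF₂.arr 6 rfl, hF.arr 6 rfl]
  have hcost := hZ.stepCost_le A B
  have hmul : s₃.reg 22 * nodeUndet n k Q num den rk A = stepCost n k Q num den rk A B := by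
    rw [h22₃]
    rfl
  have hDB := hD B hB
  have hV := hZ.cost_le
  -- Step and continuation are each at most `n` times the product of the denominators, whence the 2
  -- in `Sizes.cost_le`.
  have hV' : 2 * n * ∏ e ∈ range n, den e =
    n * (∏ e ∈ range n, den e) + n * ∏ e ∈ range n, den e := by ring
  refine .seqs_cons (R := fun s₄ => s₄.reg 22 = stepCost n k Q num den rk A B + D B ∧
    s₄.reg 16 = s₃.reg 16 ∧ s₄.reg 17 = s₃.reg 17 ∧ s₄.reg 20 = B ∧
    (s₄.reg 23 = 0 ↔ s₃.reg 16 ≤ stepCost n k Q num den rk A B + D B)) (.ops ?_ ?_) ?_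
  · simp [OpsOk, Op.Ok, Op.apply, h18₃, h11₃, h20₃, ha6₃, ha6 B hB, hmul]
    exact ⟨by omega, hZ.row_le (by omega) (by omega), by omega⟩
  · simp [runOps, Op.apply, h18₃, h11₃, h20₃, ha6₃, ha6 B hB, hmul]
    omega
  rintro s₄ ⟨h22₄, h16₄, h17₄, h20₄, h23₄⟩ - -
  refine .seqs_cons (R := fun s₅ =>
      s₅.reg 16 = (bestStep (stepCost n k Q num den rk A) D A (B + 1)).1 ∧
      s₅.reg 17 = (bestStep (stepCost n k Q num den rk A) D A (B + 1)).2) ?_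
    (fun s₅ h _ _ => .seqs_nil (by simpa using h))
  rw [h16₃] at h23₄ h16₄
  rw [h17₃] at h17₄
  unfold bestStep
  refine .ite (fun h => ?_) (fun h => ?_)
  · rw [if_pos (by omega)]
    refine .ops ?_ ?_
    · simp [OpsOk, Op.Ok]
    · simp [runOps, Op.apply, h22₄, h20₄]
  · rw [if_neg (by omega)]
    exact .skip ⟨h16₄, h17₄⟩

/-- Computes a row of the dynamic program from the previous one; registers `11` and `12` hold
the offsets of the two rows in the arrays `6` and `7`. -/
def progRow : Prog := .forUp 13 14 6 (.seqs [
  .ops [.add 15 11 13, .load 16 6 15, .copy 17 13, .load 18 5 13, .mul 19 13 0],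
  progBest,
  .ops [.add 15 12 13, .store 6 15 16, .store 7 15 17]])

theorem runs_row (hZ : Sizes n k Q N X V M num den rk) (hE : Env n k Q N X num den rk s)
    (hT : Tables n k Q N num den rk s) {r : ℕ} {D : ℕ → ℕ} (hr : r < N)
    (h11 : s.reg 11 = r * N) (h12 : s.reg 12 = (r + 1) * N)
    (ha6 : ∀ B < N, s.arr 6 (r * N + B) = D B)
    (hD : ∀ B < N, D B ≤ n * ∏ e ∈ range n, den e) :
    Runs V M progRow s (fun s' =>
      (∀ A < N, s'.arr 6 ((r + 1) * N + A) = (bestStep (stepCost n k Q num den rk A) D A N).1 ∧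
        s'.arr 7 ((r + 1) * N + A) = (bestStep (stepCost n k Q num den rk A) D A N).2) ∧
      ∀ i < (r + 1) * N, s'.arr 6 i = s.arr 6 i ∧ s'.arr 7 i = s.arr 7 i) := by
  have hsmall := hZ.small_le
  have hnN := hZ.n_le
  refine .forUp hE.r6 hE.r3 hZ.lt_M.le (by decide) (by decide)
    (by decide) rfl rfl rfl (fun j s' =>
      (∀ A < j, s'.arr 6 ((r + 1) * N + A) = (bestStep (stepCost n k Q num den rk A) D A N).1 ∧
        s'.arr 7 ((r + 1) * N + A) = (bestStep (stepCost n k Q num den rk A) D A N).2) ∧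
      ∀ i < (r + 1) * N, s'.arr 6 i = s.arr 6 i ∧ s'.arr 7 i = s.arr 7 i)
    (by simp) ?_ (fun s' h _ => h)
  rintro A s₁ hA ⟨hI1, hI2⟩ hF hi _
  have hE₁ := hE.frame hF (by decide)
  have hT₁ := hT.frame hF rfl rfl
  have h11₁ : s₁.reg 11 = r * N := (hF.reg 11 rfl).trans h11
  -- Writing happens only from offset (r+1)*N on, so the previous row is still intact.
  have ha6₁ : ∀ B < N, s₁.arr 6 (r * N + B) = D B := by
    intro B hB
    rw [(hI2 _ (by nlinarith)).1, ha6 B hB]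
  refine .seqs_cons (R := fun s₂ => s₂.reg 16 = D A ∧ s₂.reg 17 = A ∧
    s₂.reg 18 = nodeUndet n k Q num den rk A ∧ s₂.reg 19 = A * n) (.ops ?_ ?_) ?_
  · simp [OpsOk, Op.Ok, Op.apply, h11₁, hi, hE₁.r0]
    exact ⟨hZ.row_le (by omega) (by omega), hZ.cell_le (e := 0) (by omega) (by omega)⟩
  · simp [runOps, Op.apply, h11₁, hi, hE₁.r0, ha6₁ A hA, hT₁.a5 A hA]
  rintro s₂ ⟨h16₂, h17₂, h18₂, h19₂⟩ hF₂ -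
  have hE₂ := hE₁.frame hF₂ (by decide)
  have hT₂ := hT₁.frame hF₂ rfl rfl
  have h11₂ : s₂.reg 11 = r * N := (hF₂.reg 11 rfl).trans h11₁
  refine .seqs_cons (runs_best hZ hE₂ hT₂ hA hr h11₂ h16₂ h17₂ h18₂ h19₂
    (by rw [hF₂.arr 6 rfl]; exact ha6₁) hD) ?_
  rintro s₃ ⟨h16₃, h17₃⟩ hF₃ -
  have h12₃ : s₃.reg 12 = (r + 1) * N := by
    rw [hF₃.reg 12 rfl, hF₂.reg 12 rfl, hF.reg 12 rfl, h12]
  have h13₃ : s₃.reg 13 = A := (hF₃.reg 13 rfl).trans ((hF₂.reg 13 rfl).trans hi)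
  have h6₃ : s₃.arr 6 = s₁.arr 6 := (hF₃.arr 6 rfl).trans (hF₂.arr 6 rfl)
  have h7₃ : s₃.arr 7 = s₁.arr 7 := (hF₃.arr 7 rfl).trans (hF₂.arr 7 rfl)
  refine .seqs_cons (R := fun s₄ =>
      (∀ A' < A + 1, s₄.arr 6 ((r + 1) * N + A') =
          (bestStep (stepCost n k Q num den rk A') D A' N).1 ∧
        s₄.arr 7 ((r + 1) * N + A') = (bestStep (stepCost n k Q num den rk A') D A' N).2) ∧
      ∀ i < (r + 1) * N, s₄.arr 6 i = s.arr 6 i ∧ s₄.arr 7 i = s.arr 7 i) (.ops ?_ ⟨?_, ?_⟩)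
    (fun s₄ h _ _ => .seqs_nil (by simpa using h))
  · simp [OpsOk, Op.Ok, h12₃, h13₃]
    exact hZ.row_le (by omega) (by omega)
  · intro A' hA'
    rcases Nat.lt_succ_iff_lt_or_eq.1 hA' with h | rfl
    · have hne : A' ≠ A := by omega
      simpa [runOps, Op.apply, h12₃, h13₃, h6₃, h7₃, hne] using hI1 A' h
    · simp [runOps, Op.apply, h12₃, h13₃, h16₃, h17₃]
  · intro i hi'
    have hne : i ≠ (r + 1) * N + A := by omega
    simpa [runOps, Op.apply, h12₃, h13₃, h6₃, h7₃, hne] using hI2 i hi'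

/-- Computes all rows of the dynamic program. -/
def progDP : Prog := .forUp 9 10 6 (.seqs [
  .ops [.mul 11 9 6, .add 12 11 6],
  progRow])

/-- The length of a shortest path in `r` steps and a final step to the set of all variables. -/
def pathCost (n k Q N : ℕ) (num den rk : ℕ → ℕ) : ℕ → ℕ → ℕ :=
  dist (stepCost n k Q num den rk) (fun A => n * nodeUndet n k Q num den rk A) N

/-- The second node on such a path. -/
def pathNext (n k Q N : ℕ) (num den rk : ℕ → ℕ) : ℕ → ℕ → ℕ :=
  next (stepCost n k Q num den rk) (fun A => n * nodeUndet n k Q num den rk A) N (n * (n + 1))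

/-- Later rows never exceed row `0`, so the entries stay bounded however many rounds are made. -/
theorem Sizes.pathCost_le (hZ : Sizes n k Q N X V M num den rk) (r A : ℕ) :
    pathCost n k Q N num den rk r A ≤ n * ∏ e ∈ range n, den e :=
  (dist_anti (Nat.zero_le r) A).trans (Nat.mul_le_mul_left _ (hZ.nodeUndet_le A))

theorem runs_DP (hZ : Sizes n k Q N X V M num den rk) (hE : Env n k Q N X num den rk s)
    (hT : Tables n k Q N num den rk s)
    (h0 : ∀ A < N, s.arr 6 A = n * nodeUndet n k Q num den rk A ∧ s.arr 7 A = n * (n + 1)) :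
    Runs V M progDP s (fun s' => ∀ r ≤ N, ∀ A < N,
      s'.arr 7 (r * N + A) = pathNext n k Q N num den rk r A) := by
  refine .forUp hE.r6 hE.r3 hZ.lt_M.le (by decide) (by decide)
    (by decide) rfl rfl rfl (fun j s' => ∀ r ≤ j, ∀ A < N,
      s'.arr 6 (r * N + A) = pathCost n k Q N num den rk r A ∧
      s'.arr 7 (r * N + A) = pathNext n k Q N num den rk r A) ?_ ?_
    (fun s' h _ r hr A hA => (h r hr A hA).2)
  · intro r hr A hA
    rw [Nat.le_zero.1 hr]
    simpa [pathCost, pathNext, dist, next] using h0 A hA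
  intro r s₁ hr hI hF hi _
  have hE₁ := hE.frame hF (by decide)
  have hT₁ := hT.frame hF rfl rfl
  refine .seqs_cons (R := fun s₂ => s₂.reg 11 = r * N ∧ s₂.reg 12 = (r + 1) * N ∧
    s₂.arr = s₁.arr) (.ops ?_ ?_) ?_
  · simp [OpsOk, Op.Ok, Op.apply, hi, hE₁.r6]
    exact ⟨hZ.row_le (A := 0) (by omega) (by omega), hZ.row_le (by omega) (by omega)⟩
  · simp [runOps, Op.apply, hi, hE₁.r6]
    ring
  rintro s₂ ⟨h11₂, h12₂, harr₂⟩ hF₂ -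
  have hE₂ := hE₁.frame hF₂ (by decide)
  have hT₂ := hT₁.frame hF₂ rfl rfl
  refine .seqs_cons (runs_row hZ hE₂ hT₂ hr h11₂ h12₂
    (fun B hB => by rw [harr₂]; exact (hI r le_rfl B hB).1)
    (fun B _ => hZ.pathCost_le r B)) ?_
  rintro s₃ ⟨h1, h2⟩ - -
  refine .seqs_nil ?_
  intro r' hr' A hA
  simp only [Mem.arr_setReg]
  rcases Nat.le_succ_iff.1 hr' with h | rfl
  · have hlt : r' * N + A < (r + 1) * N := by
      have : r' * N ≤ r * N := Nat.mul_le_mul_right _ h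
      nlinarith
    rw [(h2 _ hlt).1, (h2 _ hlt).2, harr₂]
    exact hI r' h A hA
  · exact h1 A hA

/-! #### The output -/

/-- The list `L` has been written to array `2`, and array `8` marks its elements. -/
structure Listed (L : List (Fin n)) (s : Mem) : Prop where
  nodup : L.Nodup
  length : s.reg 10 = L.length
  out : ∀ i (h : i < L.length), s.arr 2 i = L[i]
  mark : ∀ e : Fin n, s.arr 8 e = if e ∈ L then 1 else 0

/-- Appends the new elements of a node to the output; register `14` holds the offset of the node
in array `4`. -/
def progEmitNode : Prog := .forUp 15 16 0 (.seqs [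
  .ops [.add 17 14 15, .load 17 4 17, .load 18 8 15, .sub 17 17 18],
  .ite 17 (.ops [.store 2 10 15, .add 10 10 3, .store 8 15 3]) .skip])

theorem Listed.length_le {L : List (Fin n)} (h : Listed L s) : L.length ≤ n := by
  simpa using h.nodup.length_le_card

/-- Elements of the node that are already listed are skipped. Every other one lies outside the
previous node `S`, and its prefix contains `S`, so it costs at most `q S`. Nodes along the path need
not be nested. -/
theorem runs_emitNode (hZ : Sizes n k Q N X V M num den rk) (hE : Env n k Q N X num den rk s)
    (hT : Tables n k Q N num den rk s) {q : Finset (Fin n) → ℕ}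
    (hq : ∀ S S', S ⊆ S' → q S' ≤ q S) {B : ℕ} (hB : B < N) {S : Finset (Fin n)}
    {L : List (Fin n)} (hS : S ⊆ L.toFinset) (h14 : s.reg 14 = B * n) (hL : Listed L s) :
    Runs V M progEmitNode s (fun s' => ∃ L', Listed L' s' ∧
      node (n + 1) Q (fun e : Fin n => rk e) B ⊆ L'.toFinset ∧
      listCost q L' ≤
        listCost q L + #(node (n + 1) Q (fun e : Fin n => rk e) B \ S) * q S) := by
  have hsmall := hZ.small_le
  have hnN := hZ.n_le
  set T := node (n + 1) Q (fun e : Fin n => rk e) B with hTdef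
  refine .forUp hE.r0 hE.r3 (by have := hZ.lt_M; omega) (by decide) (by decide)
    (by decide) rfl rfl rfl (fun j s' => ∃ L', Listed L' s' ∧ (∀ e ∈ L, e ∈ L') ∧
      (∀ e : Fin n, (e : ℕ) < j → e ∈ T → e ∈ L') ∧
      listCost q L' ≤ listCost q L + #((T \ S).filter fun e : Fin n => (e : ℕ) < j) * q S)
    ⟨L, ⟨hL.nodup, by simpa using hL.length, by simpa using hL.out, by simpa using hL.mark⟩,
      fun e he => he, by simp, by simp⟩ ?_ ?_
  · rintro j s₁ hj ⟨L₁, hL₁, hsub, hall, hcost⟩ hF hi _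
    have hE₁ := hE.frame hF (by decide)
    have hT₁ := hT.frame hF rfl rfl
    have h14₁ : s₁.reg 14 = B * n := (hF.reg 14 rfl).trans h14
    have hmark := hL₁.mark ⟨j, hj⟩
    dsimp only at hmark
    have hmem : (⟨j, hj⟩ : Fin n) ∈ T ↔ InNode (n + 1) Q B (rk j) := by simp [hTdef]
    refine .seqs_cons (R := fun s₂ => s₂.reg 3 = 1 ∧ s₂.reg 15 = j ∧ s₂.reg 10 = s₁.reg 10 ∧
      s₂.arr = s₁.arr ∧ (s₂.reg 17 ≠ 0 ↔ (⟨j, hj⟩ : Fin n) ∈ T ∧ (⟨j, hj⟩ : Fin n) ∉ L₁))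
      (.ops ?_ ?_) ?_
    · simp [OpsOk, Op.Ok, h14₁, hi]
      exact hZ.cell_le (by omega) (by omega)
    · simp [runOps, Op.apply, h14₁, hi, hE₁.r3, hT₁.a4 B hB j hj, hmark, hmem]
      by_cases h1 : InNode (n + 1) Q B (rk j) <;> by_cases h2 : (⟨j, hj⟩ : Fin n) ∈ L₁ <;>
        simp [h1, h2]
    rintro s₂ ⟨h3₂, h15₂, h10₂, harr₂, h17₂⟩ - -
    have hmono : #((T \ S).filter fun e : Fin n => (e : ℕ) < j) ≤
        #((T \ S).filter fun e : Fin n => (e : ℕ) < j + 1) :=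
      card_le_card (monotone_filter_right _ fun e _ h => by omega)
    refine .seqs_cons (R := fun s₃ => ∃ L', Listed L' s₃ ∧ (∀ e ∈ L, e ∈ L') ∧
      (∀ e : Fin n, (e : ℕ) < j + 1 → e ∈ T → e ∈ L') ∧
      listCost q L' ≤ listCost q L + #((T \ S).filter fun e : Fin n => (e : ℕ) < j + 1) * q S)
      ?_ ?_
    · refine .ite (fun h => ?_) (fun h => ?_)
      · obtain ⟨hjT, hjL⟩ := h17₂.1 h
        have hnd : (L₁ ++ [(⟨j, hj⟩ : Fin n)]).Nodup := by
          rw [List.nodup_append]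
          refine ⟨hL₁.nodup, by simp, ?_⟩
          intro a ha b hb hab
          rw [List.mem_singleton] at hb
          subst hab hb
          exact hjL ha
        have hlen := hL₁.length_le
        refine .ops ?_ ⟨L₁ ++ [⟨j, hj⟩], ⟨hnd, ?_, ?_, ?_⟩, ?_, ?_, ?_⟩
        · simp [OpsOk, Op.Ok, Op.apply, h10₂, h3₂, hL₁.length]
          omega
        · simp [runOps, Op.apply, h10₂, h3₂, hL₁.length]
        · intro i hi'
          simp [runOps, Op.apply, h10₂, h15₂, harr₂, hL₁.length, Function.update_apply,
            List.getElem_append]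
          by_cases hil : i < L₁.length
          · rw [if_neg (by omega), dif_pos hil]
            exact hL₁.out i hil
          · rw [if_pos (by simp at hi'; omega), dif_neg hil]
        · intro e
          simp [runOps, Op.apply, h15₂, h3₂, harr₂, Function.update_apply, hL₁.mark]
          by_cases hej : e = ⟨j, hj⟩
          · subst hej; simp
          · have : (e : ℕ) ≠ j := fun h => hej (Fin.ext h)
            simp [hej, this]
        · intro e he
          simp [hsub e he]
        · intro e he heT
          rcases Nat.lt_succ_iff_lt_or_eq.1 he with h' | h'
          · simp [hall e h' heT]
          · simp [show e = ⟨j, hj⟩ from Fin.ext h']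
        · rw [listCost_append_singleton]
          have hSL : S ⊆ L₁.toFinset := by
            intro e he
            have := hS he
            rw [List.mem_toFinset] at this ⊢
            exact hsub e this
          -- The new element is charged the weight of everything listed so far, which is at most
          -- that of `S`.
          have hqS := hq _ _ hSL
          have hcard : #((T \ S).filter fun e : Fin n => (e : ℕ) < j + 1) =
              #((T \ S).filter fun e : Fin n => (e : ℕ) < j) + 1 := by
            have hins : ((T \ S).filter fun e : Fin n => (e : ℕ) < j + 1) =
                insert ⟨j, hj⟩ ((T \ S).filter fun e : Fin n => (e : ℕ) < j) := by
              ext e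
              simp only [mem_filter, mem_insert, mem_sdiff, Fin.ext_iff]
              constructor
              · rintro ⟨h1, h2⟩
                rcases Nat.lt_succ_iff_lt_or_eq.1 h2 with h' | h'
                · exact Or.inr ⟨h1, h'⟩
                · exact Or.inl h'
              · rintro (h' | ⟨h1, h2⟩)
                · have : e = ⟨j, hj⟩ := Fin.ext h'
                  subst this
                  exact ⟨⟨hjT, fun hjS => hjL (by simpa using hSL hjS)⟩, by simp⟩
                · exact ⟨h1, by omega⟩
            rw [hins, card_insert_of_notMem (by simp)]
          rw [hcard, add_mul, one_mul]
          omega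
      · refine .skip ⟨L₁, ⟨hL₁.nodup, by rw [h10₂, hL₁.length], by rw [harr₂]; exact hL₁.out,
          by rw [harr₂]; exact hL₁.mark⟩, hsub, ?_, hcost.trans ?_⟩
        · intro e he heT
          rcases Nat.lt_succ_iff_lt_or_eq.1 he with h' | h'
          · exact hall e h' heT
          · have hej : e = ⟨j, hj⟩ := Fin.ext h'
            subst hej
            by_contra hnot
            exact h17₂.2 ⟨heT, hnot⟩ h
        · exact Nat.add_le_add_left (Nat.mul_le_mul_right _ hmono) _
    · rintro s₃ ⟨L', hL', h1, h2, h3⟩ - -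
      exact .seqs_nil ⟨L', ⟨hL'.nodup, by simpa using hL'.length, by simpa using hL'.out,
        by simpa using hL'.mark⟩, h1, h2, h3⟩
  · rintro s' ⟨L', hL', _, h2, h3⟩ -
    refine ⟨L', hL', fun e he => by simpa using h2 e e.2 he, h3.trans ?_⟩
    exact Nat.add_le_add_left (Nat.mul_le_mul_right _ (card_filter_le _ _)) _

/-- Follows a shortest path from the node `0` and appends the new elements of its nodes to the
output. -/
def progEmit : Prog := .seqs [
  .ops [.const 9 0, .const 10 0, .add 11 6 3],
  .forUp 12 13 11 (.seqs [
    .ops [.sub 14 6 12, .mul 14 14 6, .add 14 14 9, .load 9 7 14, .mul 14 9 0],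
    progEmitNode])]

theorem pathNext_lt (hfull : n * (n + 1) < N) {r A : ℕ} (hA : A < N) :
    pathNext n k Q N num den rk r A < N := by
  cases r with
  | zero => exact hfull
  | succ r => exact bestStep_snd_lt hA le_rfl

/-- The cost of the list plus the length of the remaining path never increases. There are N+1
rounds: `N` steps of the path, read from the rows in descending order, and one step to the set of
all variables, which completes the list. -/
theorem runs_emit (hZ : Sizes n k Q N X V M num den rk) (hE : Env n k Q N X num den rk s)
    (hT : Tables n k Q N num den rk s) (hQ : 0 < Q)
    (hq : ∀ S S', S ⊆ S' → scaledUndet (fun e : Fin n => num e) (fun e : Fin n => den e) k S' ≤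
      scaledUndet (fun e : Fin n => num e) (fun e : Fin n => den e) k S)
    (h7 : ∀ r ≤ N, ∀ A < N, s.arr 7 (r * N + A) = pathNext n k Q N num den rk r A)
    (h8 : ∀ e < n, s.arr 8 e = 0) :
    Runs V M progEmit s (fun s' => ∃ L : List (Fin n), Listed L s' ∧ (∀ e, e ∈ L) ∧
      listCost (scaledUndet (fun e : Fin n => num e) (fun e : Fin n => den e) k) L ≤
        pathCost n k Q N num den rk N 0) := by
  have hsmall := hZ.small_le
  have hnN := hZ.n_le
  have hfull := hZ.full_lt
  set q := scaledUndet (fun e : Fin n => num e) (fun e : Fin n => den e) k with hqdef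
  refine .seqs_cons (R := fun s₁ => s₁.reg 9 = 0 ∧ s₁.reg 10 = 0 ∧ s₁.reg 11 = N + 1 ∧
    s₁.arr = s.arr) (.ops ?_ ?_) ?_
  · simp [OpsOk, Op.Ok, Op.apply, hE.r6, hE.r3]
    have := hZ.row_le (r := 1) (A := 1) (by omega) (by omega)
    omega
  · simp [runOps, Op.apply, hE.r6, hE.r3]
  rintro s₁ ⟨h9₁, h10₁, h11₁, harr₁⟩ hF₁ -
  have hE₁ := hE.frame hF₁ (by decide)
  have hT₁ := hT.frame hF₁ rfl rfl
  refine .seqs_cons (.forUp h11₁ hE₁.r3 hZ.lt_M (by decide) (by decide)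
    (by decide) rfl rfl rfl (fun j s' => ∃ (A : ℕ) (L : List (Fin n)), A < N ∧ s'.reg 9 = A ∧
      Listed L s' ∧ node (n + 1) Q (fun e : Fin n => rk e) A ⊆ L.toFinset ∧
      listCost q L + (if j ≤ N then pathCost n k Q N num den rk (N - j) A else 0) ≤
        pathCost n k Q N num den rk N 0 ∧ (j = N + 1 → A = n * (n + 1)))
    ⟨0, [], by omega, by simpa using h9₁, ⟨by simp, by simpa using h10₁, by simp, ?_⟩, ?_, ?_, ?_⟩
    ?_ (fun s' h _ => h)) ?_
  · intro e
    simp [harr₁, h8 e e.2]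
  · simp [node_zero]
  · simp [listCost]
  · omega
  · rintro j s₂ hj ⟨A, L, hA, h9₂, hL, hAL, hcost, -⟩ hF₂ hi -
    have hE₂ := hE₁.frame hF₂ (by decide)
    have hT₂ := hT₁.frame hF₂ rfl rfl
    set A' := pathNext n k Q N num den rk (N - j) A with hA'
    have hA'lt : A' < N := pathNext_lt hfull hA
    have h7₂ : s₂.arr 7 ((N - j) * N + A) = A' := by
      rw [hF₂.arr 7 rfl, harr₁, h7 _ (by omega) A hA]
    refine .seqs_cons (R := fun s₃ => s₃.reg 9 = A' ∧ s₃.reg 14 = A' * n ∧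
      s₃.reg 10 = s₂.reg 10 ∧ s₃.arr = s₂.arr) (.ops ?_ ?_) ?_
    · simp [OpsOk, Op.Ok, Op.apply, hE₂.r6, hE₂.r0, hi, h9₂, h7₂]
      exact ⟨hZ.row_le (A := 0) (by omega) (by omega), hZ.row_le (by omega) (by omega),
        hZ.cell_le (e := 0) (by omega) (by omega)⟩
    · simp [runOps, Op.apply, hE₂.r6, hE₂.r0, hi, h9₂, h7₂]
    rintro s₃ ⟨h9₃, h14₃, h10₃, harr₃⟩ hF₃ -
    have hE₃ := hE₂.frame hF₃ (by decide)
    have hT₃ := hT₂.frame hF₃ rfl rfl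
    refine .seqs_cons (runs_emitNode hZ hE₃ hT₃ hq hA'lt hAL h14₃ (L := L)
      ⟨hL.nodup, by rw [h10₃, hL.length], by rw [harr₃]; exact hL.out,
        by rw [harr₃]; exact hL.mark⟩) ?_
    rintro s₄ ⟨L', hL', hsub, hcost'⟩ hF₄ -
    have h9₄ : s₄.reg 9 = A' := (hF₄.reg 9 rfl).trans h9₃
    refine .seqs_nil ⟨A', L', hA'lt, by simpa using h9₄, ⟨hL'.nodup, by simpa using hL'.length,
      by simpa using hL'.out, by simpa using hL'.mark⟩, hsub, ?_, ?_⟩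
    · rw [if_pos (by omega)] at hcost
      by_cases hjN : j + 1 ≤ N
      · rw [if_pos hjN]
        -- The stored successor attains the minimum, so the remaining length drops by exactly the
        -- length of the step taken.
        have hstep : pathCost n k Q N num den rk (N - j) A =
            stepCost n k Q num den rk A A' + pathCost n k Q N num den rk (N - (j + 1)) A' := by
          rw [hA', show N - j = (N - (j + 1)) + 1 by omega]
          exact bestStep_eq (stepCost_self A)
        rw [hstep] at hcost
        have : stepCost n k Q num den rk A A' =
          #(node (n + 1) Q (fun e : Fin n => rk e) A' \
            node (n + 1) Q (fun e : Fin n => rk e) A) *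
            q (node (n + 1) Q (fun e : Fin n => rk e) A) := rfl
        omega
      · rw [if_neg hjN]
        -- Last round: at most `n` variables are still missing, paid by the term n*q of the end of
        -- the path.
        have hj0 : N - j = 0 := by omega
        rw [hj0] at hcost
        have h1 : pathCost n k Q N num den rk 0 A =
          n * q (node (n + 1) Q (fun e : Fin n => rk e) A) := rfl
        have h2 : #(node (n + 1) Q (fun e : Fin n => rk e) A' \
            node (n + 1) Q (fun e : Fin n => rk e) A) *
            q (node (n + 1) Q (fun e : Fin n => rk e) A) ≤
            n * q (node (n + 1) Q (fun e : Fin n => rk e) A) := by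
          refine Nat.mul_le_mul_right _ ?_
          simpa using card_le_univ (node (n + 1) Q (fun e : Fin n => rk e) A' \
            node (n + 1) Q (fun e : Fin n => rk e) A)
        omega
    · intro hjN
      have hj0 : N - j = 0 := by omega
      rw [hA', hj0]
      rfl
  · rintro s₂ ⟨A, L, hA, h9₂, hL, hAL, hcost, hAfull⟩ - -
    refine .seqs_nil ⟨L, hL, fun e => ?_, ?_⟩
    · rw [hAfull rfl, node_full (fun e => hZ.rk_lt e e.2) hQ] at hAL
      simpa using hAL (mem_univ e)
    · omega

end

end KOfN

namespace KOfN

open Finset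

/-! #### The whole program -/

/-- Computes a nearly optimal order. -/
def progOrder : Prog := .seqs [progSetup, progRanks, progTables, progDP, progEmit]

/-! ### Correctness on the given input -/

section

variable {n k m : ℕ} {p : Fin n → ℚ}

theorem inputMem_num (e : Fin n) : (inputMem k p m).arr 0 e = (p e).num.natAbs := by
  simp [inputMem]

theorem inputMem_den (e : Fin n) : (inputMem k p m).arr 1 e = (p e).den := by
  simp [inputMem]

theorem ratCast_eq_div (hp : ∀ i, 0 < p i ∧ p i < 1) (e : Fin n) :
    (((p e).num.natAbs : ℕ) : ℚ) / ((p e).den : ℚ) = p e := by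
  have h : (((p e).num.natAbs : ℕ) : ℚ) = (p e).num := by
    rw [← Int.cast_natCast, Int.natAbs_of_nonneg (Rat.num_nonneg.2 (hp e).1.le)]
  rw [h, Rat.num_div_den]

theorem natAbs_num_le_den (hp : ∀ i, 0 < p i ∧ p i < 1) (e : Fin n) :
    (p e).num.natAbs ≤ (p e).den := by
  have h := (hp e).2.le
  rw [← ratCast_eq_div hp e, div_le_one (by exact_mod_cast (p e).den_pos)] at h
  exact_mod_cast h

/-- Cross-multiplied numerators are compared as leading parts and indices below `n` as trailing
digits, so one comparison of numbers is the lexicographic order. Breaking ties by index makes the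
ranks injective. -/
theorem before_iff (hp : ∀ i, 0 < p i ∧ p i < 1) (f e : Fin n) :
    Before ((inputMem k p m).arr 0) ((inputMem k p m).arr 1) n f e ↔
      toLex (p f, f) < toLex (p e, e) := by
  unfold Before
  rw [inputMem_num, inputMem_num, inputMem_den, inputMem_den, Prod.Lex.toLex_lt_toLex]
  have hf := ratCast_eq_div hp f
  have he := ratCast_eq_div hp e
  have hdf : (0 : ℚ) < (p f).den := by exact_mod_cast (p f).den_pos
  have hde : (0 : ℚ) < (p e).den := by exact_mod_cast (p e).den_pos
  have hlt : p f < p e ↔ (p f).num.natAbs * (p e).den < (p e).num.natAbs * (p f).den := by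
    rw [← hf, ← he, div_lt_div_iff₀ hdf hde, hf, he]
    exact_mod_cast Iff.rfl
  have heq : p f = p e ↔ (p f).num.natAbs * (p e).den = (p e).num.natAbs * (p f).den := by
    rw [← hf, ← he, div_eq_div_iff hdf.ne' hde.ne', hf, he]
    exact_mod_cast Iff.rfl
  dsimp only
  rw [hlt, heq, Fin.lt_def]
  set u := (p f).num.natAbs * (p e).den
  set v := (p e).num.natAbs * (p f).den
  have h1 := f.2
  have h2 := e.2
  rcases lt_trichotomy u v with h | h | h
  · have : (u + 1) * n ≤ v * n := Nat.mul_le_mul_right _ h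
    rw [add_mul, one_mul] at this
    omega
  · rw [h]
    omega
  · have : (v + 1) * n ≤ u * n := Nat.mul_le_mul_right _ h
    rw [add_mul, one_mul] at this
    omega

theorem rankOf_eq (hp : ∀ i, 0 < p i ∧ p i < 1) (e : Fin n) :
    rankOf ((inputMem k p m).arr 0) ((inputMem k p m).arr 1) n e =
      #{f ∈ (univ : Finset (Fin n)) | toLex (p f, f) < toLex (p e, e)} := by
  unfold rankOf
  rw [card_filter, card_filter, sum_range]
  simp only [before_iff hp]

theorem toLex_pair_injective : Function.Injective fun e : Fin n => toLex (p e, e) := by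
  intro e f h
  exact congrArg Prod.snd (toLex.injective h)

theorem rankOf_injective (hp : ∀ i, 0 < p i ∧ p i < 1) : Function.Injective
    fun e : Fin n => rankOf ((inputMem k p m).arr 0) ((inputMem k p m).arr 1) n e := by
  intro e f h
  simp only [rankOf_eq hp] at h
  exact injOn_card_below toLex_pair_injective univ (by simp) (by simp) h

theorem rankOf_lt (hp : ∀ i, 0 < p i ∧ p i < 1) (e : Fin n) :
    rankOf ((inputMem k p m).arr 0) ((inputMem k p m).arr 1) n e < n := by
  rw [rankOf_eq hp]
  have h := image_card_below (toLex_pair_injective (p := p)) univ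
  have h' := h ▸ mem_image_of_mem _ (mem_univ e)
  simpa using h'

theorem le_of_rankOf_le (hp : ∀ i, 0 < p i ∧ p i < 1) {e f : Fin n}
    (h : rankOf ((inputMem k p m).arr 0) ((inputMem k p m).arr 1) n e ≤
      rankOf ((inputMem k p m).arr 0) ((inputMem k p m).arr 1) n f) : p e ≤ p f := by
  rw [rankOf_eq hp, rankOf_eq hp] at h
  have hle : toLex (p e, e) ≤ toLex (p f, f) := by
    by_contra hlt
    have := card_below_lt (rk := fun e : Fin n => toLex (p e, e)) (mem_univ f) (not_le.1 hlt)
    omega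
  rcases Prod.Lex.toLex_le_toLex.1 hle with h' | h'
  · exact h'.le
  · exact h'.1.le

/-! ### The bounds for loop lengths and values -/

/-- The number of nodes. -/
def nodeCount (n m : ℕ) : ℕ := ((n + 1) * (n + 1)) ^ 2 ^ (6 * m + 1)

/-- A bound for all values that occur. -/
def valueBound (m : ℕ) (p : Fin n → ℚ) : ℕ :=
  (nodeCount n m + 2) ^ 2 * (∏ e, (p e).den + 1) ^ (n + 3)

theorem pow_le_nodeCount (m : ℕ) {c : ℕ} (hc : c ≤ 2 ^ (6 * m + 2)) :
    (n + 1) ^ c ≤ nodeCount n m := by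
  unfold nodeCount
  rw [← pow_two, ← pow_mul, ← pow_succ']
  exact Nat.pow_le_pow_right (by omega) hc

/-- The left-hand side bounds the number of steps in `exists_reach` for `w = 6 * m`, so as many
rounds as there are nodes suffice. -/
theorem two_pow_mul_le_nodeCount (hn : 1 ≤ n) (m : ℕ) : 2 ^ (6 * m) * (n + 1) ≤ nodeCount n m := by
  have h1 : 2 ^ (6 * m) ≤ (n + 1) ^ (6 * m) := Nat.pow_le_pow_left (by omega) _
  have h2 : 6 * m + 1 < 2 ^ (6 * m + 1) := Nat.lt_two_pow_self
  calc _ ≤ (n + 1) ^ (6 * m) * (n + 1) := Nat.mul_le_mul_right _ h1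
    _ = (n + 1) ^ (6 * m + 1) := (pow_succ _ _).symm
    _ ≤ _ := pow_le_nodeCount m (by rw [pow_succ]; omega)

/-- In `valueBound` the first factor covers the addresses in the tables, and the power of the base
covers the product of the denominators times X^n. -/
theorem sizes_input (hn : 1 ≤ n) (hk : k ≤ n) (hp : ∀ i, 0 < p i ∧ p i < 1) :
    Sizes n k (2 ^ (6 * m + 1)) (nodeCount n m) (∏ e, (p e).den + 1) (valueBound m p)
      (nodeCount n m + 1) ((inputMem k p m).arr 0) ((inputMem k p m).arr 1)
      (rankOf ((inputMem k p m).arr 0) ((inputMem k p m).arr 1) n) := by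
  have hprod : ∏ e ∈ range n, (inputMem k p m).arr 1 e = ∏ e, (p e).den := by
    rw [prod_range]
    exact prod_congr rfl fun e _ => inputMem_den e
  have hnN : (n + 1) ^ 2 ≤ nodeCount n m := by
    refine pow_le_nodeCount m ?_
    rw [pow_succ]
    have := Nat.one_le_two_pow (n := 6 * m + 1)
    omega
  have hX : 1 ≤ ∏ e, (p e).den + 1 := by omega
  have hpow : ∀ c ≤ n + 3, (∏ e, (p e).den + 1) ^ c ≤ valueBound m p := by
    intro c hc
    unfold valueBound
    have h1 := Nat.pow_le_pow_right hX hc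
    exact h1.trans (Nat.le_mul_of_pos_left _ (by positivity))
  refine ⟨hk, by nlinarith, ?_, by omega, ?_, by rw [hprod], ?_, ?_, ?_, ?_, ?_, ?_⟩
  · have h1 : (2 : ℕ) ^ (6 * m + 1) ≤ (n + 1) ^ (6 * m + 1) := Nat.pow_le_pow_left (by omega) _
    refine h1.trans (pow_le_nodeCount m ?_)
    have h2 : 6 * m + 1 < 2 ^ (6 * m + 1) := Nat.lt_two_pow_self
    rw [pow_succ]
    omega
  · unfold valueBound
    rw [← pow_two]
    exact Nat.le_mul_of_pos_right _ (by positivity)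
  · rw [← pow_two]
    exact hpow 2 (by omega)
  · rw [hprod]
    refine le_trans ?_ (hpow (n + 1) (by omega))
    rw [pow_succ']
    exact Nat.mul_le_mul_right _ (by omega)
  · rw [hprod]
    unfold valueBound
    have h1 : ∏ e, (p e).den + 1 ≤ (∏ e, (p e).den + 1) ^ (n + 3) := Nat.le_self_pow (by omega) _
    refine Nat.mul_le_mul (by nlinarith) (by omega)
  · intro e he
    have h1 := natAbs_num_le_den hp ⟨e, he⟩
    rwa [← inputMem_num (k := k) (m := m), ← inputMem_den (k := k) (m := m)] at h1
  · intro e he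
    have h1 := (p ⟨e, he⟩).den_pos
    rwa [← inputMem_den (k := k) (m := m)] at h1
  · intro e he
    exact rankOf_lt hp ⟨e, he⟩

theorem inputMem_bounded (hn : 1 ≤ n) (hk : k ≤ n) (hp : ∀ i, 0 < p i ∧ p i < 1) :
    Bounded (valueBound m p) (inputMem k p m) := by
  have hZ := sizes_input (m := m) hn hk hp
  have hsmall := hZ.small_le
  have hden : ∀ e : Fin n, (p e).den ≤ valueBound m p := by
    intro e
    have h1 := hZ.den_le e.2
    rw [inputMem_den] at h1
    have h2 := hZ.X_eq
    have h3 := hZ.XX_le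
    nlinarith
  -- The accuracy parameter is itself a register value; it is below `Q`.
  have hm : m ≤ valueBound m p := by
    have h1 := hZ.Q_le
    have h2 : 6 * m + 1 < 2 ^ (6 * m + 1) := Nat.lt_two_pow_self
    have h3 := hZ.row_le (r := 0) (A := nodeCount n m) (by omega) le_rfl
    omega
  constructor
  · intro r
    simp only [inputMem]
    split_ifs <;> omega
  · intro a i
    simp only [inputMem]
    split_ifs with h1 h2 h3
    · exact (natAbs_num_le_den hp _).trans (hden _)
    · exact hden _
    · omega
    · omega

/-- The domination bound for probabilities, multiplied by the common denominator. -/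
theorem scaledUndet_le_of_dominates (hk : k ≤ n) (hp : ∀ i, 0 < p i ∧ p i < 1)
    {S S' : Finset (Fin n)}
    (h : Dominates (fun e : Fin n =>
      rankOf ((inputMem k p m).arr 0) ((inputMem k p m).arr 1) n e) S' S) :
    scaledUndet (fun e : Fin n => (inputMem k p m).arr 0 e)
      (fun e : Fin n => (inputMem k p m).arr 1 e) k S' ≤
    scaledUndet (fun e : Fin n => (inputMem k p m).arr 0 e)
      (fun e : Fin n => (inputMem k p m).arr 1 e) k S := by
  have hp' : ∀ i, 0 ≤ (p i : ℝ) ∧ (p i : ℝ) ≤ 1 := fun i =>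
    ⟨by exact_mod_cast (hp i).1.le, by exact_mod_cast (hp i).2.le⟩
  have hu := undet_le_of_dominates hk hp'
    (fun i j hij => by exact_mod_cast le_of_rankOf_le hp hij) h
  have hcast := cast_scaledUndet (a := fun e : Fin n => (p e).num.natAbs)
    (d := fun e : Fin n => (p e).den) (p := fun i => (p i : ℝ)) (natAbs_num_le_den hp)
    (fun i => (p i).den_pos) (fun i => by
      rw [← ratCast_eq_div hp i]
      push_cast
      rw [ratCast_eq_div hp i]) k
  simp only [inputMem_num, inputMem_den]
  have hle : (scaledUndet (fun e : Fin n => (p e).num.natAbs) (fun e : Fin n => (p e).den) k S' :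
      ℝ) ≤ scaledUndet (fun e : Fin n => (p e).num.natAbs) (fun e : Fin n => (p e).den) k S := by
    rw [hcast, hcast]
    exact mul_le_mul_of_nonneg_left hu (prod_nonneg fun i _ => by positivity)
  exact_mod_cast hle

theorem runs_order (hn : 1 ≤ n) (hk : k ≤ n) (hp : ∀ i, 0 < p i ∧ p i < 1) :
    Runs (valueBound m p) (nodeCount n m + 1) progOrder (inputMem k p m) (fun s' =>
      ∃ L : List (Fin n), Listed L s' ∧ (∀ e, e ∈ L) ∧
        listCost (scaledUndet (fun e : Fin n => (inputMem k p m).arr 0 e)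
          (fun e : Fin n => (inputMem k p m).arr 1 e) k) L ≤
        pathCost n k (2 ^ (6 * m + 1)) (nodeCount n m) ((inputMem k p m).arr 0)
          ((inputMem k p m).arr 1)
          (rankOf ((inputMem k p m).arr 0) ((inputMem k p m).arr 1) n) (nodeCount n m) 0) := by
  have hZ := sizes_input (m := m) hn hk hp
  set num := (inputMem k p m).arr 0 with hnum
  set den := (inputMem k p m).arr 1 with hden
  have hnN := hZ.n_le
  have hXeq := hZ.X_eq
  have hV : nodeCount n m + 1 ≤ valueBound m p := by
    have := hZ.row_le (r := 1) (A := 1) (by omega) (by have := hZ.full_lt; omega)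
    omega
  have hr0 : (inputMem k p m).reg 0 = n := by simp [inputMem]
  have hr1 : (inputMem k p m).reg 1 = k := by simp [inputMem]
  have hr2 : (inputMem k p m).reg 2 = m := by simp [inputMem]
  have harr : ∀ a, a ≠ 0 → a ≠ 1 → ∀ i, (inputMem k p m).arr a i = 0 := by
    intro a h0 h1 i
    simp [inputMem, h0, h1]
  refine .seqs_cons (runs_setup hr0 hr2 hn (Nat.le_succ _) hV) ?_
  rintro s₁ ⟨h3, h4, h5, h6⟩ hF₁ -
  have hX : ∏ e, (p e).den + 1 ≤ valueBound m p := by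
    have h1 := hZ.XX_le
    nlinarith
  refine .seqs_cons (runs_ranks ((hF₁.reg 0 rfl).trans hr0) h3 (hF₁.arr 0 rfl) (hF₁.arr 1 rfl)
    hZ.den_pos (by omega) ?_ (by rw [← hXeq]; exact hX)) ?_
  · intro e he f hf
    change num f * den e * n + n ≤ _
    have h1 := hZ.den_le he
    have h2 := (hZ.num_le f hf).trans (hZ.den_le hf)
    have h3 : num f * den e ≤ (∏ e, (p e).den) * ∏ e, (p e).den := by
      rw [Nat.succ_injective hXeq]
      exact Nat.mul_le_mul h2 h1
    have h4 : num f * den e * n + n ≤ (nodeCount n m + 2) ^ 2 *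
        (∏ e, (p e).den + 1) ^ 2 := by
      have h5 : num f * den e + 1 ≤ (∏ e, (p e).den + 1) ^ 2 := by nlinarith
      have h6 : n ≤ (nodeCount n m + 2) ^ 2 := by nlinarith
      calc _ = n * (num f * den e + 1) := by ring
        _ ≤ _ := Nat.mul_le_mul h6 h5
    exact h4.trans (Nat.mul_le_mul_left _ (Nat.pow_le_pow_right (by omega) (by omega)))
  rintro s₂ ⟨h3₂, h7₂⟩ hF₂ -
  have hE : Env n k (2 ^ (6 * m + 1)) (nodeCount n m) (∏ e, (p e).den + 1) num den
      (rankOf num den n) s₂ :=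
    ⟨((hF₂.reg 0 rfl).trans (hF₁.reg 0 rfl)).trans hr0,
      ((hF₂.reg 1 rfl).trans (hF₁.reg 1 rfl)).trans hr1, (hF₂.reg 3 rfl).trans h3,
      (hF₂.reg 4 rfl).trans h4, (hF₂.reg 5 rfl).trans h5, (hF₂.reg 6 rfl).trans h6,
      h7₂.trans hXeq.symm, (hF₂.arr 0 rfl).trans (hF₁.arr 0 rfl),
      (hF₂.arr 1 rfl).trans (hF₁.arr 1 rfl), h3₂⟩
  refine .seqs_cons (runs_tables hZ hE) ?_
  intro s₃ h₃ hF₃ _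
  have hE₃ := hE.frame hF₃ (by decide)
  have hT₃ : Tables n k (2 ^ (6 * m + 1)) (nodeCount n m) num den (rankOf num den n) s₃ :=
    ⟨fun A hA => (h₃ A hA).1, fun A hA => (h₃ A hA).2.1⟩
  refine .seqs_cons (runs_DP hZ hE₃ hT₃ fun A hA => (h₃ A hA).2.2) ?_
  intro s₄ h₄ hF₄ _
  have hE₄ := hE₃.frame hF₄ (by decide)
  have hT₄ := hT₃.frame hF₄ rfl rfl
  refine .seqs_cons (runs_emit hZ hE₄ hT₄ (by positivity)
    (fun S S' h => scaledUndet_le_of_dominates hk hp (.of_subset _ h)) h₄ ?_)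
    (fun s₅ h _ _ => .seqs_nil h)
  intro e _
  rw [hF₄.arr 8 rfl, hF₃.arr 8 rfl, hF₂.arr 8 rfl, hF₁.arr 8 rfl]
  exact harr 8 (by decide) (by decide) e

/-- The path found by the dynamic program is nearly as short as every order. -/
theorem mul_pathCost_le (hn : 1 ≤ n) (hk : k ≤ n) (hm : 1 ≤ m) (hp : ∀ i, 0 < p i ∧ p i < 1)
    (τ : Equiv.Perm (Fin n)) :
    m * pathCost n k (2 ^ (6 * m + 1)) (nodeCount n m) ((inputMem k p m).arr 0)
        ((inputMem k p m).arr 1)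
        (rankOf ((inputMem k p m).arr 0) ((inputMem k p m).arr 1) n) (nodeCount n m) 0 ≤
      (m + 1) * ∑ t ∈ range n, scaledUndet (fun e : Fin n => (inputMem k p m).arr 0 e)
        (fun e : Fin n => (inputMem k p m).arr 1 e) k (pre τ t) := by
  have hZ := sizes_input (m := m) hn hk hp
  have hfull : scaledUndet (fun e : Fin n => (inputMem k p m).arr 0 e)
      (fun e : Fin n => (inputMem k p m).arr 1 e) k univ = 0 := by
    have h := cast_scaledUndet (p := fun e : Fin n =>
      ((inputMem k p m).arr 0 e : ℝ) / ((inputMem k p m).arr 1 e : ℝ))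
      (fun e : Fin n => hZ.num_le e e.2) (fun e : Fin n => hZ.den_pos e e.2) (fun _ => rfl) k univ
    rw [undet_univ, mul_zero] at h
    exact_mod_cast h
  obtain ⟨r, v, hr, hreach, hv⟩ := exists_reach (rankOf_injective (k := k) (m := m) hp)
    (rankOf_lt hp) (fun S S' h => scaledUndet_le_of_dominates hk hp h) hfull τ
    (w := 6 * m) (Q := 2 ^ (6 * m + 1)) (by omega)
    (by rw [pow_succ]; have := Nat.one_le_two_pow (n := 6 * m); omega)
  have h1 := dist_le_of_reach hreach (A := 0) (node_zero _)
  have h2 : pathCost n k (2 ^ (6 * m + 1)) (nodeCount n m) ((inputMem k p m).arr 0)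
        ((inputMem k p m).arr 1)
        (rankOf ((inputMem k p m).arr 0) ((inputMem k p m).arr 1) n) (nodeCount n m) 0 ≤ v :=
    (dist_anti (hr.trans (two_pow_mul_le_nodeCount hn m)) 0).trans h1
  -- With w = 6m the path bound reads 6m * v ≤ (6m + 6) * cost; dividing by 6 gives the claim.
  have h3 := Nat.mul_le_mul_left (6 * m) h2
  nlinarith

end

end KOfN

/-! ### Approximation factor and running time -/

namespace KOfN

open Finset

section

variable {n k m : ℕ} {p : Fin n → ℚ}

/-- A complete output list whose cost is at most the path length is an order within the factor
`1 + 1 / m` of the optimum. -/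
theorem exists_perm_of_listed (hn : 1 ≤ n) (hk : k ≤ n) (hm : 1 ≤ m)
    (hp : ∀ i, 0 < p i ∧ p i < 1) {L : List (Fin n)} {s : Mem} (hL : Listed L s)
    (hall : ∀ e, e ∈ L)
    (hcost : listCost (scaledUndet (fun e : Fin n => (inputMem k p m).arr 0 e)
          (fun e : Fin n => (inputMem k p m).arr 1 e) k) L ≤
        pathCost n k (2 ^ (6 * m + 1)) (nodeCount n m) ((inputMem k p m).arr 0)
          ((inputMem k p m).arr 1)
          (rankOf ((inputMem k p m).arr 0) ((inputMem k p m).arr 1) n) (nodeCount n m) 0) :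
    ∃ σ : Equiv.Perm (Fin n), Outputs s σ ∧ ∀ τ : Equiv.Perm (Fin n),
      m * expectedCost (kOfN n k) (fun i => (p i : ℝ)) (fun _ => 1) σ ≤
        (m + 1) * expectedCost (kOfN n k) (fun i => (p i : ℝ)) (fun _ => 1) τ := by
  have hlen : L.length = n := by
    have h1 : L.toFinset = univ := by
      ext e
      simp [hall e]
    rw [← List.toFinset_card_of_nodup hL.nodup, h1, card_univ, Fintype.card_fin]
  obtain ⟨σ, hσ, hsum⟩ := exists_perm_of_list hL.nodup hlen
  refine ⟨σ, fun i => ?_, fun τ => ?_⟩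
  · rw [hL.out i (by omega), hσ i]
  have hN : m * ∑ t ∈ range n, scaledUndet (fun e : Fin n => (inputMem k p m).arr 0 e)
        (fun e : Fin n => (inputMem k p m).arr 1 e) k (pre σ t) ≤
      (m + 1) * ∑ t ∈ range n, scaledUndet (fun e : Fin n => (inputMem k p m).arr 0 e)
        (fun e : Fin n => (inputMem k p m).arr 1 e) k (pre τ t) := by
    rw [hsum]
    exact (Nat.mul_le_mul_left m hcost).trans (mul_pathCost_le hn hk hm hp τ)
  simp only [inputMem_num, inputMem_den] at hN
  have hcast := cast_scaledUndet (a := fun e : Fin n => (p e).num.natAbs)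
    (d := fun e : Fin n => (p e).den) (p := fun i => (p i : ℝ)) (natAbs_num_le_den hp)
    (fun i => (p i).den_pos) (fun i => by
      rw [← ratCast_eq_div hp i]
      push_cast
      rw [ratCast_eq_div hp i]) k
  have hR : (m : ℝ) * ∑ t ∈ range n, (scaledUndet (fun e : Fin n => (p e).num.natAbs)
        (fun e : Fin n => (p e).den) k (pre σ t) : ℝ) ≤
      (m + 1) * ∑ t ∈ range n, (scaledUndet (fun e : Fin n => (p e).num.natAbs)
        (fun e : Fin n => (p e).den) k (pre τ t) : ℝ) := by
    exact_mod_cast hN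
  simp only [hcast, ← mul_sum] at hR
  rw [expectedCost_eq_sum_undet, expectedCost_eq_sum_undet]
  have hD : (0 : ℝ) < ∏ i, ((p i).den : ℝ) :=
    prod_pos fun i _ => by exact_mod_cast (p i).den_pos
  refine le_of_mul_le_mul_left ?_ hD
  linarith

theorem prod_den_succ_le : ∏ e, (p e).den + 1 ≤ 2 ^ (encLength k p + 1) := by
  have h1 : ∏ e, (p e).den ≤ 2 ^ ∑ e, (p e).den.size := by
    rw [← prod_pow_eq_pow_sum]
    exact prod_le_prod' fun e _ => Nat.lt_size_self _ |>.le
  have h2 : ∑ e, (p e).den.size ≤ encLength k p := by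
    unfold encLength
    rw [sum_add_distrib]
    omega
  have h3 := Nat.pow_le_pow_right (n := 2) (by norm_num) h2
  have h4 := Nat.one_le_two_pow (n := encLength k p)
  rw [pow_succ]
  omega

/-- The product of the denominators has bit length at most `encLength`, and its exponent n+3 is
polynomial in the number of nodes; so the encoding length enters only linearly. -/
theorem size_valueBound_le (hn : 1 ≤ n) (hnN : n ≤ nodeCount n m) :
    1 + (valueBound m p).size ≤ (encLength k p + 1) * (nodeCount n m + 3) ^ 3 := by
  set N := nodeCount n m
  set l := encLength k p + 1
  have h1 : (valueBound m p).size ≤ 2 * (N + 2) + l * (n + 3) := by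
    rw [Nat.size_le, pow_add, mul_comm 2, pow_mul, pow_mul]
    unfold valueBound
    refine Nat.mul_lt_mul_of_lt_of_le
      (Nat.pow_lt_pow_left Nat.lt_two_pow_self (by norm_num))
      (Nat.pow_le_pow_left prod_den_succ_le _) (by positivity)
  have hl : 1 ≤ l := Nat.succ_le_succ (Nat.zero_le _)
  calc _ ≤ l * (3 * N + 8) := by nlinarith
    _ ≤ _ := Nat.mul_le_mul_left _ (by ring_nf; nlinarith [Nat.zero_le (N ^ 3)])

/-- Since N ≥ 4, N+3 ≤ N^2. As `N` is a power of n+1 with exponent 2^(6m+2), the power `c`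
multiplies this exponent by less than 2^c, adding only `c` at the top of the tower. -/
theorem nodeCount_pow_le (hn : 1 ≤ n) (c : ℕ) :
    (nodeCount n m + 3) ^ c ≤ (n + 1) ^ 2 ^ (6 * m + c + 3) := by
  have hN : 4 ≤ nodeCount n m := by
    have h1 : 4 ≤ (n + 1) * (n + 1) := by nlinarith
    exact h1.trans (Nat.le_self_pow (by positivity) _)
  calc (nodeCount n m + 3) ^ c ≤ (nodeCount n m ^ 2) ^ c :=
        Nat.pow_le_pow_left (by nlinarith) _
    _ = (n + 1) ^ (2 * 2 ^ (6 * m + 1) * 2 * c) := by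
        unfold nodeCount
        rw [← pow_two, ← pow_mul, ← pow_mul, ← pow_mul, mul_assoc, mul_assoc]
    _ ≤ _ := by
        refine Nat.pow_le_pow_right (by omega) ?_
        have h1 : c < 2 ^ c := Nat.lt_two_pow_self
        calc 2 * 2 ^ (6 * m + 1) * 2 * c = 2 ^ (6 * m + 3) * c := by ring
          _ ≤ 2 ^ (6 * m + 3) * 2 ^ c := Nat.mul_le_mul_left _ h1.le
          _ = _ := by ring

end

theorem cast_pow_two_pow_le {n e : ℕ} {y : ℝ} (h : (e : ℝ) ≤ y) :
    (((n + 1) ^ 2 ^ e : ℕ) : ℝ) ≤ ((n : ℝ) + 1) ^ ((2 : ℝ) ^ y) := by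
  have h1 : ((2 ^ e : ℕ) : ℝ) ≤ (2 : ℝ) ^ y := by
    push_cast
    rw [← Real.rpow_natCast]
    exact Real.rpow_le_rpow_of_exponent_le one_le_two h
  rw [Nat.cast_pow, Nat.cast_succ, ← Real.rpow_natCast]
  exact Real.rpow_le_rpow_of_exponent_le (by linarith [Nat.cast_nonneg (α := ℝ) n]) h1

theorem expectedCost_nonneg {n k : ℕ} {p : Fin n → ℝ} (hp : ∀ i, 0 ≤ p i ∧ p i ≤ 1)
    (σ : Equiv.Perm (Fin n)) : 0 ≤ expectedCost (kOfN n k) p (fun _ => 1) σ := by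
  refine sum_nonneg fun x _ => mul_nonneg (prod_nonneg fun i _ => ?_)
    (sum_nonneg fun _ _ => zero_le_one)
  split_ifs
  · exact (hp i).1
  · linarith [(hp i).2]

end KOfN

theorem theorem2 :
    ∃ (P : KOfN.Prog) (C : ℕ),
      ∀ (n k : ℕ) (p : Fin n → ℚ) (ε : ℝ),
        1 ≤ k → k ≤ n → (∀ i, 0 < p i ∧ p i < 1) → 0 < ε →
        ∃ (s : KOfN.Mem) (steps bits : ℕ) (σ : Equiv.Perm (Fin n)),
          KOfN.Exec P (KOfN.inputMem k p ⌈1 / ε⌉₊) s steps bits ∧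
          KOfN.Outputs s σ ∧
          (∀ τ : Equiv.Perm (Fin n),
            KOfN.expectedCost (KOfN.kOfN n k) (fun i => (p i : ℝ)) (fun _ => 1) σ ≤
              (1 + ε) *
                KOfN.expectedCost (KOfN.kOfN n k) (fun i => (p i : ℝ)) (fun _ => 1) τ) ∧
          (steps : ℝ) ≤ ((n : ℝ) + 1) ^ ((2 : ℝ) ^ ((C : ℝ) * max 1 (1 / ε))) ∧
          (bits : ℝ) ≤ ((n : ℝ) + 1) ^ ((2 : ℝ) ^ ((C : ℝ) * max 1 (1 / ε))) *
            ((KOfN.encLength k p : ℝ) + 1) ^ C := by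
  obtain ⟨c, hc⟩ := KOfN.Prog.time_le KOfN.progOrder
  -- The exponent needed is 6m + (c+6) + 3, and m ≤ 2x with x = max 1 (1/ε), so (c + 21)*x suffices.
  refine ⟨KOfN.progOrder, c + 21, fun n k p ε hk1 hk hp hε => ?_⟩
  have hn : 1 ≤ n := hk1.trans hk
  set m := ⌈1 / ε⌉₊ with hm
  set x := max 1 (1 / ε) with hx
  have hx1 : 1 ≤ x := le_max_left _ _
  have hmε : 1 / ε ≤ m := Nat.le_ceil _
  have hm1 : 1 ≤ m := Nat.ceil_pos.2 (by positivity)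
  have hmx : (m : ℝ) ≤ 2 * x := by
    have h1 : (m : ℝ) < 1 / ε + 1 := Nat.ceil_lt_add_one (by positivity)
    have h2 : 1 / ε ≤ x := le_max_right _ _
    linarith
  obtain ⟨s, t, b, hex, ht, hb, -, L, hL, hall, hcost⟩ :=
    KOfN.runs_order (m := m) hn hk hp (KOfN.inputMem_bounded hn hk hp)
  obtain ⟨σ, hout, happ⟩ := KOfN.exists_perm_of_listed hn hk hm1 hp hL hall hcost
  have hnN := (KOfN.sizes_input (m := m) hn hk hp).n_le
  have hexp : ((6 * m + (c + 6) + 3 : ℕ) : ℝ) ≤ ((c + 21 : ℕ) : ℝ) * x := by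
    push_cast
    nlinarith [Nat.cast_nonneg (α := ℝ) c]
  have hbound := (Nat.cast_le (α := ℝ).2 (KOfN.nodeCount_pow_le (m := m) hn (c + 6))).trans
    (KOfN.cast_pow_two_pow_le hexp)
  have ht' : t ≤ (KOfN.nodeCount n m + 3) ^ c := ht.trans (hc _)
  refine ⟨s, t, b, σ, hex, hout, fun τ => ?_, ?_, ?_⟩
  · have h1 := happ τ
    have hτ := KOfN.expectedCost_nonneg (k := k) (p := fun i => (p i : ℝ))
      (fun i => ⟨by exact_mod_cast (hp i).1.le, by exact_mod_cast (hp i).2.le⟩) τ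
    set E := KOfN.expectedCost (KOfN.kOfN n k) (fun i => (p i : ℝ)) (fun _ => 1) τ
    have hm0 : (0 : ℝ) < m := by exact_mod_cast hm1
    refine le_of_mul_le_mul_left (h1.trans ?_) hm0
    -- This turns the factor 1+1/m into 1+ε.
    have h2 : 1 ≤ m * ε := by rwa [div_le_iff₀ hε] at hmε
    nlinarith
  · refine le_trans ?_ hbound
    exact Nat.cast_le.2 (ht'.trans (Nat.pow_le_pow_right (Nat.succ_pos _) (Nat.le_add_right _ _)))
  -- At most (N+3)^c steps, each costing at most the square of (encLength+1) * (N+3)^3.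
  · have h1 : b ≤ (KOfN.nodeCount n m + 3) ^ (c + 6) * (KOfN.encLength k p + 1) ^ 2 := by
      refine hb.trans ((Nat.mul_le_mul ht' (Nat.pow_le_pow_left
        (KOfN.size_valueBound_le (k := k) hn hnN) 2)).trans (le_of_eq ?_))
      ring
    have h2 : (KOfN.encLength k p + 1) ^ 2 ≤ (KOfN.encLength k p + 1) ^ (c + 21) :=
      Nat.pow_le_pow_right (by omega) (by omega)
    have h3 := h1.trans (Nat.mul_le_mul_left _ h2)
    have h4 : (b : ℝ) ≤ (((KOfN.nodeCount n m + 3) ^ (c + 6) : ℕ) : ℝ) *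
        ((KOfN.encLength k p : ℝ) + 1) ^ (c + 21) := by
      exact_mod_cast h3
    have h5 : (0 : ℝ) ≤ ((KOfN.encLength k p : ℝ) + 1) ^ (c + 21) :=
      pow_nonneg (add_nonneg (Nat.cast_nonneg _) zero_le_one) _
    exact h4.trans (mul_le_mul_of_nonneg_right hbound h5)
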